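/- Fix integers $\ell\ge 1$, $n\ge 0$ and a primitive $\ell$-th root of unity $\zeta$. Let $G(\ell,1,n)=\boldsymbol\mu_\ell\wr S_n$ be the group of $n\times n$ monomial matrices with non-zero entries in $\boldsymbol\mu_\ell$, let $\zeta_i$ be the diagonal matrix with entry $\zeta$ in position $i$ and $1$ elsewhere, and $s_i=s_{i,i+1}$, $s_{ij}$ the permutation matrices of the transpositions. The degenerate affine Hecke algebra $H_{\ell,n}$ is the $\mathbf C$-algebra generated by $\mathbf C[u_1,\dots,u_n]$ and $G(\ell,1,n)$ subject to $\zeta_iu_j=u_j\zeta_i$, $s_iu_j=u_js_i$ for $j\ne i,i+1$, and $s_iu_i=u_{i+1}s_i-\pi_i$ with $\pi_i=\sum_{k=0}^{\ell-1}\zeta_i^k\zeta_{i+1}^{-k}$. Let $\mathfrak u\subseteq H_{\ell,n}$ be the subalgebra generated by the $u_i$ and the $\zeta_i$; an $H_{\ell,n}$-module is $\mathfrak u$-diagonalizable if it has a basis of simultaneous eigenvectors for $\mathfrak u$. For $\kappa\in\mathbf C$ let $t_\kappa$ be the automorphism of $H_{\ell,n}$ with $t_\kappa(u_i)=u_i+\kappa$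 that fixes $G(\ell,1,n)$, and $M^{t_\kappa}$ the module $M$ with $h$ acting as $t_\kappa(h)$. For an $\ell$-partition $\lambda$ of $m+n$ and an $\ell$-partition $\mu\subseteq\lambda$ of $m$ let $S^\lambda,S^\mu$ be the corresponding irreducible representations of $G(\ell,1,m+n)$, $G(\ell,1,m)$ (Young's orthogonal form), and let $H_{\ell,n}$ act on $S^{\lambda\setminus\mu}=\mathrm{Hom}_{\mathbf CG(\ell,1,m)}(S^\mu,\mathrm{Res}\,S^\lambda)$ through $u_i\mapsto\phi_{m+i}$, $\zeta_i\mapsto\zeta_{m+i}$, $s_i\mapsto s_{m+i}$, where $\phi_i=\sum_{j<i}\sum_{k=0}^{\ell-1}\zeta_i^ks_{ij}\zeta_i^{-k}$. A skew shape is a finite set $D\subseteq\mathbf C^2$ such that $(x,y),(x+k,y+l)\in D$ with integers $k,l\ge 0$ implies $(x+k',y+l')\in D$ for all integers $0\le k'\le k$, $0\le l'\le l$. An $\ell$-skew shape is a sequence $D=(D^0,\dots,D^{\ell-1})$ of skew shapes; a box $b=(x,y)\in D^j$ has content $\mathrm{ct}(b)=x-y$ and coordinate $\beta(b)=j$. Two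 boxes of the same $D^j$ are adjacent if they agree in one of $x,y$ and differ by $\pm1$ in the other; the connected components of $D$ are those of this adjacency graph. A standard Young tableau on $D$, where $D$ has $n$ boxes, is a bijection $T$ from the boxes to $\{1,\dots,n\}$ with $T(b)<T(b')$ whenever $b=(x,y)\ne b'=(x',y')$ lie in the same $D^j$ and $x'-x,\,y'-y\in\mathbf Z_{\ge0}$. Let $D$ be an $\ell$-skew shape with $n$ boxes that can be normalized, that is: sliding each connected component $C$ of $D$ diagonally, by $(c_C,c_C)$ with some $c_C\in\mathbf C$, yields an $\ell$-skew shape $D'$ whose connected components are precisely the slid components and whose boxes all have positive integral $y$-coordinate. (Every $\ell$-skew shape whose boxes all have integral $y$-coordinate can be normalized.) Choose such a $D'$, let $D_1,\dots,D_k$ be its connected components in any order, and choose $\alpha_i\in\mathbf C$ and $\ell$-partitions $\mu_i\subseteq\lambda_i$ with $D_i=\lambda_i\setminus\mu_i+(\alpha_i,0)$. Let $n_i$ be the number of boxes of $D_i$, and let $A=H_{\ell,n_1}\otimes\cdots\otimes H_{\ell,n_k}$, which maps to $H_{\ell,n}$ by placing the factors on consecutive blocks of indices. Put $$S^D=\mathrm{Ind}_A^{H_{\ell,n}}\Bigl(\bigotimes_{i=1}^k\bigl(S^{\lambda_i\setminus\mu_i}\bigr)^{t_{\ell\alpha_i}}\Bigr)=H_{\ell,n}\otimes_A\Bigl(\bigotimes_{i=1}^k\bigl(S^{\lambda_i\setminus\mu_i}\bigr)^{t_{\ell\alpha_i}}\Bigr).$$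 **Theorem.** For all these choices, $S^D$ is an irreducible $\mathfrak u$-diagonalizable $H_{\ell,n}$-module. It has a $\mathbf C$-basis $(v_T)$ indexed by the standard Young tableaux $T$ on $D$ such that for $1\le i\le n$ $$u_iv_T=\ell\,\mathrm{ct}(T^{-1}(i))\,v_T,\qquad \zeta_iv_T=\zeta^{\beta(T^{-1}(i))}v_T .$$ -/

import Mathlib

namespace GHecke

/-! Permutations: a family of elements of a group that satisfies the braid relations defines a
homomorphism from the symmetric group. -/

section Coxeter

/-- The adjacent transposition `s_i = (i, i+1)` of `{0, …, n-1}`. -/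
def adjSwap {n : ℕ} (i : ℕ) (hi : i + 1 < n) : Equiv.Perm (Fin n) :=
  Equiv.swap ⟨i, Nat.lt_of_succ_lt hi⟩ ⟨i + 1, hi⟩

/-- The relations `s_i ^ 2 = 1`, `s_i s_j = s_j s_i` for `|i - j| > 1` and
`s_i s_{i+1} s_i = s_{i+1} s_i s_{i+1}` of the symmetric group on `n` letters. -/
structure BraidRel {M : Type*} [Monoid M] (n : ℕ) (S : ℕ → M) : Prop where
  sq : ∀ i, i + 1 < n → S i * S i = 1
  comm : ∀ i j, i + 1 < j → j + 1 < n → S i * S j = S j * S i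
  braid : ∀ i, i + 2 < n → S i * S (i + 1) * S i = S (i + 1) * S i * S (i + 1)

variable {M : Type*} [Monoid M]

/-- The word `S_{j+d-1} ⋯ S_{j+1} S_j`. -/
def cyc (S : ℕ → M) (j : ℕ) : ℕ → M
  | 0 => 1
  | d + 1 => S (j + d) * cyc S j d

theorem cyc_comm {n : ℕ} {S : ℕ → M} (h : BraidRel n S) (j d i : ℕ) (hi : j + d < i)
    (hin : i + 1 < n) : S i * cyc S j d = cyc S j d * S i := by
  induction d with
  | zero => simp [cyc]
  | succ d ih =>
    rw [cyc, ← mul_assoc, ← h.comm (j + d) i (by omega) hin, mul_assoc, ih (by omega), mul_assoc]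

theorem cyc_shift {n : ℕ} {S : ℕ → M} (h : BraidRel n S) (j d i : ℕ) (hj : j ≤ i)
    (hi : i + 1 < j + d) (hd : j + d < n) : S i * cyc S j d = cyc S j d * S (i + 1) := by
  induction d with
  | zero => omega
  | succ d ih =>
    rcases Nat.lt_or_ge (i + 1) (j + d) with h1 | h1
    · rw [cyc, ← mul_assoc, h.comm i (j + d) h1 (by omega), mul_assoc, ih h1 (by omega), mul_assoc]
    · obtain ⟨e, rfl⟩ : ∃ e, d = e + 1 := ⟨d - 1, by omega⟩
      obtain rfl : i = j + e := by omega
      have hb := h.braid (j + e) (by omega)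
      have hc := cyc_comm h j e (j + e + 1) (by omega) (by omega)
      simp only [cyc, ← add_assoc]
      calc S (j + e) * (S (j + e + 1) * (S (j + e) * cyc S j e))
          = (S (j + e) * S (j + e + 1) * S (j + e)) * cyc S j e := by simp only [mul_assoc]
        _ = S (j + e + 1) * S (j + e) * (S (j + e + 1) * cyc S j e) := by
            rw [hb]; simp only [mul_assoc]
        _ = S (j + e + 1) * (S (j + e) * cyc S j e) * S (j + e + 1) := by
            rw [hc]; simp only [mul_assoc]

/-- The submonoid generated by `S_j, …, S_{n-2}`. -/
def tailMon (n : ℕ) (S : ℕ → M) (j : ℕ) : Submonoid M :=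
  Submonoid.closure {x | ∃ i, j ≤ i ∧ i + 1 < n ∧ x = S i}

theorem mem_tailMon {n : ℕ} {S : ℕ → M} {j i : ℕ} (hj : j ≤ i) (hi : i + 1 < n) :
    S i ∈ tailMon n S j := Submonoid.subset_closure ⟨i, hj, hi, rfl⟩

theorem tailMon_decomp {n : ℕ} {S : ℕ → M} (h : BraidRel n S) (j : ℕ) (hjn : j < n) (x : M)
    (hx : x ∈ tailMon n S j) :
    ∃ d, j + d < n ∧ ∃ y ∈ tailMon n S (j + 1), x = cyc S j d * y := by
  induction hx using Submonoid.closure_induction_left with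
  | one => exact ⟨0, hjn, 1, Submonoid.one_mem _, by simp [cyc]⟩
  | mul_left g hg x _ ih =>
    obtain ⟨i, hji, hin, rfl⟩ := hg
    obtain ⟨d, hd, y, hy, rfl⟩ := ih
    rcases Nat.lt_trichotomy i (j + d) with h1 | h1 | h1
    · rcases Nat.lt_or_ge (i + 1) (j + d) with h2 | h2
      · refine ⟨d, hd, S (i + 1) * y, Submonoid.mul_mem _ (mem_tailMon (by omega) (by omega)) hy, ?_⟩
        rw [← mul_assoc, cyc_shift h j d i hji h2 hd, mul_assoc]
      · obtain ⟨e, rfl⟩ : ∃ e, d = e + 1 := ⟨d - 1, by omega⟩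
        obtain rfl : i = j + e := by omega
        refine ⟨e, by omega, y, hy, ?_⟩
        rw [cyc, mul_assoc, ← mul_assoc (S (j + e)), h.sq _ hin, one_mul]
    · subst h1
      exact ⟨d + 1, by omega, y, hy, by rw [cyc, mul_assoc]⟩
    · refine ⟨d, hd, S i * y, Submonoid.mul_mem _ (mem_tailMon (by omega) hin) hy, ?_⟩
      rw [← mul_assoc, cyc_comm h j d i h1 hin, mul_assoc]

/-- `s_i` as a function of an arbitrary natural number. -/
def adjSwap' (n : ℕ) (i : ℕ) : Equiv.Perm (Fin n) :=
  if h : i + 1 < n then adjSwap i h else 1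

theorem adjSwap'_eq {n i : ℕ} (h : i + 1 < n) : adjSwap' n i = adjSwap i h := dif_pos h

theorem adjSwap_apply_val {n i : ℕ} (h : i + 1 < n) (k : Fin n) :
    ((adjSwap i h k : Fin n) : ℕ) =
      if (k : ℕ) = i then i + 1 else if (k : ℕ) = i + 1 then i else k := by
  unfold adjSwap
  rw [Equiv.swap_apply_def]
  simp only [Fin.ext_iff]
  split_ifs <;> simp_all

theorem adjSwap_mul_self {n i : ℕ} (h : i + 1 < n) :
    (adjSwap i h : Equiv.Perm (Fin n)) * adjSwap i h = 1 := Equiv.swap_mul_self _ _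

theorem braidRel_adjSwap' (n : ℕ) : BraidRel n (adjSwap' n) where
  sq i hi := by rw [adjSwap'_eq hi, adjSwap_mul_self]
  comm i j hij hj := by
    rw [adjSwap'_eq hj, adjSwap'_eq (show i + 1 < n by omega)]
    ext k
    simp only [Equiv.Perm.mul_apply, adjSwap_apply_val]
    split_ifs <;> omega
  braid i hi := by
    rw [adjSwap'_eq (show i + 1 < n by omega), adjSwap'_eq (show i + 1 + 1 < n by omega)]
    ext k
    simp only [Equiv.Perm.mul_apply, adjSwap_apply_val]
    split_ifs <;> omega

theorem tailMon_fix {n : ℕ} {S : ℕ → M} {j : ℕ} (x : Equiv.Perm (Fin n) × M)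
    (hx : x ∈ tailMon n (fun i => (adjSwap' n i, S i)) (j + 1)) (k : Fin n) (hk : (k : ℕ) = j) :
    x.1 k = k := by
  induction hx using Submonoid.closure_induction with
  | mem x hx =>
    obtain ⟨i, h1, h2, rfl⟩ := hx
    ext
    simp only [adjSwap'_eq h2, adjSwap_apply_val]
    split_ifs <;> omega
  | one => rfl
  | mul x y _ _ hx hy => simp [Equiv.Perm.mul_apply, hx, hy]

theorem cyc_apply {n : ℕ} (S : ℕ → M) (j d : ℕ) (hd : j + d < n) (k : Fin n) (hk : (k : ℕ) = j) :
    (((cyc (fun i => (adjSwap' n i, S i)) j d).1 k : Fin n) : ℕ) = j + d := by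
  induction d with
  | zero => simpa [cyc] using hk
  | succ d ih =>
    have := ih (by omega)
    simp only [cyc, Prod.fst_mul, Equiv.Perm.mul_apply, adjSwap'_eq (show j + d + 1 < n by omega),
      adjSwap_apply_val, this]
    simp [add_assoc]

theorem tailMon_functional {n : ℕ} {S : ℕ → M} (h : BraidRel n S) (e : ℕ) :
    ∀ j, n ≤ j + e → ∀ x ∈ tailMon n (fun i => (adjSwap' n i, S i)) j, x.1 = 1 → x.2 = 1 := by
  have hB : BraidRel n (fun i => (adjSwap' n i, S i)) :=
    ⟨fun i hi => Prod.ext ((braidRel_adjSwap' n).sq i hi) (h.sq i hi),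
      fun i j hi hj => Prod.ext ((braidRel_adjSwap' n).comm i j hi hj) (h.comm i j hi hj),
      fun i hi => Prod.ext ((braidRel_adjSwap' n).braid i hi) (h.braid i hi)⟩
  have key : ∀ j, n ≤ j → ∀ x ∈ tailMon n (fun i => (adjSwap' n i, S i)) j, x.2 = 1 := by
    intro j hj x hx
    have : {x | ∃ i, j ≤ i ∧ i + 1 < n ∧ x = (fun i => (adjSwap' n i, S i)) i} = ∅ := by
      ext x
      simp only [Set.mem_ofPred_eq, Set.mem_empty_iff_false, iff_false]
      rintro ⟨i, h1, h2, -⟩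
      omega
    rw [tailMon, this, Submonoid.closure_empty, Submonoid.mem_bot] at hx
    rw [hx]; rfl
  induction e with
  | zero => intro j hj x hx _; exact key j hj x hx
  | succ e ih =>
    intro j hj x hx hx1
    rcases Nat.lt_or_ge j n with hjn | hjn
    · obtain ⟨d, hd, y, hy, rfl⟩ := tailMon_decomp hB j hjn x hx
      have h1 := cyc_apply S j d hd ⟨j, hjn⟩ rfl
      have h2 := tailMon_fix y hy ⟨j, hjn⟩ rfl
      rw [Prod.fst_mul] at hx1
      have h3 := congrArg (fun σ : Equiv.Perm (Fin n) => ((σ ⟨j, hjn⟩ : Fin n) : ℕ)) hx1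
      simp only [Equiv.Perm.mul_apply, h2, h1, Equiv.Perm.one_apply] at h3
      obtain rfl : d = 0 := by omega
      simp only [cyc, one_mul] at hx1 ⊢
      exact ih (j + 1) (by omega) y hy hx1
    · exact key j hjn x hx

theorem closure_adjSwap (n : ℕ) :
    Submonoid.closure {x : Equiv.Perm (Fin n) | ∃ i, 0 ≤ i ∧ i + 1 < n ∧ x = adjSwap' n i} = ⊤ := by
  cases n with
  | zero => exact Subsingleton.elim _ _
  | succ m =>
    rw [eq_top_iff, ← Equiv.Perm.mclosure_swap_castSucc_succ m]
    apply Submonoid.closure_mono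
    rintro _ ⟨i, rfl⟩
    have hi : (i : ℕ) + 1 < m + 1 := by omega
    exact ⟨i, Nat.zero_le _, hi, by rw [adjSwap'_eq hi]; rfl⟩

end Coxeter

/-- Elements `S_0, …, S_{n-2}` of a group that satisfy the braid relations define a homomorphism
from the symmetric group. -/
theorem exists_permLift {M : Type*} [Group M] {n : ℕ} {S : ℕ → M} (h : BraidRel n S) :
    ∃ f : Equiv.Perm (Fin n) →* M, ∀ i (hi : i + 1 < n), f (adjSwap i hi) = S i := by
  classical
  set P := tailMon n (fun i => (adjSwap' n i, S i)) 0 with hP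
  have hfun : ∀ x ∈ P, ∀ y ∈ P, x.1 = y.1 → x.2 = y.2 := by
    have hinv : ∀ y ∈ P, y⁻¹ ∈ P := by
      intro y hy
      induction hy using Submonoid.closure_induction with
      | mem x hx =>
        obtain ⟨i, h1, h2, rfl⟩ := hx
        have : ((adjSwap' n i, S i) : Equiv.Perm (Fin n) × M)⁻¹ = (adjSwap' n i, S i) := by
          rw [inv_eq_iff_mul_eq_one]
          exact Prod.ext ((braidRel_adjSwap' n).sq i h2) (h.sq i h2)
        simp only [this]
        exact Submonoid.subset_closure ⟨i, h1, h2, rfl⟩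
      | one => rw [inv_one]; exact P.one_mem
      | mul x y _ _ hx hy => rw [mul_inv_rev]; exact P.mul_mem hy hx
    intro x hx y hy hxy
    have := tailMon_functional h n 0 (by omega) (x * y⁻¹) (P.mul_mem hx (hinv y hy))
      (by simp [hxy])
    simpa [mul_inv_eq_one] using this
  have hex : ∀ σ : Equiv.Perm (Fin n), ∃ m, (σ, m) ∈ P := by
    intro σ
    have hσ : σ ∈ Submonoid.closure
        {x : Equiv.Perm (Fin n) | ∃ i, 0 ≤ i ∧ i + 1 < n ∧ x = adjSwap' n i} := by
      rw [closure_adjSwap]; trivial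
    induction hσ using Submonoid.closure_induction with
    | mem x hx =>
      obtain ⟨i, h1, h2, rfl⟩ := hx
      exact ⟨S i, Submonoid.subset_closure ⟨i, h1, h2, rfl⟩⟩
    | one => exact ⟨1, P.one_mem⟩
    | mul x y _ _ hx hy =>
      obtain ⟨a, ha⟩ := hx
      obtain ⟨b, hb⟩ := hy
      exact ⟨a * b, P.mul_mem ha hb⟩
  choose f hf using hex
  refine ⟨⟨⟨f, hfun _ (hf 1) _ P.one_mem rfl⟩,
    fun σ τ => hfun _ (hf _) _ (P.mul_mem (hf σ) (hf τ)) rfl⟩, fun i hi => ?_⟩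
  have : ((adjSwap i hi, S i) : Equiv.Perm (Fin n) × M) ∈ P := by
    rw [← adjSwap'_eq hi]
    exact Submonoid.subset_closure ⟨i, Nat.zero_le _, hi, rfl⟩
  exact hfun _ (hf _) _ this rfl

/-! The group `G(ℓ,1,n)`. -/

/-- The group `G(ℓ,1,n)`: the wreath product `μ_ℓ ≀ S_n`, where `S_n` permutes the coordinates of
`μ_ℓ ^ n`. The pair `(a, σ)` is the monomial matrix `diag(a) · σ`. -/
abbrev GGroup (ℓ n : ℕ) : Type :=
  (Fin n → rootsOfUnity ℓ ℂ) ⋊[mulAutArrow] Equiv.Perm (Fin n)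

noncomputable instance rootsFintype (ℓ : ℕ) [NeZero ℓ] : Fintype (rootsOfUnity ℓ ℂ) :=
  Fintype.ofFinite _

theorem arrow_apply {n : ℕ} {A : Type*} [Group A] (σ : Equiv.Perm (Fin n)) (a : Fin n → A)
    (k : Fin n) : (mulAutArrow σ : MulAut (Fin n → A)) a k = a (σ.symm k) := rfl

/-- The diagonal matrix `ε_i` with entry `ε` in position `i` and `1` elsewhere. -/
def diagAt {ℓ n : ℕ} (i : Fin n) (ε : rootsOfUnity ℓ ℂ) : GGroup ℓ n :=
  SemidirectProduct.inl (Pi.mulSingle i ε)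

/-- The permutation matrix of `σ`. -/
def permMat {ℓ n : ℕ} (σ : Equiv.Perm (Fin n)) : GGroup ℓ n := SemidirectProduct.inr σ

/-- The permutation matrix `s_i = s_{i,i+1}`. -/
def simpleRefl {ℓ n : ℕ} (i : ℕ) (hi : i + 1 < n) : GGroup ℓ n := permMat (adjSwap i hi)

/-- The reflection `ε_i s_{ij} ε_i⁻¹`. -/
def reflAt {ℓ n : ℕ} (i j : Fin n) (ε : rootsOfUnity ℓ ℂ) : GGroup ℓ n :=
  diagAt i ε * permMat (Equiv.swap i j) * (diagAt i ε)⁻¹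

/-- The group homomorphism `G(ℓ,1,a) → G(ℓ,1,b)` induced by an injection of the index sets. -/
noncomputable def embGroup {ℓ a b : ℕ} (f : Fin a ↪ Fin b) : GGroup ℓ a →* GGroup ℓ b :=
  SemidirectProduct.map (Function.ExtendByOne.hom (rootsOfUnity ℓ ℂ) f)
    (Equiv.Perm.viaEmbeddingHom f) (by
      intro σ
      refine MonoidHom.ext fun x => funext fun j => ?_
      by_cases hj : ∃ i, f i = j
      · obtain ⟨i, rfl⟩ := hj
        have h1 : (Equiv.Perm.viaEmbedding σ f).symm (f i) = f (σ.symm i) := by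
          rw [Equiv.symm_apply_eq, Equiv.Perm.viaEmbedding_apply]; simp
        simp only [Function.ExtendByOne.hom, MonoidHom.comp_apply, MonoidHom.coe_mk, OneHom.coe_mk,
          MulEquiv.coe_toMonoidHom, arrow_apply, Equiv.Perm.viaEmbeddingHom_apply, h1,
          f.injective.extend_apply]
      · have h1 : (Equiv.Perm.viaEmbedding σ f).symm j = j := by
          rw [Equiv.symm_apply_eq, Equiv.Perm.viaEmbedding_apply_of_notMem]
          simpa using hj
        simp only [Function.ExtendByOne.hom, MonoidHom.comp_apply, MonoidHom.coe_mk, OneHom.coe_mk,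
          MulEquiv.coe_toMonoidHom, arrow_apply, Equiv.Perm.viaEmbeddingHom_apply, h1,
          Function.extend_apply' _ _ _ hj])

theorem extendByOne_mulSingle {ℓ a b : ℕ} (f : Fin a ↪ Fin b) (i : Fin a) (ε : rootsOfUnity ℓ ℂ) :
    Function.ExtendByOne.hom (rootsOfUnity ℓ ℂ) f (Pi.mulSingle i ε) = Pi.mulSingle (f i) ε := by
  funext j
  by_cases hj : ∃ k, f k = j
  · obtain ⟨k, rfl⟩ := hj
    by_cases hk : k = i
    · subst hk; simp [Function.ExtendByOne.hom, f.injective.extend_apply]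
    · have : f k ≠ f i := fun h => hk (f.injective h)
      simp [Function.ExtendByOne.hom, f.injective.extend_apply, Pi.mulSingle_eq_of_ne hk,
        Pi.mulSingle_eq_of_ne this]
  · have : j ≠ f i := fun h => hj ⟨i, h.symm⟩
    simp [Function.ExtendByOne.hom, Function.extend_apply' _ _ _ hj, Pi.mulSingle_eq_of_ne this]

theorem embGroup_diagAt {ℓ a b : ℕ} (f : Fin a ↪ Fin b) (i : Fin a) (ε : rootsOfUnity ℓ ℂ) :
    embGroup f (diagAt i ε) = diagAt (f i) ε := by
  rw [diagAt, diagAt, ← extendByOne_mulSingle]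
  simp [embGroup]

theorem viaEmbedding_swap {a b : ℕ} (f : Fin a ↪ Fin b) (i j : Fin a) :
    (Equiv.swap i j).viaEmbedding f = Equiv.swap (f i) (f j) := by
  ext k
  by_cases hk : ∃ c, f c = k
  · obtain ⟨c, rfl⟩ := hk
    rw [Equiv.Perm.viaEmbedding_apply, f.injective.map_swap]
  · rw [Equiv.Perm.viaEmbedding_apply_of_notMem _ _ _ (by simpa using hk),
      Equiv.swap_apply_of_ne_of_ne]
    · rintro rfl; exact hk ⟨_, rfl⟩
    · rintro rfl; exact hk ⟨_, rfl⟩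

theorem embGroup_swap {ℓ a b : ℕ} (f : Fin a ↪ Fin b) (i j : Fin a) :
    embGroup f (permMat (Equiv.swap i j) : GGroup ℓ a) = permMat (Equiv.swap (f i) (f j)) := by
  rw [permMat, permMat, ← viaEmbedding_swap]
  simp [embGroup, Equiv.Perm.viaEmbeddingHom_apply]

/-- The injection `i ↦ o + i` of `{0, …, a-1}` into `{0, …, b-1}`. -/
def shiftEmb (o a b : ℕ) (h : o + a ≤ b) : Fin a ↪ Fin b where
  toFun i := ⟨o + i, by omega⟩
  inj' i j hij := by simpa [Fin.ext_iff] using hij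

theorem shiftEmb_val {o a b : ℕ} (h : o + a ≤ b) (i : Fin a) :
    ((shiftEmb o a b h i : Fin b) : ℕ) = o + i := rfl

theorem embGroup_shift_simpleRefl {ℓ o a b : ℕ} (h : o + a ≤ b) (i : ℕ) (hi : i + 1 < a) :
    embGroup (shiftEmb o a b h) (simpleRefl i hi : GGroup ℓ a) =
      simpleRefl (o + i) (by omega) := by
  rw [simpleRefl, adjSwap, embGroup_swap]
  rfl

theorem right_embGroup {ℓ a b : ℕ} (f : Fin a ↪ Fin b) (g : GGroup ℓ a) :
    (embGroup f g).right = g.right.viaEmbedding f := by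
  simp [embGroup, Equiv.Perm.viaEmbeddingHom_apply]

/-- Elements supported on disjoint sets of indices commute. -/
theorem embGroup_commute {ℓ a b c : ℕ} (f : Fin a ↪ Fin c) (f' : Fin b ↪ Fin c)
    (hf : ∀ i j, f i ≠ f' j) (g : GGroup ℓ a) (g' : GGroup ℓ b) :
    Commute (embGroup f g) (embGroup f' g') := by
  have hn : ∀ k, (∃ i, f i = k) → ¬ ∃ j, f' j = k := by
    rintro k ⟨i, rfl⟩ ⟨j, hj⟩; exact hf i j hj.symm
  have fixl : ∀ (σ : Equiv.Perm (Fin b)) i, σ.viaEmbedding f' (f i) = f i := fun σ i =>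
    Equiv.Perm.viaEmbedding_apply_of_notMem _ _ _ (by simpa using fun j => (hf i j).symm)
  have fixr : ∀ (σ : Equiv.Perm (Fin a)) j, σ.viaEmbedding f (f' j) = f' j := fun σ i =>
    Equiv.Perm.viaEmbedding_apply_of_notMem _ _ _ (by simpa using fun j => hf j i)
  have fixl' : ∀ (σ : Equiv.Perm (Fin b)) i, (σ.viaEmbedding f').symm (f i) = f i := fun σ i => by
    rw [Equiv.symm_apply_eq, fixl]
  have fixr' : ∀ (σ : Equiv.Perm (Fin a)) j, (σ.viaEmbedding f).symm (f' j) = f' j := fun σ i => by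
    rw [Equiv.symm_apply_eq, fixr]
  have outl : ∀ (σ : Equiv.Perm (Fin a)) k, (¬ ∃ i, f i = k) → σ.viaEmbedding f k = k :=
    fun σ k hk => Equiv.Perm.viaEmbedding_apply_of_notMem _ _ _ (by simpa using hk)
  have outr : ∀ (σ : Equiv.Perm (Fin b)) k, (¬ ∃ i, f' i = k) → σ.viaEmbedding f' k = k :=
    fun σ k hk => Equiv.Perm.viaEmbedding_apply_of_notMem _ _ _ (by simpa using hk)
  have key : ∀ k, (∃ i, f i = k) ∨ (∃ j, f' j = k) ∨ ((¬ ∃ i, f i = k) ∧ ¬ ∃ j, f' j = k) := by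
    intro k; tauto
  rw [Commute, SemiconjBy]
  apply SemidirectProduct.ext
  · funext k
    simp only [embGroup, SemidirectProduct.map_left, SemidirectProduct.mul_left, Pi.mul_apply,
      SemidirectProduct.map_right, arrow_apply, Equiv.Perm.viaEmbeddingHom_apply,
      Function.ExtendByOne.hom, MonoidHom.coe_mk, OneHom.coe_mk]
    rcases key k with ⟨i, rfl⟩ | ⟨j, rfl⟩ | ⟨h1, h2⟩
    · have hx : ¬ ∃ j, f' j = f i := hn _ ⟨i, rfl⟩
      have hy : ¬ ∃ j, f' j = f (g.right.symm i) := hn _ ⟨_, rfl⟩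
      have h3 : (g.right.viaEmbedding f).symm (f i) = f (g.right.symm i) := by
        rw [Equiv.symm_apply_eq, Equiv.Perm.viaEmbedding_apply]; simp
      simp [h3, fixl', Function.extend_apply' _ _ _ hx, Function.extend_apply' _ _ _ hy]
    · have hx : ¬ ∃ i, f i = f' j := fun h => hn _ h ⟨j, rfl⟩
      have hy : ¬ ∃ i, f i = f' (g'.right.symm j) := fun h => hn _ h ⟨_, rfl⟩
      have h3 : (g'.right.viaEmbedding f').symm (f' j) = f' (g'.right.symm j) := by
        rw [Equiv.symm_apply_eq, Equiv.Perm.viaEmbedding_apply]; simp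
      simp [h3, fixr', Function.extend_apply' _ _ _ hx, Function.extend_apply' _ _ _ hy]
    · have h3 : (g.right.viaEmbedding f).symm k = k := by
        rw [Equiv.symm_apply_eq, outl _ _ h1]
      have h4 : (g'.right.viaEmbedding f').symm k = k := by
        rw [Equiv.symm_apply_eq, outr _ _ h2]
      simp [h3, h4, Function.extend_apply' _ _ _ h1, Function.extend_apply' _ _ _ h2]
  · simp only [SemidirectProduct.mul_right, right_embGroup]
    ext k
    simp only [Equiv.Perm.mul_apply]
    rcases key k with ⟨i, rfl⟩ | ⟨j, rfl⟩ | ⟨h1, h2⟩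
    · rw [fixl, Equiv.Perm.viaEmbedding_apply, fixl]
    · rw [fixr, Equiv.Perm.viaEmbedding_apply, fixr]
    · rw [outl _ _ h1, outr _ _ h2, outl _ _ h1]

/-! The Jucys–Murphy elements and their relations. -/

section JM

variable {ℓ n : ℕ}

theorem permMat_diagAt (σ : Equiv.Perm (Fin n)) (i : Fin n) (ε : rootsOfUnity ℓ ℂ) :
    permMat σ * diagAt i ε = diagAt (σ i) ε * permMat σ := by
  rw [permMat, diagAt, diagAt]
  apply SemidirectProduct.ext
  · simp only [SemidirectProduct.mul_left, SemidirectProduct.left_inr, SemidirectProduct.right_inr,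
      SemidirectProduct.left_inl, SemidirectProduct.right_inl, one_mul, map_one, mul_one]
    funext k
    simp only [arrow_apply]
    by_cases hk : k = σ i
    · subst hk; simp
    · have : σ.symm k ≠ i := by rw [Ne, Equiv.symm_apply_eq]; exact hk
      simp [Pi.mulSingle_eq_of_ne hk, Pi.mulSingle_eq_of_ne this]
  · simp

/-- Every element is a product of a diagonal matrix and a permutation matrix, and it permutes the
reflections by conjugation. -/
theorem conj_reflAt (g : GGroup ℓ n) (i j : Fin n) (hij : i ≠ j) (ε : rootsOfUnity ℓ ℂ) :
    g * reflAt i j ε = reflAt (g.right i) (g.right j)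
      (ε * g.left (g.right i) * (g.left (g.right j))⁻¹) * g := by
  apply SemidirectProduct.ext
  · simp only [reflAt, diagAt, permMat, ← map_inv, SemidirectProduct.mul_left,
      SemidirectProduct.mul_right, SemidirectProduct.left_inr, SemidirectProduct.right_inr,
      SemidirectProduct.left_inl, SemidirectProduct.right_inl, one_mul, map_one, mul_one]
    funext k
    simp only [Pi.mul_apply, arrow_apply, Pi.inv_apply,
      Equiv.symm_swap]
    obtain ⟨m, rfl⟩ := g.right.surjective k
    have hne : g.right i ≠ g.right j := fun h => hij (g.right.injective h)
    rw [← g.right.injective.map_swap]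
    simp only [Equiv.symm_apply_apply]
    by_cases h1 : m = i
    · subst h1
      have h2 : j ≠ m := hij.symm
      simp [Pi.mulSingle_eq_of_ne h2, Pi.mulSingle_eq_of_ne hne.symm]
      simp [mul_comm]
    · by_cases h2 : m = j
      · subst h2
        simp [Pi.mulSingle_eq_of_ne h1, Pi.mulSingle_eq_of_ne hne.symm]
        simp [mul_comm, mul_left_comm, mul_assoc]
      · have h3 : g.right m ≠ g.right i := fun h => h1 (g.right.injective h)
        simp [Equiv.swap_apply_of_ne_of_ne h1 h2, Pi.mulSingle_eq_of_ne h1,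
          Pi.mulSingle_eq_of_ne h3]
  · simp only [reflAt, diagAt, permMat, ← map_inv, SemidirectProduct.mul_right,
      SemidirectProduct.right_inr, SemidirectProduct.right_inl, one_mul, mul_one]
    ext k
    simp [Equiv.Perm.mul_apply, g.right.injective.map_swap]

theorem right_reflAt (i j : Fin n) (ε : rootsOfUnity ℓ ℂ) :
    (reflAt i j ε).right = Equiv.swap i j := by
  simp [reflAt, diagAt, permMat, ← map_inv]

variable [NeZero ℓ]

/-- The Jucys–Murphy element `φ_i = ∑_{j < i} ∑_k ζ_i^k s_{ij} ζ_i^{-k}` of the group algebra. The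
inner sum runs over all `ε ∈ μ_ℓ`, that is over the powers `ε = ζ^k` with `0 ≤ k < ℓ` of a
primitive `ℓ`-th root of unity `ζ`. -/
noncomputable def jmElt (i : Fin n) : MonoidAlgebra ℂ (GGroup ℓ n) :=
  ∑ j ∈ Finset.univ.filter (· < i), ∑ ε : rootsOfUnity ℓ ℂ,
    MonoidAlgebra.of ℂ (GGroup ℓ n) (reflAt i j ε)

theorem conj_sum_reflAt (g : GGroup ℓ n) (i j : Fin n) (hij : i ≠ j) :
    MonoidAlgebra.of ℂ (GGroup ℓ n) g *
        ∑ ε : rootsOfUnity ℓ ℂ, MonoidAlgebra.of ℂ (GGroup ℓ n) (reflAt i j ε) =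
      (∑ ε : rootsOfUnity ℓ ℂ, MonoidAlgebra.of ℂ (GGroup ℓ n)
        (reflAt (g.right i) (g.right j) ε)) * MonoidAlgebra.of ℂ (GGroup ℓ n) g := by
  rw [Finset.mul_sum, Finset.sum_mul]
  refine Fintype.sum_equiv
    (Equiv.mulRight (g.left (g.right i) * (g.left (g.right j))⁻¹)) _ _ fun ε => ?_
  rw [← map_mul, ← map_mul, conj_reflAt g i j hij, Equiv.coe_mulRight, mul_assoc ε]

/-- `φ_i` commutes with every `g` whose permutation fixes `i` and preserves `{j | j < i}`. -/
theorem commute_jmElt (g : GGroup ℓ n) (i : Fin n) (hi : g.right i = i)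
    (hlt : ∀ j, j < i → g.right j < i) :
    MonoidAlgebra.of ℂ (GGroup ℓ n) g * jmElt i = jmElt i * MonoidAlgebra.of ℂ (GGroup ℓ n) g := by
  have hlt' : ∀ j, g.right j < i → j < i := by
    intro j hj
    have hinj : Set.InjOn g.right (Finset.univ.filter (· < i) : Finset (Fin n)) :=
      g.right.injective.injOn
    have himg : (Finset.univ.filter (· < i)).image g.right = Finset.univ.filter (· < i) := by
      apply Finset.eq_of_subset_of_card_le
      · intro k hk
        simp only [Finset.mem_image, Finset.mem_filter, Finset.mem_univ, true_and] at hk ⊢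
        obtain ⟨m, hm, rfl⟩ := hk
        exact hlt m hm
      · rw [Finset.card_image_of_injOn hinj]
    have : g.right j ∈ (Finset.univ.filter (· < i)).image g.right := by rw [himg]; simpa using hj
    simp only [Finset.mem_image, Finset.mem_filter, Finset.mem_univ, true_and] at this
    obtain ⟨m, hm, hmj⟩ := this
    rwa [← g.right.injective hmj]
  rw [jmElt, Finset.mul_sum, Finset.sum_mul]
  refine Finset.sum_equiv g.right ?_ ?_
  · intro j
    simp only [Finset.mem_filter, Finset.mem_univ, true_and]
    exact ⟨hlt j, hlt' j⟩
  · intro j hj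
    simp only [Finset.mem_filter, Finset.mem_univ, true_and] at hj
    rw [conj_sum_reflAt g i j hj.ne', hi]

theorem jmElt_commute (i j : Fin n) : jmElt i * jmElt j = jmElt j * (jmElt i :
    MonoidAlgebra ℂ (GGroup ℓ n)) := by
  have key : ∀ i j : Fin n, i < j → jmElt i * jmElt j = jmElt j * (jmElt i :
      MonoidAlgebra ℂ (GGroup ℓ n)) := by
    intro i j hij
    rw [jmElt.eq_def i, Finset.sum_mul, Finset.mul_sum]
    refine Finset.sum_congr rfl fun k hk => ?_
    rw [Finset.sum_mul, Finset.mul_sum]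
    refine Finset.sum_congr rfl fun ε _ => ?_
    simp only [Finset.mem_filter, Finset.mem_univ, true_and] at hk
    have hkj : k < j := hk.trans hij
    apply commute_jmElt
    · rw [right_reflAt, Equiv.swap_apply_of_ne_of_ne hij.ne' hkj.ne']
    · intro m hm
      rw [right_reflAt, Equiv.swap_apply_def]
      split_ifs <;> assumption
  rcases lt_trichotomy i j with h | h | h
  · exact key i j h
  · rw [h]
  · exact (key j i h).symm

theorem jmElt_diagAt (i j : Fin n) (ε : rootsOfUnity ℓ ℂ) :
    MonoidAlgebra.of ℂ (GGroup ℓ n) (diagAt i ε) * jmElt j =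
      jmElt j * MonoidAlgebra.of ℂ (GGroup ℓ n) (diagAt i ε) :=
  commute_jmElt _ _ (by simp [diagAt]) (by simp [diagAt])

theorem jmElt_simpleRefl (i : ℕ) (hi : i + 1 < n) (j : Fin n) (h1 : (j : ℕ) ≠ i)
    (h2 : (j : ℕ) ≠ i + 1) :
    MonoidAlgebra.of ℂ (GGroup ℓ n) (simpleRefl i hi) * jmElt j =
      jmElt j * MonoidAlgebra.of ℂ (GGroup ℓ n) (simpleRefl i hi) := by
  apply commute_jmElt
  · ext
    simp only [simpleRefl, permMat, SemidirectProduct.right_inr, adjSwap_apply_val]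
    split_ifs <;> omega
  · intro k hk
    rw [Fin.lt_def] at hk ⊢
    simp only [simpleRefl, permMat, SemidirectProduct.right_inr, adjSwap_apply_val]
    split_ifs <;> omega

theorem jmElt_succ (i : ℕ) (hi : i + 1 < n) :
    MonoidAlgebra.of ℂ (GGroup ℓ n) (simpleRefl i hi) * jmElt ⟨i, Nat.lt_of_succ_lt hi⟩ =
      jmElt ⟨i + 1, hi⟩ * MonoidAlgebra.of ℂ (GGroup ℓ n) (simpleRefl i hi) -
        ∑ ε : rootsOfUnity ℓ ℂ, MonoidAlgebra.of ℂ (GGroup ℓ n)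
          (diagAt ⟨i, Nat.lt_of_succ_lt hi⟩ ε * (diagAt ⟨i + 1, hi⟩ ε)⁻¹) := by
  set a : Fin n := ⟨i, Nat.lt_of_succ_lt hi⟩ with ha
  set b : Fin n := ⟨i + 1, hi⟩ with hb
  have hab : a ≠ b := by simp [ha, hb, Fin.ext_iff]
  have hs : (simpleRefl i hi : GGroup ℓ n).right = Equiv.swap a b := rfl
  have hset : Finset.univ.filter (· < b) = insert a (Finset.univ.filter (· < a)) := by
    ext k
    simp only [Finset.mem_filter, Finset.mem_univ, true_and, Finset.mem_insert, Fin.lt_def,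
      Fin.ext_iff, ha, hb]
    omega
  rw [jmElt.eq_def b, hset, Finset.sum_insert (by simp), add_mul, jmElt, Finset.mul_sum,
    Finset.sum_mul]
  have h1 : ∀ j ∈ Finset.univ.filter (· < a),
      MonoidAlgebra.of ℂ (GGroup ℓ n) (simpleRefl i hi) *
        ∑ ε : rootsOfUnity ℓ ℂ, MonoidAlgebra.of ℂ (GGroup ℓ n) (reflAt a j ε) =
      (∑ ε : rootsOfUnity ℓ ℂ, MonoidAlgebra.of ℂ (GGroup ℓ n) (reflAt b j ε)) *
        MonoidAlgebra.of ℂ (GGroup ℓ n) (simpleRefl i hi) := by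
    intro j hj
    simp only [Finset.mem_filter, Finset.mem_univ, true_and] at hj
    have hjb : j ≠ b := by
      rw [Fin.lt_def] at hj
      simp only [Ne, Fin.ext_iff, ha, hb] at hj ⊢
      omega
    rw [conj_sum_reflAt _ _ _ hj.ne', hs, Equiv.swap_apply_left,
      Equiv.swap_apply_of_ne_of_ne hj.ne hjb]
  rw [Finset.sum_congr rfl h1]
  have h2 : (∑ ε : rootsOfUnity ℓ ℂ, MonoidAlgebra.of ℂ (GGroup ℓ n) (reflAt b a ε)) *
        MonoidAlgebra.of ℂ (GGroup ℓ n) (simpleRefl i hi) =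
      ∑ ε : rootsOfUnity ℓ ℂ, MonoidAlgebra.of ℂ (GGroup ℓ n) (diagAt a ε * (diagAt b ε)⁻¹) := by
    rw [Finset.sum_mul]
    refine Fintype.sum_equiv (Equiv.inv _) _ _ fun ε => ?_
    rw [← map_mul]
    congr 1
    have h3 : (diagAt b ε : GGroup ℓ n)⁻¹ = diagAt b ε⁻¹ := by
      simp [diagAt, ← map_inv, Pi.mulSingle_inv]
    have h4 : (diagAt b ε⁻¹ : GGroup ℓ n)⁻¹ = diagAt b ε := by
      simp [diagAt, ← map_inv, Pi.mulSingle_inv]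
    have h5 : (simpleRefl i hi : GGroup ℓ n) = permMat (Equiv.swap a b) := rfl
    have h6 : (permMat (Equiv.swap b a) * permMat (Equiv.swap a b) : GGroup ℓ n) = 1 := by
      rw [permMat, permMat, ← map_mul, Equiv.swap_comm, Equiv.swap_mul_self, map_one]
    have h7 : (diagAt b ε * diagAt a ε⁻¹ : GGroup ℓ n) = diagAt a ε⁻¹ * diagAt b ε := by
      rw [diagAt, diagAt, ← map_mul, ← map_mul, mul_comm]
    rw [reflAt, h3, h5, Equiv.inv_apply, h4, mul_assoc (diagAt b ε), permMat_diagAt,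
      Equiv.swap_apply_left, ← mul_assoc, mul_assoc, h6, mul_one, h7]
  rw [← Finset.sum_mul (s := Finset.univ) (f := fun ε => MonoidAlgebra.of ℂ (GGroup ℓ n)
    (reflAt b a ε)), h2, ← Finset.sum_mul]
  abel

end JM

/-! `ℓ`-partitions, standard Young tableaux, and Young's orthogonal form of the irreducible
representation `S^λ` of `G(ℓ,1,n)`. -/

/-- An `ℓ`-partition `(λ^0, …, λ^{ℓ-1})`. -/
abbrev LPartition (ℓ : ℕ) : Type := Fin ℓ → YoungDiagram

/-- The number of boxes of an `ℓ`-partition. -/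
def LPartition.size {ℓ : ℕ} (lam : LPartition ℓ) : ℕ := ∑ j, (lam j).card

/-- The boxes of an `ℓ`-partition: triples `(j, r, c)` with `(r, c)` a cell of `λ^j`, in row `r` and
column `c` (numbered from `0`). -/
abbrev PBox {ℓ : ℕ} (lam : LPartition ℓ) : Type := {b : Fin ℓ × ℕ × ℕ // b.2 ∈ lam b.1}

/-- The content (column minus row) of a box. -/
def PBox.ct {ℓ : ℕ} {lam : LPartition ℓ} (b : PBox lam) : ℤ := (b.1.2.2 : ℤ) - (b.1.2.1 : ℤ)

/-- A filling of the boxes of `λ` with the numbers `0, …, n-1`, each used once. -/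
abbrev Filling {ℓ : ℕ} (lam : LPartition ℓ) (n : ℕ) : Type := PBox lam ≃ Fin n

/-- A filling is standard if its entries increase from left to right and from top to bottom in every
component of `λ`. -/
def Filling.IsStandard {ℓ n : ℕ} {lam : LPartition ℓ} (T : Filling lam n) : Prop :=
  ∀ b b' : PBox lam, b.1.1 = b'.1.1 → b.1.2 ≤ b'.1.2 → b ≠ b' → T b < T b'

/-- The standard Young tableaux of shape `λ`; there are none unless `λ` has `n` boxes. -/
abbrev PSYT {ℓ : ℕ} (lam : LPartition ℓ) (n : ℕ) : Type := {T : Filling lam n // T.IsStandard}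

namespace Young

variable {ℓ n : ℕ} {lam : LPartition ℓ}

/-- The filling `s_i T` in which the entries `i` and `i + 1` are exchanged. -/
def swapF (T : Filling lam n) (i : ℕ) (hi : i + 1 < n) : Filling lam n := T.trans (adjSwap i hi)

/-- The box containing the entry `i`. -/
def boxAt (T : Filling lam n) (i : ℕ) (hi : i < n) : PBox lam := T.symm ⟨i, hi⟩

/-- The diagonal coefficient `1 / (ct y - ct x)` of the orthogonal form for boxes `x`, `y` in the same
component, and `0` for boxes in different components. -/
noncomputable def pco (x y : PBox lam) : ℝ :=
  if x.1.1 = y.1.1 then 1 / ((y.ct - x.ct : ℤ) : ℝ) else 0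

/-- The off-diagonal coefficient `√(1 - p²)` of the orthogonal form. -/
noncomputable def qco (x y : PBox lam) : ℝ := Real.sqrt (1 - pco x y ^ 2)

theorem pco_symm (x y : PBox lam) : pco y x = - pco x y := by
  unfold pco
  by_cases h : x.1.1 = y.1.1
  · rw [if_pos h, if_pos h.symm, ← neg_sub x.ct y.ct, Int.cast_neg, div_neg, neg_neg]
  · rw [if_neg h, if_neg (Ne.symm h), neg_zero]

theorem qco_symm (x y : PBox lam) : qco y x = qco x y := by
  rw [qco, qco, pco_symm, neg_sq]

theorem pco_sq_le (x y : PBox lam) : pco x y ^ 2 ≤ 1 := by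
  unfold pco
  split_ifs with h
  · by_cases h0 : y.ct - x.ct = 0
    · simp [h0]
    · rw [div_pow, one_pow]
      apply div_le_one_of_le₀ _ (sq_nonneg _)
      have : (1 : ℤ) ≤ (y.ct - x.ct) ^ 2 := by
        have := sq_nonneg (y.ct - x.ct)
        have h2 : (y.ct - x.ct) ^ 2 ≠ 0 := pow_ne_zero 2 h0
        omega
      exact_mod_cast this
  · simp

theorem qco_sq (x y : PBox lam) : qco x y ^ 2 = 1 - pco x y ^ 2 :=
  Real.sq_sqrt (by linarith [pco_sq_le x y])

theorem pco_mul (a b c : PBox lam) (h1 : a.1.1 = b.1.1 → a.ct ≠ b.ct)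
    (h2 : b.1.1 = c.1.1 → b.ct ≠ c.ct) (h3 : a.1.1 = c.1.1 → a.ct ≠ c.ct) :
    pco a b * pco b c = pco a c * (pco a b + pco b c) := by
  unfold pco
  by_cases hab : a.1.1 = b.1.1
  · by_cases hbc : b.1.1 = c.1.1
    · have hac := hab.trans hbc
      have e1 : (b.ct - a.ct : ℝ) ≠ 0 := sub_ne_zero.2 (by exact_mod_cast (h1 hab).symm)
      have e2 : (c.ct - b.ct : ℝ) ≠ 0 := sub_ne_zero.2 (by exact_mod_cast (h2 hbc).symm)
      have e3 : (c.ct - a.ct : ℝ) ≠ 0 := sub_ne_zero.2 (by exact_mod_cast (h3 hac).symm)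
      rw [if_pos hab, if_pos hbc, if_pos hac]
      push_cast
      field_simp
      ring
    · have hac : a.1.1 ≠ c.1.1 := fun h => hbc (hab.symm.trans h)
      simp [hbc, hac]
  · by_cases hbc : b.1.1 = c.1.1
    · have hac : a.1.1 ≠ c.1.1 := fun h => hab (h.trans hbc.symm)
      simp [hab, hac]
    · simp [hab, hbc]

/-- In a standard tableau, boxes of the same content whose entries differ by at most `2` lie in
different components. -/
theorem ct_ne (T : Filling lam n) (hT : T.IsStandard) (x y : PBox lam) (hxy : T x < T y)
    (h2 : (T y : ℕ) ≤ T x + 2) (hc : x.1.1 = y.1.1) : x.ct ≠ y.ct := by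
  intro he
  obtain ⟨⟨j, r, c⟩, hx⟩ := x
  obtain ⟨⟨j', r', c'⟩, hy⟩ := y
  obtain rfl : j = j' := hc
  simp only [PBox.ct] at he
  have hr : r < r' := by
    by_contra hcon
    have hle : ((r', c') : ℕ × ℕ) ≤ (r, c) := ⟨by omega, by simp only; omega⟩
    have hne : (⟨(j, r', c'), hy⟩ : PBox lam) ≠ ⟨(j, r, c), hx⟩ := by
      rintro h
      rw [h] at hxy
      exact lt_irrefl _ hxy
    exact lt_asymm hxy (hT _ _ rfl hle hne)
  have hcc : c < c' := by omega
  have hz1 : ((r + 1, c) : ℕ × ℕ) ∈ lam j := (lam j).up_left_mem (by omega) (by omega) hy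
  have hz2 : ((r, c + 1) : ℕ × ℕ) ∈ lam j := (lam j).up_left_mem (by omega) (by omega) hy
  have a1 := hT ⟨(j, r, c), hx⟩ ⟨(j, r + 1, c), hz1⟩ rfl ⟨by simp, by simp⟩ (by simp)
  have a2 := hT ⟨(j, r, c), hx⟩ ⟨(j, r, c + 1), hz2⟩ rfl ⟨by simp, by simp⟩ (by simp)
  have a3 := hT ⟨(j, r + 1, c), hz1⟩ ⟨(j, r', c'), hy⟩ rfl
    ⟨by simp only; omega, by simp only; omega⟩ (by simp; omega)
  have a4 := hT ⟨(j, r, c + 1), hz2⟩ ⟨(j, r', c'), hy⟩ rfl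
    ⟨by simp only; omega, by simp only; omega⟩ (by simp; omega)
  have a5 : T ⟨(j, r + 1, c), hz1⟩ ≠ T ⟨(j, r, c + 1), hz2⟩ := by
    rw [Ne, T.injective.eq_iff]; simp
  rw [Fin.lt_def] at a1 a2 a3 a4
  rw [Ne, Fin.ext_iff] at a5
  omega

theorem boxAt_swapF (T : Filling lam n) (i : ℕ) (hi : i + 1 < n) (k : ℕ) (hk : k < n) :
    boxAt (swapF T i hi) k hk = T.symm (adjSwap i hi ⟨k, hk⟩) := by
  simp [boxAt, swapF, adjSwap]

theorem boxAt_swapF_left (T : Filling lam n) (i : ℕ) (hi : i + 1 < n) (hi' : i < n) :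
    boxAt (swapF T i hi) i hi' = boxAt T (i + 1) hi := by
  rw [boxAt_swapF, adjSwap, Equiv.swap_apply_left]; rfl

theorem boxAt_swapF_right (T : Filling lam n) (i : ℕ) (hi : i + 1 < n) :
    boxAt (swapF T i hi) (i + 1) hi = boxAt T i (Nat.lt_of_succ_lt hi) := by
  rw [boxAt_swapF, adjSwap, Equiv.swap_apply_right]; rfl

theorem boxAt_swapF_of_ne (T : Filling lam n) (i : ℕ) (hi : i + 1 < n) (k : ℕ) (hk : k < n)
    (h1 : k ≠ i) (h2 : k ≠ i + 1) : boxAt (swapF T i hi) k hk = boxAt T k hk := by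
  rw [boxAt_swapF, adjSwap, Equiv.swap_apply_of_ne_of_ne]
  · rfl
  · simpa [Fin.ext_iff] using h1
  · simpa [Fin.ext_iff] using h2

theorem swapF_swapF (T : Filling lam n) (i : ℕ) (hi : i + 1 < n) :
    swapF (swapF T i hi) i hi = T := by
  ext b
  simp [swapF, adjSwap]

/-- If exchanging `i` and `i + 1` turns a non-standard filling into a standard one, then the two
boxes are adjacent, so that the off-diagonal coefficient vanishes. -/
theorem qco_eq_zero (T : Filling lam n) (i : ℕ) (hi : i + 1 < n) (hT : ¬ T.IsStandard)
    (hs : (swapF T i hi).IsStandard) : qco (boxAt T i (Nat.lt_of_succ_lt hi)) (boxAt T (i + 1) hi) = 0 := by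
  have hval : ∀ z, ((swapF T i hi z : Fin n) : ℕ) =
      if (T z : ℕ) = i then i + 1 else if (T z : ℕ) = i + 1 then i else T z :=
    fun z => adjSwap_apply_val hi (T z)
  unfold Filling.IsStandard at hT
  push Not at hT
  obtain ⟨b, b', hj, hle, hne, hlt⟩ := hT
  have h1 := hs b b' hj hle hne
  have h2 : T b ≠ T b' := fun h => hne (T.injective h)
  rw [Fin.lt_def, hval, hval] at h1
  rw [Fin.le_def] at hlt
  rw [Ne, Fin.ext_iff] at h2
  have h3 : (T b : ℕ) = i + 1 ∧ (T b' : ℕ) = i := by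
    split_ifs at h1 <;> omega
  have hb : b = boxAt T (i + 1) hi := by
    rw [boxAt, Equiv.eq_symm_apply]; exact Fin.ext h3.1
  have hb' : b' = boxAt T i (Nat.lt_of_succ_lt hi) := by
    rw [boxAt, Equiv.eq_symm_apply]; exact Fin.ext h3.2
  rw [← hb, ← hb']
  have hbv : ((swapF T i hi b : Fin n) : ℕ) = i := by rw [hval]; split_ifs <;> omega
  have hbv' : ((swapF T i hi b' : Fin n) : ℕ) = i + 1 := by rw [hval]; split_ifs <;> omega
  have hmid : ∀ z : PBox lam, b.1.1 = z.1.1 → b.1.2 ≤ z.1.2 → z.1.2 ≤ b'.1.2 → b ≠ z → z = b' := by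
    intro z hz1 hz2 hz3 hz4
    by_contra hz5
    have c1 := hs b z hz1 hz2 hz4
    have c2 := hs z b' (hz1.symm.trans hj) hz3 hz5
    rw [Fin.lt_def] at c1 c2
    omega
  have hp : pco b' b ^ 2 = 1 := by
    obtain ⟨⟨j, r, c⟩, hx⟩ := b
    obtain ⟨⟨j', r', c'⟩, hy⟩ := b'
    obtain rfl : j = j' := hj
    have hle1 : r ≤ r' := hle.1
    have hle2 : c ≤ c' := hle.2
    simp only [pco, if_true, PBox.ct]
    rcases Nat.lt_or_ge r r' with hr | hr
    · have hz : ((r + 1, c) : ℕ × ℕ) ∈ lam j := (lam j).up_left_mem (by omega) (by omega) hy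
      have := hmid ⟨(j, r + 1, c), hz⟩ rfl ⟨by simp, by simp⟩
        ⟨by simp only; omega, by simp only; omega⟩ (by simp)
      simp only [Subtype.mk.injEq, Prod.mk.injEq, true_and] at this
      obtain ⟨rfl, rfl⟩ := this
      push_cast
      ring_nf
    · obtain rfl : r = r' := by omega
      have hcc : c < c' := by
        rcases Nat.lt_or_ge c c' with h | h
        · exact h
        · obtain rfl : c = c' := by omega
          exact absurd rfl hne
      have hz : ((r, c + 1) : ℕ × ℕ) ∈ lam j := (lam j).up_left_mem (by omega) (by omega) hy
      have := hmid ⟨(j, r, c + 1), hz⟩ rfl ⟨by simp, by simp⟩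
        ⟨by simp only; omega, by simp only; omega⟩ (by simp)
      simp only [Subtype.mk.injEq, Prod.mk.injEq, true_and] at this
      obtain rfl := this
      push_cast
      ring_nf
  rw [qco, hp, sub_self, Real.sqrt_zero]

/-- The space with basis the standard Young tableaux of shape `λ`, written `v_T`. -/
abbrev Sp (lam : LPartition ℓ) (n : ℕ) : Type := PSYT lam n →₀ ℂ

open Classical in
/-- The basis vector `v_T` if `T` is standard, and `0` otherwise. -/
noncomputable def vec (T : Filling lam n) : Sp lam n :=
  if h : T.IsStandard then Finsupp.single ⟨T, h⟩ 1 else 0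

theorem vec_of (T : PSYT lam n) : vec T.1 = Finsupp.single T 1 := dif_pos T.2

theorem ext_vec {N : Type*} [AddCommMonoid N] [Module ℂ N] {f g : Sp lam n →ₗ[ℂ] N}
    (h : ∀ T : Filling lam n, T.IsStandard → f (vec T) = g (vec T)) : f = g := by
  apply Finsupp.lhom_ext'
  intro T
  apply LinearMap.ext_ring
  simpa [vec_of] using h T.1 T.2

/-- The action of the simple transposition `s_i`:
`s_i v_T = p v_T + √(1 - p²) v_{s_i T}`, where `p = 1 / (ct (T⁻¹ (i+1)) - ct (T⁻¹ i))` if `i` and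
`i + 1` lie in the same component, and `p = 0` otherwise. -/
noncomputable def sOp (lam : LPartition ℓ) {n : ℕ} (i : ℕ) (hi : i + 1 < n) :
    Module.End ℂ (Sp lam n) :=
  Finsupp.linearCombination ℂ fun T : PSYT lam n =>
    ((pco (boxAt T.1 i (Nat.lt_of_succ_lt hi)) (boxAt T.1 (i + 1) hi) : ℝ) : ℂ) • vec T.1 +
    ((qco (boxAt T.1 i (Nat.lt_of_succ_lt hi)) (boxAt T.1 (i + 1) hi) : ℝ) : ℂ) •
      vec (swapF T.1 i hi)

theorem sOp_vec (T : Filling lam n) (i : ℕ) (hi : i + 1 < n) :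
    sOp lam i hi (vec T) =
      ((pco (boxAt T i (Nat.lt_of_succ_lt hi)) (boxAt T (i + 1) hi) : ℝ) : ℂ) • vec T +
      ((qco (boxAt T i (Nat.lt_of_succ_lt hi)) (boxAt T (i + 1) hi) : ℝ) : ℂ) •
        vec (swapF T i hi) := by
  by_cases hT : T.IsStandard
  · rw [vec_of ⟨T, hT⟩, sOp, Finsupp.linearCombination_single, one_smul, vec_of ⟨T, hT⟩]
  · have hv : vec T = 0 := dif_neg hT
    by_cases hs : (swapF T i hi).IsStandard
    · rw [hv, qco_eq_zero T i hi hT hs]; simp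
    · have hv' : vec (swapF T i hi) = 0 := dif_neg hs
      rw [hv, hv']; simp

theorem qcoC_sq (x y : PBox lam) : ((qco x y : ℝ) : ℂ) ^ 2 = 1 - ((pco x y : ℝ) : ℂ) ^ 2 := by
  exact_mod_cast congrArg (fun t : ℝ => (t : ℂ)) (qco_sq x y)

theorem sOp_sq (i : ℕ) (hi : i + 1 < n) : sOp lam i hi * sOp lam i hi = 1 := by
  apply ext_vec
  intro T _
  rw [Module.End.mul_apply, sOp_vec, map_add, map_smul, map_smul, sOp_vec, sOp_vec,
    boxAt_swapF_left, boxAt_swapF_right, swapF_swapF,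
    pco_symm (boxAt T i (Nat.lt_of_succ_lt hi)) (boxAt T (i + 1) hi),
    qco_symm (boxAt T i (Nat.lt_of_succ_lt hi)) (boxAt T (i + 1) hi), Module.End.one_apply]
  have h := qcoC_sq (boxAt T i (Nat.lt_of_succ_lt hi)) (boxAt T (i + 1) hi)
  push_cast
  linear_combination (norm := module) h • vec T

theorem sOp_comm (i j : ℕ) (hij : i + 1 < j) (hi : i + 1 < n) (hj : j + 1 < n) :
    sOp lam i hi * sOp lam j hj = sOp lam j hj * sOp lam i hi := by
  apply ext_vec
  intro T _
  have hsw : swapF (swapF T j hj) i hi = swapF (swapF T i hi) j hj := by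
    have := (braidRel_adjSwap' n).comm i j hij hj
    rw [adjSwap'_eq hi, adjSwap'_eq hj] at this
    apply Equiv.ext
    intro b
    exact congrArg (fun σ : Equiv.Perm (Fin n) => σ (T b)) this
  rw [Module.End.mul_apply, Module.End.mul_apply, sOp_vec, sOp_vec T i, map_add, map_smul, map_smul,
    map_add, map_smul, map_smul, sOp_vec, sOp_vec, sOp_vec, sOp_vec,
    boxAt_swapF_of_ne T j hj i _ (by omega) (by omega),
    boxAt_swapF_of_ne T j hj (i + 1) _ (by omega) (by omega),
    boxAt_swapF_of_ne T i hi j _ (by omega) (by omega),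
    boxAt_swapF_of_ne T i hi (j + 1) _ (by omega) (by omega), hsw]
  module

theorem sOp_braid (i : ℕ) (hi : i + 1 < n) (hi' : i + 1 + 1 < n) :
    sOp lam i hi * sOp lam (i + 1) hi' * sOp lam i hi =
      sOp lam (i + 1) hi' * sOp lam i hi * sOp lam (i + 1) hi' := by
  apply ext_vec
  intro T hT
  set a := boxAt T i (Nat.lt_of_succ_lt hi) with ha
  set b := boxAt T (i + 1) hi with hb
  set c := boxAt T (i + 1 + 1) hi' with hc
  have hTa : (T a : ℕ) = i := by simp [ha, boxAt]
  have hTb : (T b : ℕ) = i + 1 := by simp [hb, boxAt]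
  have hTc : (T c : ℕ) = i + 1 + 1 := by simp [hc, boxAt]
  have hpp : pco a b * pco b c = pco a c * (pco a b + pco b c) :=
    pco_mul a b c
      (ct_ne T hT a b (by rw [Fin.lt_def]; omega) (by omega))
      (ct_ne T hT b c (by rw [Fin.lt_def]; omega) (by omega))
      (ct_ne T hT a c (by rw [Fin.lt_def]; omega) (by omega))
  have hpp' : ((pco a b : ℝ) : ℂ) * (pco b c : ℝ) =
      (pco a c : ℝ) * ((pco a b : ℝ) + (pco b c : ℝ)) := by exact_mod_cast hpp
  have hsw : swapF (swapF (swapF T i hi) (i + 1) hi') i hi =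
      swapF (swapF (swapF T (i + 1) hi') i hi) (i + 1) hi' := by
    have := (braidRel_adjSwap' n).braid i hi'
    rw [adjSwap'_eq hi, adjSwap'_eq hi'] at this
    apply Equiv.ext
    intro x
    exact congrArg (fun σ : Equiv.Perm (Fin n) => σ (T x)) this
  have e1 := sOp_vec T i hi
  have e2 := sOp_vec T (i + 1) hi'
  have e3 := sOp_vec (swapF T i hi) i hi
  have e4 := sOp_vec (swapF T i hi) (i + 1) hi'
  have e5 := sOp_vec (swapF T (i + 1) hi') i hi
  have e6 := sOp_vec (swapF T (i + 1) hi') (i + 1) hi'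
  have e7 := sOp_vec (swapF (swapF T i hi) (i + 1) hi') i hi
  have e8 := sOp_vec (swapF (swapF T (i + 1) hi') i hi) (i + 1) hi'
  have n1 : ∀ (S : Filling lam n), boxAt (swapF S i hi) (i + 1 + 1) hi' = boxAt S (i + 1 + 1) hi' :=
    fun S => boxAt_swapF_of_ne S i hi _ _ (by omega) (by omega)
  have n2 : ∀ (S : Filling lam n), boxAt (swapF S (i + 1) hi') i (Nat.lt_of_succ_lt hi) =
      boxAt S i (Nat.lt_of_succ_lt hi) :=
    fun S => boxAt_swapF_of_ne S (i + 1) hi' _ _ (by omega) (by omega)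
  have n3 : ∀ (S : Filling lam n), boxAt (swapF S (i + 1) hi') (i + 1) hi =
      boxAt S (i + 1 + 1) hi' := fun S => boxAt_swapF_left S (i + 1) hi' hi
  simp only [n1, n2, n3, boxAt_swapF_left, boxAt_swapF_right, swapF_swapF, hsw, ← ha, ← hb, ← hc]
    at e1 e2 e3 e4 e5 e6 e7 e8
  simp only [Module.End.mul_apply, map_add, map_smul, e1, e2, e3, e4, e5, e6, e7, e8]
  simp only [pco_symm a b, pco_symm b c, qco_symm a b, qco_symm b c]
  have q1 := qcoC_sq a b
  have q2 := qcoC_sq b c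
  push_cast
  generalize ((pco a b : ℝ) : ℂ) = x at *
  generalize ((pco b c : ℝ) : ℂ) = y at *
  generalize ((pco a c : ℝ) : ℂ) = z at *
  generalize ((qco a b : ℝ) : ℂ) = u at *
  generalize ((qco b c : ℝ) : ℂ) = v at *
  linear_combination (norm := module) (q1 * z - q2 * z + hpp' * (x - y)) • vec T +
    (u * hpp') • vec (swapF T i hi) - (v * hpp') • vec (swapF T (i + 1) hi')

/-- The character by which a diagonal matrix acts on `v_T`: the product of the `a_i ^ β(T⁻¹ i)`. -/
noncomputable def diagChar (T : Filling lam n) (a : Fin n → rootsOfUnity ℓ ℂ) : ℂ :=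
  ∏ i, (((a i : ℂˣ) : ℂ)) ^ ((T.symm i).1.1 : ℕ)

/-- The action of the diagonal matrix with entries `a` on the basis vectors `v_T`. -/
noncomputable def dOp (lam : LPartition ℓ) {n : ℕ} (a : Fin n → rootsOfUnity ℓ ℂ) :
    Module.End ℂ (Sp lam n) :=
  Finsupp.linearCombination ℂ fun T : PSYT lam n => diagChar T.1 a • vec T.1

theorem dOp_vec (T : Filling lam n) (a : Fin n → rootsOfUnity ℓ ℂ) :
    dOp lam a (vec T) = diagChar T a • vec T := by
  by_cases hT : T.IsStandard
  · rw [vec_of ⟨T, hT⟩, dOp, Finsupp.linearCombination_single, one_smul, vec_of ⟨T, hT⟩]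
  · have hv : vec T = 0 := dif_neg hT
    rw [hv]; simp

theorem dOp_one : dOp lam (1 : Fin n → rootsOfUnity ℓ ℂ) = 1 := by
  apply ext_vec
  intro T _
  rw [dOp_vec]
  simp [diagChar]

theorem dOp_mul (a b : Fin n → rootsOfUnity ℓ ℂ) : dOp lam (a * b) = dOp lam a * dOp lam b := by
  apply ext_vec
  intro T _
  rw [Module.End.mul_apply, dOp_vec, dOp_vec, map_smul, dOp_vec, smul_smul]
  congr 1
  simp [diagChar, mul_pow, Finset.prod_mul_distrib, mul_comm]

theorem diagChar_arrow (T : Filling lam n) (σ : Equiv.Perm (Fin n)) (a : Fin n → rootsOfUnity ℓ ℂ) :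
    diagChar (T.trans σ) ((mulAutArrow σ : MulAut (Fin n → rootsOfUnity ℓ ℂ)) a) =
      diagChar T a := by
  unfold diagChar
  refine (Fintype.prod_equiv σ _ _ fun i => ?_).symm
  rw [arrow_apply, Equiv.symm_apply_apply]
  simp

theorem sOp_dOp (i : ℕ) (hi : i + 1 < n) (a : Fin n → rootsOfUnity ℓ ℂ) :
    sOp lam i hi * dOp lam a =
      dOp lam ((mulAutArrow (adjSwap i hi) : MulAut (Fin n → rootsOfUnity ℓ ℂ)) a) *
        sOp lam i hi := by
  apply ext_vec
  intro T _
  rw [Module.End.mul_apply, Module.End.mul_apply, dOp_vec, map_smul, sOp_vec, map_add, map_smul,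
    map_smul, dOp_vec, dOp_vec, swapF, diagChar_arrow]
  by_cases hj : (boxAt T i (Nat.lt_of_succ_lt hi)).1.1 = (boxAt T (i + 1) hi).1.1
  · have : diagChar T ((mulAutArrow (adjSwap i hi) : MulAut (Fin n → rootsOfUnity ℓ ℂ)) a) =
        diagChar T a := by
      rw [← diagChar_arrow T (adjSwap i hi) a]
      unfold diagChar
      refine Finset.prod_congr rfl fun k _ => ?_
      congr 2
      have h1 : (T.trans (adjSwap i hi)).symm k = T.symm (adjSwap i hi k) := by simp [adjSwap]
      rw [h1]
      unfold boxAt at hj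
      rw [adjSwap, Equiv.swap_apply_def]
      split_ifs with h2 h3
      · rw [h2]; exact hj
      · rw [h3]; exact hj.symm
      · rfl
    rw [this]
    module
  · rw [pco, if_neg hj]
    simp only [Complex.ofReal_zero, zero_smul, zero_add]
    module

/-- `sOp` as a family of invertible operators. -/
noncomputable def sUnit (lam : LPartition ℓ) (n i : ℕ) : (Module.End ℂ (Sp lam n))ˣ :=
  if hi : i + 1 < n then ⟨sOp lam i hi, sOp lam i hi, sOp_sq i hi, sOp_sq i hi⟩ else 1

theorem sUnit_val (i : ℕ) (hi : i + 1 < n) :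
    ((sUnit lam n i : (Module.End ℂ (Sp lam n))ˣ) : Module.End ℂ (Sp lam n)) = sOp lam i hi := by
  rw [sUnit, dif_pos hi]

theorem sUnit_rel : BraidRel n (sUnit lam n) where
  sq i hi := Units.ext (by
    rw [Units.val_mul, sUnit_val i hi, sOp_sq, Units.val_one])
  comm i j hij hj := Units.ext (by
    rw [Units.val_mul, Units.val_mul, sUnit_val i (by omega), sUnit_val j hj]
    exact sOp_comm i j hij _ _)
  braid i hi := Units.ext (by
    rw [Units.val_mul, Units.val_mul, Units.val_mul, Units.val_mul, sUnit_val i (by omega),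
      sUnit_val (i + 1) hi]
    exact sOp_braid i _ _)

/-- The action of `S_n`: the unique homomorphism with `s_i ↦ sOp i`. -/
noncomputable def permHom (lam : LPartition ℓ) (n : ℕ) :
    Equiv.Perm (Fin n) →* (Module.End ℂ (Sp lam n))ˣ :=
  (exists_permLift (sUnit_rel (lam := lam) (n := n))).choose

theorem permHom_adjSwap (i : ℕ) (hi : i + 1 < n) :
    ((permHom lam n (adjSwap i hi) : (Module.End ℂ (Sp lam n))ˣ) : Module.End ℂ (Sp lam n)) =
      sOp lam i hi := by
  rw [permHom, (exists_permLift (sUnit_rel (lam := lam) (n := n))).choose_spec i hi, sUnit_val]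

/-- The action of the group of diagonal matrices. -/
noncomputable def diagHom (lam : LPartition ℓ) (n : ℕ) :
    (Fin n → rootsOfUnity ℓ ℂ) →* (Module.End ℂ (Sp lam n))ˣ :=
  MonoidHom.toHomUnits ⟨⟨dOp lam, dOp_one⟩, dOp_mul⟩

theorem diagHom_val (a : Fin n → rootsOfUnity ℓ ℂ) :
    ((diagHom lam n a : (Module.End ℂ (Sp lam n))ˣ) : Module.End ℂ (Sp lam n)) = dOp lam a := rfl

theorem permHom_diagHom (σ : Equiv.Perm (Fin n)) : ∀ a : Fin n → rootsOfUnity ℓ ℂ,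
    permHom lam n σ * diagHom lam n a = diagHom lam n (mulAutArrow σ a) * permHom lam n σ := by
  have hσ : σ ∈ Submonoid.closure
      {x : Equiv.Perm (Fin n) | ∃ i, 0 ≤ i ∧ i + 1 < n ∧ x = adjSwap' n i} := by
    rw [closure_adjSwap]; trivial
  induction hσ using Submonoid.closure_induction with
  | mem x hx =>
    obtain ⟨i, -, hi, rfl⟩ := hx
    intro a
    rw [adjSwap'_eq hi]
    apply Units.ext
    rw [Units.val_mul, Units.val_mul, permHom_adjSwap, diagHom_val, diagHom_val, sOp_dOp]
  | one => intro a; simp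
  | mul x y _ _ hx hy =>
    intro a
    rw [map_mul, map_mul, mul_assoc, hy, ← mul_assoc, hx, mul_assoc, MulAut.mul_apply]

end Young

/-- The irreducible representation `S^λ` of `G(ℓ,1,n)` attached to an `ℓ`-partition `λ` of `n`, in
Young's orthogonal form: it has a basis `v_T` indexed by the standard Young tableaux `T` of shape `λ`,
a diagonal matrix with entries `a` acts on `v_T` by `∏ i, a_i ^ β(T⁻¹ i)`, and `s_i` acts by
`Young.sOp`. (If `λ` does not have `n` boxes, then this is the zero representation.) -/
noncomputable def spechtRep {ℓ : ℕ} (lam : LPartition ℓ) (n : ℕ) :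
    Representation ℂ (GGroup ℓ n) (Young.Sp lam n) :=
  (Units.coeHom (Module.End ℂ (Young.Sp lam n))).comp
    (SemidirectProduct.lift (Young.diagHom lam n) (Young.permHom lam n) (by
      intro σ
      refine MonoidHom.ext fun a => ?_
      have := Young.permHom_diagHom (lam := lam) σ a
      rw [MonoidHom.comp_apply, MonoidHom.comp_apply]
      simp [this]))

theorem spechtRep_simpleRefl {ℓ n : ℕ} (lam : LPartition ℓ) (i : ℕ) (hi : i + 1 < n) :
    spechtRep lam n (simpleRefl i hi) = Young.sOp lam i hi := by
  rw [← Young.permHom_adjSwap]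
  simp [spechtRep, simpleRefl, permMat]

theorem spechtRep_diagAt {ℓ n : ℕ} (lam : LPartition ℓ) (i : Fin n) (ε : rootsOfUnity ℓ ℂ)
    (T : PSYT lam n) :
    spechtRep lam n (diagAt i ε) (Finsupp.single T 1) =
      (((ε : ℂˣ) : ℂ) ^ ((T.1.symm i).1.1 : ℕ)) • Finsupp.single T 1 := by
  have h : spechtRep lam n (diagAt i ε) = Young.dOp lam (Pi.mulSingle i ε) := by
    rw [← Young.diagHom_val]
    simp [spechtRep, diagAt]
  rw [h, ← Young.vec_of, Young.dOp_vec, Young.diagChar]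
  congr 1
  rw [Finset.prod_eq_single i]
  · simp
  · intro j _ hj
    simp [Pi.mulSingle_eq_of_ne hj]
  · simp

/-! The degenerate affine Hecke algebra `H_{ℓ,n}`. -/

section Hecke

open scoped TensorProduct

variable {ℓ n : ℕ} [NeZero ℓ]

/-- The free algebra on the letters `u_1, …, u_n` and on the elements of `G(ℓ,1,n)`. -/
abbrev PreHecke (ℓ n : ℕ) : Type := FreeAlgebra ℂ (Fin n ⊕ GGroup ℓ n)

/-- The letter `u_i`. -/
noncomputable def preU {ℓ n : ℕ} (i : Fin n) : PreHecke ℓ n := FreeAlgebra.ι ℂ (Sum.inl i)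

/-- The letter of a group element. -/
noncomputable def preG {ℓ n : ℕ} (g : GGroup ℓ n) : PreHecke ℓ n := FreeAlgebra.ι ℂ (Sum.inr g)

/-- The defining relations of `H_{ℓ,n}`: those of the polynomial ring `ℂ[u_1, …, u_n]`, those of the
group `G(ℓ,1,n)`, and
`ζ_i u_j = u_j ζ_i`, `s_i u_j = u_j s_i` for `j ≠ i, i + 1`, `s_i u_i = u_{i+1} s_i - π_i` with
`π_i = ∑_k ζ_i^k ζ_{i+1}^{-k}`. They are written with all `ε ∈ μ_ℓ` in place of the powers `ζ^k` of a
primitive `ℓ`-th root of unity. -/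
inductive HeckeRel (ℓ n : ℕ) [NeZero ℓ] : PreHecke ℓ n → PreHecke ℓ n → Prop
  | u_comm (i j : Fin n) : HeckeRel ℓ n (preU i * preU j) (preU j * preU i)
  | g_one : HeckeRel ℓ n (preG 1) 1
  | g_mul (g h : GGroup ℓ n) : HeckeRel ℓ n (preG (g * h)) (preG g * preG h)
  | diag_u (i j : Fin n) (ε : rootsOfUnity ℓ ℂ) :
      HeckeRel ℓ n (preG (diagAt i ε) * preU j) (preU j * preG (diagAt i ε))
  | s_u_of_ne (i : ℕ) (hi : i + 1 < n) (j : Fin n) (h1 : (j : ℕ) ≠ i) (h2 : (j : ℕ) ≠ i + 1) :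
      HeckeRel ℓ n (preG (simpleRefl i hi) * preU j) (preU j * preG (simpleRefl i hi))
  | s_u (i : ℕ) (hi : i + 1 < n) :
      HeckeRel ℓ n (preG (simpleRefl i hi) * preU ⟨i, Nat.lt_of_succ_lt hi⟩)
        (preU ⟨i + 1, hi⟩ * preG (simpleRefl i hi) -
          ∑ ε : rootsOfUnity ℓ ℂ,
            preG (diagAt ⟨i, Nat.lt_of_succ_lt hi⟩ ε * (diagAt ⟨i + 1, hi⟩ ε)⁻¹))

/-- The degenerate affine Hecke algebra `H_{ℓ,n}` of type `G(ℓ,1,n)`. -/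
abbrev Hecke (ℓ n : ℕ) [NeZero ℓ] : Type := RingQuot (HeckeRel ℓ n)

/-- The generator `u_i` of `H_{ℓ,n}`. -/
noncomputable def uH (i : Fin n) : Hecke ℓ n := RingQuot.mkAlgHom ℂ (HeckeRel ℓ n) (preU i)

/-- The group `G(ℓ,1,n)` in `H_{ℓ,n}`. -/
noncomputable def gH (ℓ n : ℕ) [NeZero ℓ] : GGroup ℓ n →* Hecke ℓ n where
  toFun g := RingQuot.mkAlgHom ℂ (HeckeRel ℓ n) (preG g)
  map_one' := by
    rw [RingQuot.mkAlgHom_rel ℂ (HeckeRel.g_one (ℓ := ℓ) (n := n)), map_one]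
  map_mul' g h := by
    rw [RingQuot.mkAlgHom_rel ℂ (HeckeRel.g_mul g h), map_mul]

theorem gH_apply (g : GGroup ℓ n) :
    gH ℓ n g = RingQuot.mkAlgHom ℂ (HeckeRel ℓ n) (preG g) := rfl

theorem uH_comm (i j : Fin n) : (uH i * uH j : Hecke ℓ n) = uH j * uH i := by
  simpa [uH] using RingQuot.mkAlgHom_rel ℂ (HeckeRel.u_comm (ℓ := ℓ) i j)

theorem diag_uH (i j : Fin n) (ε : rootsOfUnity ℓ ℂ) :
    gH ℓ n (diagAt i ε) * uH j = uH j * gH ℓ n (diagAt i ε) := by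
  simpa [uH, gH_apply] using RingQuot.mkAlgHom_rel ℂ (HeckeRel.diag_u i j ε)

theorem s_uH_of_ne (i : ℕ) (hi : i + 1 < n) (j : Fin n) (h1 : (j : ℕ) ≠ i) (h2 : (j : ℕ) ≠ i + 1) :
    gH ℓ n (simpleRefl i hi) * uH j = uH j * gH ℓ n (simpleRefl i hi) := by
  simpa [uH, gH_apply] using RingQuot.mkAlgHom_rel ℂ (HeckeRel.s_u_of_ne (ℓ := ℓ) i hi j h1 h2)

theorem s_uH (i : ℕ) (hi : i + 1 < n) :
    gH ℓ n (simpleRefl i hi) * uH ⟨i, Nat.lt_of_succ_lt hi⟩ =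
      uH ⟨i + 1, hi⟩ * gH ℓ n (simpleRefl i hi) -
        ∑ ε : rootsOfUnity ℓ ℂ,
          gH ℓ n (diagAt ⟨i, Nat.lt_of_succ_lt hi⟩ ε * (diagAt ⟨i + 1, hi⟩ ε)⁻¹) := by
  have := RingQuot.mkAlgHom_rel ℂ (HeckeRel.s_u (ℓ := ℓ) i hi)
  rw [map_mul, map_sub, map_mul, map_sum] at this
  exact this

/-- The universal property of `H_{ℓ,n}`. -/
noncomputable def heckeLift {B : Type*} [Ring B] [Algebra ℂ B] (U : Fin n → B) (F : GGroup ℓ n →* B)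
    (h1 : ∀ i j, U i * U j = U j * U i)
    (h2 : ∀ i j ε, F (diagAt i ε) * U j = U j * F (diagAt i ε))
    (h3 : ∀ i (hi : i + 1 < n) (j : Fin n), (j : ℕ) ≠ i → (j : ℕ) ≠ i + 1 →
      F (simpleRefl i hi) * U j = U j * F (simpleRefl i hi))
    (h4 : ∀ i (hi : i + 1 < n), F (simpleRefl i hi) * U ⟨i, Nat.lt_of_succ_lt hi⟩ =
      U ⟨i + 1, hi⟩ * F (simpleRefl i hi) -
        ∑ ε : rootsOfUnity ℓ ℂ, F (diagAt ⟨i, Nat.lt_of_succ_lt hi⟩ ε * (diagAt ⟨i + 1, hi⟩ ε)⁻¹)) :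
    Hecke ℓ n →ₐ[ℂ] B :=
  RingQuot.liftAlgHom ℂ ⟨FreeAlgebra.lift ℂ (Sum.elim U F), by
    have hU : ∀ i, FreeAlgebra.lift ℂ (Sum.elim U F) (preU i) = U i := fun i => by simp [preU]
    have hF : ∀ g, FreeAlgebra.lift ℂ (Sum.elim U F) (preG g) = F g := fun g => by simp [preG]
    intro x y hxy
    cases hxy with
    | u_comm i j => simp only [map_mul, hU, h1 i j]
    | g_one => simp only [hF, map_one]
    | g_mul g h => simp only [map_mul, hF]
    | diag_u i j ε => simp only [map_mul, hU, hF, h2 i j ε]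
    | s_u_of_ne i hi j e1 e2 => simp only [map_mul, hU, hF, h3 i hi j e1 e2]
    | s_u i hi =>
      rw [map_mul, map_sub, map_mul, map_sum, hF, hU, hU, h4 i hi]
      simp only [hF]⟩

section
variable {B : Type*} [Ring B] [Algebra ℂ B] {U : Fin n → B} {F : GGroup ℓ n →* B}

theorem heckeLift_uH (h1 h2 h3 h4) (i : Fin n) : heckeLift U F h1 h2 h3 h4 (uH i) = U i := by
  simp [heckeLift, uH, preU]

theorem heckeLift_gH (h1 h2 h3 h4) (g : GGroup ℓ n) :
    heckeLift U F h1 h2 h3 h4 (gH ℓ n g) = F g := by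
  simp [heckeLift, gH_apply, preG]

end

/-- A subalgebra of `H_{ℓ,n}` that contains all generators is everything. -/
theorem hecke_induction (S : Subalgebra ℂ (Hecke ℓ n)) (hu : ∀ i, uH i ∈ S)
    (hg : ∀ g, gH ℓ n g ∈ S) (x : Hecke ℓ n) : x ∈ S := by
  obtain ⟨y, rfl⟩ := RingQuot.mkAlgHom_surjective ℂ (HeckeRel ℓ n) x
  induction y using FreeAlgebra.induction with
  | grade0 r => rw [AlgHom.commutes]; exact S.algebraMap_mem r
  | grade1 z =>
    cases z with
    | inl i => exact hu i
    | inr g => exact hg g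
  | mul a b ha hb => rw [map_mul]; exact S.mul_mem ha hb
  | add a b ha hb => rw [map_add]; exact S.add_mem ha hb

/-- `G(ℓ,1,n)` is generated by the `ε_i` and the `s_i`. -/
theorem gGroup_induction {ℓ n : ℕ} (S : Submonoid (GGroup ℓ n)) (hd : ∀ i ε, diagAt i ε ∈ S)
    (hs : ∀ i hi, simpleRefl i hi ∈ S) (g : GGroup ℓ n) : g ∈ S := by
  rw [← SemidirectProduct.inl_left_mul_inr_right g]
  refine S.mul_mem ?_ ?_
  · have : g.left ∈ S.comap SemidirectProduct.inl := by
      rw [← Finset.univ_prod_mulSingle g.left]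
      exact Submonoid.prod_mem _ fun i _ => hd i _
    exact this
  · have : g.right ∈ Submonoid.closure
        {x : Equiv.Perm (Fin n) | ∃ i, 0 ≤ i ∧ i + 1 < n ∧ x = adjSwap' n i} := by
      rw [closure_adjSwap]; trivial
    have h2 : Submonoid.closure
        {x : Equiv.Perm (Fin n) | ∃ i, 0 ≤ i ∧ i + 1 < n ∧ x = adjSwap' n i} ≤
        S.comap SemidirectProduct.inr := by
      rw [Submonoid.closure_le]
      rintro _ ⟨i, -, hi, rfl⟩
      rw [adjSwap'_eq hi]
      exact hs i hi
    exact h2 this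

/-- The algebra homomorphism `t_κ` with `u_i ↦ u_i + κ` that fixes `G(ℓ,1,n)`. -/
noncomputable def shiftAut (ℓ n : ℕ) [NeZero ℓ] (κ : ℂ) : Hecke ℓ n →ₐ[ℂ] Hecke ℓ n :=
  heckeLift (fun i => uH i + algebraMap ℂ _ κ) (gH ℓ n)
    (by
      intro i j
      have := Algebra.commutes κ (uH i : Hecke ℓ n)
      have h2 := Algebra.commutes κ (uH j : Hecke ℓ n)
      simp only [add_mul, mul_add, uH_comm i j, this, h2]
      abel)
    (by
      intro i j ε
      rw [mul_add, add_mul, diag_uH, Algebra.commutes])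
    (by
      intro i hi j e1 e2
      rw [mul_add, add_mul, s_uH_of_ne i hi j e1 e2, Algebra.commutes])
    (by
      intro i hi
      rw [mul_add, add_mul, s_uH, Algebra.commutes]
      abel)

/-- The homomorphism `H_{ℓ,a} → H_{ℓ,b}` with `u_i ↦ u_{o+i}`, `ζ_i ↦ ζ_{o+i}`, `s_i ↦ s_{o+i}`. -/
noncomputable def heckeShift (ℓ o a b : ℕ) [NeZero ℓ] (h : o + a ≤ b) :
    Hecke ℓ a →ₐ[ℂ] Hecke ℓ b :=
  heckeLift (fun i => uH (shiftEmb o a b h i)) ((gH ℓ b).comp (embGroup (shiftEmb o a b h)))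
    (fun _ _ => uH_comm _ _)
    (by
      intro i j ε
      rw [MonoidHom.comp_apply, embGroup_diagAt, diag_uH])
    (by
      intro i hi j e1 e2
      rw [MonoidHom.comp_apply, embGroup_shift_simpleRefl]
      exact s_uH_of_ne _ _ _ (by rw [shiftEmb_val]; omega)
        (by rw [shiftEmb_val]; omega))
    (by
      intro i hi
      rw [MonoidHom.comp_apply, embGroup_shift_simpleRefl]
      refine (s_uH (o + i) (by omega)).trans ?_
      congr 1
      refine Finset.sum_congr rfl fun ε _ => ?_
      rw [MonoidHom.comp_apply, map_mul (embGroup _), map_inv, embGroup_diagAt, embGroup_diagAt]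
      rfl)

theorem heckeShift_uH {o a b : ℕ} (h : o + a ≤ b) (i : Fin a) :
    heckeShift ℓ o a b h (uH i) = uH (shiftEmb o a b h i) := heckeLift_uH _ _ _ _ i

theorem heckeShift_gH {o a b : ℕ} (h : o + a ≤ b) (g : GGroup ℓ a) :
    heckeShift ℓ o a b h (gH ℓ a g) = gH ℓ b (embGroup (shiftEmb o a b h) g) :=
  heckeLift_gH _ _ _ _ g

theorem uH_commute_embGroup {a b : ℕ} (f : Fin a ↪ Fin b) (hf : ∀ i (hi : i + 1 < a),
      ((f ⟨i + 1, hi⟩ : Fin b) : ℕ) = f ⟨i, Nat.lt_of_succ_lt hi⟩ + 1)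
    (k : Fin b) (hk : ∀ i, f i ≠ k) (g : GGroup ℓ a) :
    Commute (uH k : Hecke ℓ b) (gH ℓ b (embGroup f g)) := by
  have : g ∈ (Submonoid.centralizer {(uH k : Hecke ℓ b)}).comap ((gH ℓ b).comp (embGroup f)) := by
    refine gGroup_induction _ (fun i ε => ?_) (fun i hi => ?_) g
    · rw [Submonoid.mem_comap, Submonoid.mem_centralizer_iff]
      rintro _ rfl
      rw [MonoidHom.comp_apply, embGroup_diagAt, diag_uH]
    · rw [Submonoid.mem_comap, Submonoid.mem_centralizer_iff]
      rintro _ rfl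
      rw [MonoidHom.comp_apply]
      have e : embGroup f (simpleRefl i hi : GGroup ℓ a) =
          simpleRefl (f ⟨i, Nat.lt_of_succ_lt hi⟩ : Fin b)
            (by rw [← hf i hi]; exact (f ⟨i + 1, hi⟩).2) := by
        rw [simpleRefl, adjSwap, embGroup_swap, simpleRefl, adjSwap]
        congr 2
        exact Fin.ext (hf i hi)
      rw [e]
      symm
      refine s_uH_of_ne _ _ _ (fun h => ?_) (fun h => ?_)
      · exact hk ⟨i, _⟩ (Fin.ext h.symm)
      · exact hk ⟨i + 1, hi⟩ (Fin.ext ((hf i hi).trans h.symm))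
  rw [Submonoid.mem_comap, Submonoid.mem_centralizer_iff] at this
  exact this _ rfl

theorem heckeShift_commute {o o' a a' b : ℕ} (h : o + a ≤ b) (h' : o' + a' ≤ b)
    (hd : o + a ≤ o' ∨ o' + a' ≤ o) (x : Hecke ℓ a) (y : Hecke ℓ a') :
    Commute (heckeShift ℓ o a b h x) (heckeShift ℓ o' a' b h' y) := by
  have hne : ∀ i j, shiftEmb o a b h i ≠ shiftEmb o' a' b h' j := by
    intro i j hij
    have := congrArg Fin.val hij
    simp only [shiftEmb_val] at this
    omega
  have main : ∀ y, y ∈ (Subalgebra.centralizer ℂ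
      (Set.range (heckeShift ℓ o a b h))).comap (heckeShift ℓ o' a' b h') := by
    intro y
    refine hecke_induction _ (fun j => ?_) (fun g => ?_) y
    all_goals
      rw [Subalgebra.mem_comap, Subalgebra.mem_centralizer_iff]
      rintro _ ⟨x, rfl⟩
      first | rw [heckeShift_uH] | rw [heckeShift_gH]
    · have : x ∈ (Subalgebra.centralizer ℂ
          {(uH (shiftEmb o' a' b h' j) : Hecke ℓ b)}).comap (heckeShift ℓ o a b h) := by
        refine hecke_induction _ (fun i => ?_) (fun g => ?_) x
        · rw [Subalgebra.mem_comap, Subalgebra.mem_centralizer_iff]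
          rintro _ rfl
          rw [heckeShift_uH, uH_comm]
        · rw [Subalgebra.mem_comap, Subalgebra.mem_centralizer_iff]
          rintro _ rfl
          rw [heckeShift_gH]
          exact uH_commute_embGroup _ (fun i hi => rfl) _ (fun i => hne i j) g
      rw [Subalgebra.mem_comap, Subalgebra.mem_centralizer_iff] at this
      exact (this _ rfl).symm
    · have : x ∈ (Subalgebra.centralizer ℂ
          {gH ℓ b (embGroup (shiftEmb o' a' b h') g)}).comap (heckeShift ℓ o a b h) := by
        refine hecke_induction _ (fun i => ?_) (fun g' => ?_) x
        · rw [Subalgebra.mem_comap, Subalgebra.mem_centralizer_iff]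
          rintro _ rfl
          rw [heckeShift_uH]
          exact (uH_commute_embGroup _ (fun i hi => rfl) _ (fun j => (hne i j).symm) g).symm
        · rw [Subalgebra.mem_comap, Subalgebra.mem_centralizer_iff]
          rintro _ rfl
          rw [heckeShift_gH, ← map_mul, ← map_mul,
            (embGroup_commute _ _ (fun i j => (hne j i).symm) g g').eq]
      rw [Subalgebra.mem_comap, Subalgebra.mem_centralizer_iff] at this
      exact (this _ rfl).symm
  have := main y
  rw [Subalgebra.mem_comap, Subalgebra.mem_centralizer_iff] at this
  exact this _ ⟨x, rfl⟩

/-! The modules `S^{λ∖μ}`. -/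

theorem embGroup_zero_right {ℓ : ℕ} (m n : ℕ) (g : GGroup ℓ m) (k : Fin (m + n)) :
    (m ≤ (k : ℕ) → (embGroup (shiftEmb 0 m (m + n) (by omega)) g).right k = k) ∧
      ((k : ℕ) < m → (((embGroup (shiftEmb 0 m (m + n) (by omega)) g).right k : Fin (m + n)) : ℕ) < m) := by
  rw [right_embGroup]
  constructor
  · intro hk
    apply Equiv.Perm.viaEmbedding_apply_of_notMem
    rintro ⟨i, hi⟩
    have := congrArg Fin.val hi
    simp only [shiftEmb_val] at this
    omega
  · intro hk
    have : k = shiftEmb 0 m (m + n) (by omega) ⟨k, hk⟩ := by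
      ext; exact (Nat.zero_add _).symm
    rw [this, Equiv.Perm.viaEmbedding_apply, shiftEmb_val]
    omega

/-- The homomorphism `H_{ℓ,n} → ℂ G(ℓ,1,m+n)` with `u_i ↦ φ_{m+i}`, `ζ_i ↦ ζ_{m+i}`,
`s_i ↦ s_{m+i}`. -/
noncomputable def jmHom (ℓ m n : ℕ) [NeZero ℓ] :
    Hecke ℓ n →ₐ[ℂ] MonoidAlgebra ℂ (GGroup ℓ (m + n)) :=
  heckeLift (fun i => jmElt (shiftEmb m n (m + n) le_rfl i))
    ((MonoidAlgebra.of ℂ (GGroup ℓ (m + n))).comp (embGroup (shiftEmb m n (m + n) le_rfl)))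
    (fun _ _ => jmElt_commute _ _)
    (by
      intro i j ε
      rw [MonoidHom.comp_apply, embGroup_diagAt, jmElt_diagAt])
    (by
      intro i hi j e1 e2
      rw [MonoidHom.comp_apply, embGroup_shift_simpleRefl]
      exact jmElt_simpleRefl _ _ _ (by rw [shiftEmb_val]; omega)
        (by rw [shiftEmb_val]; omega))
    (by
      intro i hi
      rw [MonoidHom.comp_apply, embGroup_shift_simpleRefl]
      refine (jmElt_succ (m + i) (by omega)).trans ?_
      congr 1
      refine Finset.sum_congr rfl fun ε _ => ?_
      rw [MonoidHom.comp_apply, map_mul (embGroup _), map_inv, embGroup_diagAt, embGroup_diagAt]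
      rfl)

theorem jmHom_uH (m : ℕ) (i : Fin n) :
    jmHom ℓ m n (uH i) = jmElt (shiftEmb m n (m + n) le_rfl i) := heckeLift_uH _ _ _ _ i

theorem jmHom_gH (m : ℕ) (g : GGroup ℓ n) :
    jmHom ℓ m n (gH ℓ n g) =
      MonoidAlgebra.of ℂ (GGroup ℓ (m + n)) (embGroup (shiftEmb m n (m + n) le_rfl) g) :=
  heckeLift_gH _ _ _ _ g

/-- The image of `jmHom` centralizes `G(ℓ,1,m)`. -/
theorem jmHom_commute (m : ℕ) (g : GGroup ℓ m) (x : Hecke ℓ n) :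
    MonoidAlgebra.of ℂ (GGroup ℓ (m + n)) (embGroup (shiftEmb 0 m (m + n) (by omega)) g) *
        jmHom ℓ m n x =
      jmHom ℓ m n x *
        MonoidAlgebra.of ℂ (GGroup ℓ (m + n)) (embGroup (shiftEmb 0 m (m + n) (by omega)) g) := by
  have : x ∈ (Subalgebra.centralizer ℂ {MonoidAlgebra.of ℂ (GGroup ℓ (m + n))
      (embGroup (shiftEmb 0 m (m + n) (by omega)) g)}).comap (jmHom ℓ m n) := by
    refine hecke_induction _ (fun i => ?_) (fun g' => ?_) x
    · rw [Subalgebra.mem_comap, Subalgebra.mem_centralizer_iff]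
      rintro _ rfl
      rw [jmHom_uH]
      have hm : m ≤ ((shiftEmb m n (m + n) le_rfl i : Fin (m + n)) : ℕ) := by
        rw [shiftEmb_val]; omega
      apply commute_jmElt
      · exact (embGroup_zero_right m n g _).1 hm
      · intro k hk
        rcases Nat.lt_or_ge (k : ℕ) m with h | h
        · rw [Fin.lt_def]
          exact lt_of_lt_of_le ((embGroup_zero_right m n g k).2 h) hm
        · rwa [(embGroup_zero_right m n g k).1 h]
    · rw [Subalgebra.mem_comap, Subalgebra.mem_centralizer_iff]
      rintro _ rfl
      rw [jmHom_gH, ← map_mul, ← map_mul, (embGroup_commute _ _ _ g g').eq]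
      intro i j hij
      have := congrArg Fin.val hij
      simp only [shiftEmb_val] at this
      omega
  rw [Subalgebra.mem_comap, Subalgebra.mem_centralizer_iff] at this
  exact this _ rfl

/-- The space `S^{λ∖μ} = Hom_{ℂ G(ℓ,1,m)}(S^μ, Res S^λ)`, where `S^λ` is a representation of
`G(ℓ,1,m+n)` and `G(ℓ,1,m)` acts on the first `m` indices. -/
def SkewSpecht {ℓ : ℕ} (lam mu : LPartition ℓ) (m n : ℕ) :
    Submodule ℂ (Young.Sp mu m →ₗ[ℂ] Young.Sp lam (m + n)) where
  carrier := {f | ∀ g : GGroup ℓ m, f ∘ₗ spechtRep mu m g =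
    spechtRep lam (m + n) (embGroup (shiftEmb 0 m (m + n) (by omega)) g) ∘ₗ f}
  add_mem' := by
    intro f f' hf hf' g
    rw [LinearMap.add_comp, LinearMap.comp_add, hf g, hf' g]
  zero_mem' := by
    intro g
    rw [LinearMap.zero_comp, LinearMap.comp_zero]
  smul_mem' := by
    intro c f hf g
    rw [LinearMap.smul_comp, LinearMap.comp_smul, hf g]

/-- The action of `H_{ℓ,n}` on `S^{λ∖μ}` through the homomorphism `jmHom`. -/
noncomputable def skewRep (lam mu : LPartition ℓ) (m n : ℕ) :
    Hecke ℓ n →ₐ[ℂ] Module.End ℂ (SkewSpecht lam mu m n) :=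
  AlgHom.ofLinearMap
    { toFun := fun x =>
        { toFun := fun f => ⟨(spechtRep lam (m + n)).asAlgebraHom (jmHom ℓ m n x) ∘ₗ f.1, by
            intro g
            have h := congrArg (spechtRep lam (m + n)).asAlgebraHom (jmHom_commute m g x)
            rw [map_mul, map_mul, Representation.asAlgebraHom_of] at h
            rw [LinearMap.comp_assoc, f.2 g, ← LinearMap.comp_assoc, ← LinearMap.comp_assoc]
            exact congrArg (fun z => z ∘ₗ f.1) h.symm⟩
          map_add' := fun f f' => Subtype.ext (LinearMap.comp_add _ _ _)
          map_smul' := fun c f => Subtype.ext (LinearMap.comp_smul _ _ _) }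
      map_add' := fun x y => by
        ext f : 2
        simp [LinearMap.add_comp]
      map_smul' := fun c x => by
        ext f : 2
        simp [LinearMap.smul_comp] }
    (by ext f : 2; simp [Module.End.one_eq_id])
    (by
      intro x y
      ext f : 2
      simp [Module.End.mul_eq_comp, LinearMap.comp_assoc])

/-! Induction. -/

/-- The position at which the `i`-th block starts if `0, …, n-1` is cut into consecutive blocks of
sizes `size 0, size 1, …`. -/
def blockStart {k : ℕ} (size : Fin k → ℕ) (i : Fin k) : ℕ := ∑ j ∈ Finset.Iio i, size j

theorem blockStart_add {k : ℕ} (size : Fin k → ℕ) (i : Fin k) :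
    blockStart size i + size i = ∑ j ∈ Finset.Iic i, size j := by
  rw [blockStart, ← Finset.Iio_insert i, Finset.sum_insert (by simp), add_comm]

theorem blockStart_le {k : ℕ} (size : Fin k → ℕ) (i : Fin k) :
    blockStart size i + size i ≤ ∑ j, size j := by
  rw [blockStart_add]
  exact Finset.sum_le_sum_of_subset (Finset.subset_univ _)

theorem blockStart_lt {k : ℕ} (size : Fin k → ℕ) (i j : Fin k) (h : i < j) :
    blockStart size i + size i ≤ blockStart size j := by
  rw [blockStart_add, blockStart]
  refine Finset.sum_le_sum_of_subset fun x hx => ?_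
  simp only [Finset.mem_Iic, Finset.mem_Iio] at hx ⊢
  exact lt_of_le_of_lt hx h

/-- The algebra `A = H_{ℓ,n_1} ⊗ ⋯ ⊗ H_{ℓ,n_k}`. -/
abbrev YoungAlg (ℓ : ℕ) [NeZero ℓ] {k : ℕ} (size : Fin k → ℕ) : Type :=
  ⨂[ℂ] i, Hecke ℓ (size i)

theorem prod_ofFn_mul {M : Type*} [Monoid M] {k : ℕ} (f g : Fin k → M)
    (h : ∀ i j, i ≠ j → Commute (f i) (g j)) :
    (List.ofFn fun i => f i * g i).prod = (List.ofFn f).prod * (List.ofFn g).prod := by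
  induction k with
  | zero => simp
  | succ k ih =>
    rw [List.ofFn_succ, List.ofFn_succ, List.ofFn_succ, List.prod_cons, List.prod_cons,
      List.prod_cons, ih (fun i => f i.succ) (fun i => g i.succ)
        (fun i j hij => h _ _ fun e => hij (Fin.succ_injective _ e))]
    have hc : Commute (g 0) (List.ofFn fun i : Fin k => f i.succ).prod := by
      apply Commute.list_prod_right
      intro x hx
      obtain ⟨i, rfl⟩ := List.mem_ofFn.1 hx
      exact (h _ _ (Fin.succ_ne_zero i)).symm
    calc f 0 * g 0 * ((List.ofFn fun i : Fin k => f i.succ).prod *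
          (List.ofFn fun i : Fin k => g i.succ).prod)
        = f 0 * (g 0 * (List.ofFn fun i : Fin k => f i.succ).prod) *
          (List.ofFn fun i : Fin k => g i.succ).prod := by simp only [mul_assoc]
      _ = _ := by rw [hc.eq]; simp only [mul_assoc]

/-- The homomorphism `H_{ℓ,n_1} ⊗ ⋯ ⊗ H_{ℓ,n_k} → H_{ℓ,n_1+⋯+n_k}`, which maps `a_1 ⊗ ⋯ ⊗ a_k` to
the product of the images of the `a_i` under the shifts to consecutive blocks. -/
noncomputable def youngHom (ℓ : ℕ) [NeZero ℓ] {k : ℕ} (size : Fin k → ℕ) :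
    YoungAlg ℓ size →ₐ[ℂ] Hecke ℓ (∑ i, size i) :=
  PiTensorProduct.liftAlgHom
    ((MultilinearMap.mkPiAlgebraFin ℂ k (Hecke ℓ (∑ i, size i))).compLinearMap fun i =>
      (heckeShift ℓ (blockStart size i) (size i) _ (blockStart_le size i)).toLinearMap)
    (by simp)
    (by
      intro x y
      simp only [MultilinearMap.compLinearMap_apply, MultilinearMap.mkPiAlgebraFin_apply,
        AlgHom.toLinearMap_apply, Pi.mul_apply, map_mul]
      apply prod_ofFn_mul
      intro i j hij
      apply heckeShift_commute
      rcases lt_or_gt_of_ne hij with h | h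
      · exact Or.inl (blockStart_lt size i j h)
      · exact Or.inr (blockStart_lt size j i h))

/-- The exterior tensor product of representations of the algebras `H_{ℓ,n_i}`. -/
noncomputable def tensorRep {k : ℕ} {size : Fin k → ℕ} {N : Fin k → Type} [∀ i, AddCommMonoid (N i)]
    [∀ i, Module ℂ (N i)] (ρ : ∀ i, Hecke ℓ (size i) →ₐ[ℂ] Module.End ℂ (N i)) :
    YoungAlg ℓ size →ₐ[ℂ] Module.End ℂ (⨂[ℂ] i, N i) :=
  PiTensorProduct.liftAlgHom
    ((PiTensorProduct.mapMultilinear ℂ N N).compLinearMap fun i => (ρ i).toLinearMap)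
    (by
      simp only [MultilinearMap.compLinearMap_apply, PiTensorProduct.mapMultilinear_apply,
        AlgHom.toLinearMap_apply, Pi.one_apply, map_one]
      exact PiTensorProduct.map_one)
    (by
      intro x y
      simp only [MultilinearMap.compLinearMap_apply, PiTensorProduct.mapMultilinear_apply,
        AlgHom.toLinearMap_apply, Pi.mul_apply, map_mul]
      exact PiTensorProduct.map_mul _ _)

end Hecke

section Induction

open scoped TensorProduct

variable {A B N : Type} [Semiring A] [Algebra ℂ A] [Ring B] [Algebra ℂ B] [AddCommMonoid N] [Module ℂ N]

/-- The `B`-submodule of `B ⊗_ℂ N` spanned by the elements `b f(a) ⊗ x - b ⊗ a x`. -/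
def indRel (f : A →ₐ[ℂ] B) (ρ : A →ₐ[ℂ] Module.End ℂ N) : Submodule B (B ⊗[ℂ] N) :=
  Submodule.span B {z | ∃ (b : B) (a : A) (x : N), z = (b * f a) ⊗ₜ[ℂ] x - b ⊗ₜ[ℂ] (ρ a x)}

/-- The induced module `Ind_A^B N = B ⊗_A N` of a representation `ρ` of `A` on `N` along
`f : A → B`. -/
abbrev Ind (f : A →ₐ[ℂ] B) (ρ : A →ₐ[ℂ] Module.End ℂ N) : Type := (B ⊗[ℂ] N) ⧸ indRel f ρ

end Induction

/-! The subalgebra `𝔲` and diagonalizability. -/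

/-- The subalgebra `𝔲` of `H_{ℓ,n}` generated by the `u_i` and the `ζ_i`. -/
def uSubalgebra {ℓ : ℕ} [NeZero ℓ] (n : ℕ) (ζ : rootsOfUnity ℓ ℂ) : Subalgebra ℂ (Hecke ℓ n) :=
  Algebra.adjoin ℂ
    (Set.range (fun i : Fin n => (uH i : Hecke ℓ n)) ∪
      Set.range (fun i : Fin n => gH ℓ n (diagAt i ζ)))

/-- An `H_{ℓ,n}`-module is `𝔲`-diagonalizable if it has a basis of simultaneous eigenvectors
for `𝔲`. -/
def IsUDiagonalizable {ℓ : ℕ} [NeZero ℓ] (n : ℕ) (ζ : rootsOfUnity ℓ ℂ) (M : Type)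
    [AddCommGroup M] [Module ℂ M] [Module (Hecke ℓ n) M] : Prop :=
  ∃ (ι : Type) (v : Module.Basis ι ℂ M), ∀ i, ∀ a ∈ uSubalgebra n ζ, ∃ c : ℂ, a • v i = c • v i

/-! Skew shapes with complex coordinates. -/

/-- A finite set `D ⊆ ℂ²` is a skew shape if `(x, y) ∈ D` and `(x + k, y + l) ∈ D` with integers
`k, l ≥ 0` imply `(x + k', y + l') ∈ D` for all integers `0 ≤ k' ≤ k`, `0 ≤ l' ≤ l`. -/
def IsSkewShape (D : Finset (ℂ × ℂ)) : Prop :=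
  ∀ (x y : ℂ) (k l : ℕ), (x, y) ∈ D → (x + k, y + l) ∈ D →
    ∀ k' l' : ℕ, k' ≤ k → l' ≤ l → (x + k', y + l') ∈ D

/-- An `ℓ`-skew shape `(D^0, …, D^{ℓ-1})`. -/
structure SkewShape (ℓ : ℕ) where
  /-- the skew shape `D^j` -/
  part : Fin ℓ → Finset (ℂ × ℂ)
  isSkew : ∀ j, IsSkewShape (part j)

namespace SkewShape

variable {ℓ : ℕ}

/-- The boxes of `D`: triples `(j, x, y)` with `(x, y) ∈ D^j`. -/
abbrev Box (D : SkewShape ℓ) : Type := {b : Fin ℓ × ℂ × ℂ // b.2 ∈ D.part b.1}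

/-- The coordinate `β(b)`. -/
def Box.coord {D : SkewShape ℓ} (b : D.Box) : Fin ℓ := b.1.1

/-- The column `x` of a box. -/
def Box.x {D : SkewShape ℓ} (b : D.Box) : ℂ := b.1.2.1

/-- The row `y` of a box. -/
def Box.y {D : SkewShape ℓ} (b : D.Box) : ℂ := b.1.2.2

/-- The content `x - y`. -/
def Box.ct {D : SkewShape ℓ} (b : D.Box) : ℂ := b.x - b.y

/-- The adjacency graph on the boxes. Its connected components are the connected components
of `D`. -/
def boxGraph (D : SkewShape ℓ) : SimpleGraph D.Box where
  Adj b b' := b.coord = b'.coord ∧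
    ((b.x = b'.x ∧ (b.y = b'.y + 1 ∨ b.y = b'.y - 1)) ∨
      (b.y = b'.y ∧ (b.x = b'.x + 1 ∨ b.x = b'.x - 1)))
  symm := ⟨by
    rintro b b' ⟨hj, ⟨h1, h2 | h2⟩ | ⟨h1, h2 | h2⟩⟩
    · exact ⟨hj.symm, Or.inl ⟨h1.symm, Or.inr (by rw [h2]; ring)⟩⟩
    · exact ⟨hj.symm, Or.inl ⟨h1.symm, Or.inl (by rw [h2]; ring)⟩⟩
    · exact ⟨hj.symm, Or.inr ⟨h1.symm, Or.inr (by rw [h2]; ring)⟩⟩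
    · exact ⟨hj.symm, Or.inr ⟨h1.symm, Or.inl (by rw [h2]; ring)⟩⟩⟩
  loopless := ⟨by
    rintro b ⟨-, ⟨-, h | h⟩ | ⟨-, h | h⟩⟩
    · simp at h
    · simp [eq_sub_iff_add_eq] at h
    · simp at h
    · simp [eq_sub_iff_add_eq] at h⟩

/-- The set of connected components of `D`. -/
abbrev Comp (D : SkewShape ℓ) : Type := D.boxGraph.ConnectedComponent

/-- The connected component of a box. -/
def Box.comp {D : SkewShape ℓ} (b : D.Box) : D.Comp := D.boxGraph.connectedComponentMk b

/-- The standard Young tableaux on `D` with entries `0, …, n-1`: bijections from the boxes to the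
entries that increase from left to right and from top to bottom. Boxes `(x, y)` and `(x', y')` of the
same `D^j` are compared if `x' - x` and `y' - y` are nonnegative integers; since `D^j` is a skew shape,
such boxes lie in the same connected component. There are none unless `D` has `n` boxes. -/
def SYT (D : SkewShape ℓ) (n : ℕ) : Type :=
  {T : D.Box ≃ Fin n // ∀ b b' : D.Box, b.coord = b'.coord →
    (∃ k l : ℕ, b'.x = b.x + k ∧ b'.y = b.y + l) → b ≠ b' → T b < T b'}

/-- The box `T⁻¹(i)`. -/
def SYT.boxOf {D : SkewShape ℓ} {n : ℕ} (T : D.SYT n) (i : Fin n) : D.Box := T.1.symm i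

/-- `D'` arises from `D` by sliding each connected component `C` diagonally by
`(slide C, slide C)`, and the connected components of `D'` are the slid components of `D`. -/
structure DiagonalSlide (D D' : SkewShape ℓ) where
  /-- the correspondence between the boxes, which preserves and reflects adjacency -/
  toIso : D.boxGraph ≃g D'.boxGraph
  /-- the amount by which a component is moved -/
  slide : D.Comp → ℂ
  coord_eq : ∀ b, (toIso b).coord = b.coord
  x_eq : ∀ b, (toIso b).x = b.x + slide b.comp
  y_eq : ∀ b, (toIso b).y = b.y + slide b.comp

/-- The choices in the construction of the module `S^D` for an `ℓ`-skew shape `D`: an enumeration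
`D_1, …, D_k` of its connected components, numbers `α_i ∈ ℂ` and `ℓ`-partitions `μ_i ⊆ λ_i` with
`D_i = λ_i∖μ_i + (α_i, 0)`. Here the cell in row `r` and column `c`, both numbered from `0`, is the
point `(c + 1, r + 1)`. -/
structure Presentation (D : SkewShape ℓ) where
  /-- the number of connected components -/
  k : ℕ
  /-- the component `D_i` -/
  comp : Fin k ≃ D.Comp
  /-- the `ℓ`-partition `λ_i` -/
  outer : Fin k → LPartition ℓ
  /-- the `ℓ`-partition `μ_i` -/
  inner : Fin k → LPartition ℓ
  inner_le_outer : ∀ i, inner i ≤ outer i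
  /-- the horizontal shift `α_i` -/
  α : Fin k → ℂ
  comp_eq : ∀ (i : Fin k) (j : Fin ℓ) (p : ℂ × ℂ),
    (∃ h : p ∈ D.part j, Box.comp (⟨(j, p), h⟩ : D.Box) = comp i) ↔
      ∃ r c : ℕ, (r, c) ∈ outer i j ∧ (r, c) ∉ inner i j ∧
        p = ((c : ℂ) + 1 + α i, (r : ℂ) + 1)

namespace Presentation

variable {D : SkewShape ℓ}

/-- The number `n_i` of boxes of `λ_i∖μ_i`. -/
def size (P : Presentation D) (i : Fin P.k) : ℕ := (P.outer i).size - (P.inner i).size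

/-- The number `n = n_1 + ⋯ + n_k`. -/
abbrev n (P : Presentation D) : ℕ := ∑ i, P.size i

/-- The space `S^{λ_i∖μ_i}`. -/
abbrev Factor (P : Presentation D) (i : Fin P.k) : Type :=
  SkewSpecht (P.outer i) (P.inner i) (P.inner i).size (P.size i)

variable [NeZero ℓ]

/-- The twist of `S^{λ_i∖μ_i}` by the automorphism `t_{ℓ α_i}`, so that the eigenvalues of the `u_j`
are the numbers `ℓ (ct(b) + α_i)`, that is `ℓ` times the contents of the boxes of `D_i`. -/
noncomputable def factor (P : Presentation D) (i : Fin P.k) :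
    Hecke ℓ (P.size i) →ₐ[ℂ] Module.End ℂ (P.Factor i) :=
  (skewRep (P.outer i) (P.inner i) (P.inner i).size (P.size i)).comp
    (shiftAut ℓ (P.size i) (ℓ * P.α i))

/-- The `H_{ℓ,n}`-module `S^D`, induced from `A = H_{ℓ,n_1} ⊗ ⋯ ⊗ H_{ℓ,n_k}`. -/
abbrev SD (P : Presentation D) : Type :=
  Ind (youngHom ℓ P.size) (tensorRep (N := P.Factor) P.factor)

end Presentation

end SkewShape

end GHecke

namespace GHecke

/-! Descent induction on permutations and linear extensions. -/

section LinearExtensions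

variable {n : ℕ}

theorem sum_mul_adjSwap_lt (σ : Equiv.Perm (Fin n)) (i : ℕ) (hi : i + 1 < n)
    (h : σ ⟨i + 1, hi⟩ < σ ⟨i, Nat.lt_of_succ_lt hi⟩) :
    ∑ j : Fin n, (n - j : ℤ) * ((σ * adjSwap i hi) j : ℕ) < ∑ j : Fin n, (n - j : ℤ) * (σ j : ℕ) := by
  set a : Fin n := ⟨i, Nat.lt_of_succ_lt hi⟩ with ha
  set b : Fin n := ⟨i + 1, hi⟩ with hb
  have hab : a ≠ b := by simp [ha, hb, Fin.ext_iff]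
  have hsub : ∑ j : Fin n, ((n - j : ℤ) * (σ j : ℕ) - (n - j : ℤ) * ((σ * adjSwap i hi) j : ℕ)) =
      ∑ j ∈ {a, b}, ((n - j : ℤ) * (σ j : ℕ) - (n - j : ℤ) * ((σ * adjSwap i hi) j : ℕ)) := by
    symm
    apply Finset.sum_subset (Finset.subset_univ _)
    intro j _ hj
    simp only [Finset.mem_insert, Finset.mem_singleton, not_or] at hj
    rw [Equiv.Perm.mul_apply, adjSwap, Equiv.swap_apply_of_ne_of_ne hj.1 hj.2, sub_self]
  rw [Finset.sum_pair hab, Finset.sum_sub_distrib, Equiv.Perm.mul_apply, Equiv.Perm.mul_apply, adjSwap,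
    Equiv.swap_apply_left, Equiv.swap_apply_right] at hsub
  have hlt : ((σ b : ℕ) : ℤ) < (σ a : ℕ) := by exact_mod_cast h
  have hav : ((a : ℕ) : ℤ) = i := rfl
  have hbv : ((b : ℕ) : ℤ) = i + 1 := by simp [hb]
  rw [← ha, ← hb, hav, hbv] at hsub
  rw [adjSwap, ← ha, ← hb]
  nlinarith

/-- A property of permutations holds for `σ` if it can be deduced from its validity for all `σ s_i`
with `σ (i + 1) < σ i`. -/
theorem perm_descent_induction {Q : Equiv.Perm (Fin n) → Prop}
    (h : ∀ σ, (∀ i (hi : i + 1 < n), σ ⟨i + 1, hi⟩ < σ ⟨i, Nat.lt_of_succ_lt hi⟩ →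
      Q (σ * adjSwap i hi)) → Q σ) (σ : Equiv.Perm (Fin n)) : Q σ := by
  have key : ∀ (m : ℕ) (σ : Equiv.Perm (Fin n)),
      ∑ j : Fin n, (n - j : ℤ) * (σ j : ℕ) < m → Q σ := by
    intro m
    induction m with
    | zero =>
      intro σ hσ
      refine absurd hσ (not_lt.2 (Finset.sum_nonneg fun j _ => mul_nonneg ?_ (by positivity)))
      have := j.2
      omega
    | succ m ih =>
      intro σ hσ
      refine h σ fun i hi hlt => ih _ ?_
      have := sum_mul_adjSwap_lt σ i hi hlt
      push_cast at hσ
      omega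
  exact key (∑ j : Fin n, (n - j : ℤ) * (σ j : ℕ)).toNat.succ σ (by
    push_cast
    have := Int.self_le_toNat (∑ j : Fin n, (n - j : ℤ) * (σ j : ℕ))
    omega)

theorem perm_eq_one_of_no_descent (σ : Equiv.Perm (Fin n))
    (h : ∀ i (hi : i + 1 < n), σ ⟨i, Nat.lt_of_succ_lt hi⟩ ≤ σ ⟨i + 1, hi⟩) : σ = 1 := by
  have hm : StrictMono σ := by
    refine Monotone.strictMono_of_injective ?_ σ.injective
    cases n with
    | zero => intro a; exact a.elim0
    | succ m =>
      rw [Fin.monotone_iff_le_succ]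
      intro i
      exact h i (by omega)
  have : (hm.orderIsoOfSurjective σ σ.surjective) = OrderIso.refl (Fin n) := Subsingleton.elim _ _
  ext k
  exact congrArg (fun f : Fin n ≃o Fin n => (f k : ℕ)) this

variable {B : Type*} {lt : B → B → Prop}

/-- Any two linear extensions of a relation are connected by exchanges of consecutive entries
within the set of linear extensions. -/
theorem linExt_connected {P : (B ≃ Fin n) → Prop} {S : B ≃ Fin n} (hS : ∀ b b', lt b b' → S b < S b')
    (hP : P S)
    (hstep : ∀ (T : B ≃ Fin n) (i : ℕ) (hi : i + 1 < n), (∀ b b', lt b b' → T b < T b') →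
      (∀ b b', lt b b' → T.trans (adjSwap i hi) b < T.trans (adjSwap i hi) b') →
      P (T.trans (adjSwap i hi)) → P T)
    (T : B ≃ Fin n) (hT : ∀ b b', lt b b' → T b < T b') : P T := by
  suffices h : ∀ σ : Equiv.Perm (Fin n), ∀ T : B ≃ Fin n, (∀ b b', lt b b' → T b < T b') →
      T.trans σ = S → P T from h (T.symm.trans S) T hT (by ext b; simp)
  intro σ
  induction σ using perm_descent_induction with
  | h σ ih =>
    intro T hT hTσ
    by_cases hd : ∃ (i : ℕ) (hi : i + 1 < n), σ ⟨i + 1, hi⟩ < σ ⟨i, Nat.lt_of_succ_lt hi⟩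
    · obtain ⟨i, hi, hlt⟩ := hd
      have hT' : ∀ b b', lt b b' → T.trans (adjSwap i hi) b < T.trans (adjSwap i hi) b' := by
        intro b b' hb
        have h1 := hT b b' hb
        have h2 := hS b b' hb
        rw [Fin.lt_def] at h1 ⊢
        simp only [Equiv.trans_apply, adjSwap_apply_val]
        have hne : ¬ ((T b : ℕ) = i ∧ (T b' : ℕ) = i + 1) := by
          rintro ⟨e1, e2⟩
          rw [← hTσ, Equiv.trans_apply, Equiv.trans_apply,
            show T b = ⟨i, Nat.lt_of_succ_lt hi⟩ from Fin.ext e1,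
            show T b' = ⟨i + 1, hi⟩ from Fin.ext e2] at h2
          exact lt_asymm h2 hlt
        split_ifs <;> omega
      refine hstep T i hi hT hT' (ih i hi hlt _ hT' ?_)
      rw [← hTσ]
      ext b
      simp [adjSwap]
    · push Not at hd
      rw [perm_eq_one_of_no_descent σ hd] at hTσ
      have : T = S := by rw [← hTσ]; rfl
      rwa [this]

/-- A finite strict order has a linear extension. -/
theorem exists_linExt [Finite B] (htrans : ∀ a b c, lt a b → lt b c → lt a c)
    (hirr : ∀ a, ¬ lt a a) (hn : Nat.card B = n) :
    ∃ T : B ≃ Fin n, ∀ b b', lt b b' → T b < T b' := by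
  classical
  let le : B → B → Prop := fun a b => a = b ∨ lt a b
  have : IsPartialOrder B le :=
    { refl := fun a => Or.inl rfl
      trans := by
        rintro a b c (rfl | h1) (rfl | h2)
        · exact Or.inl rfl
        · exact Or.inr h2
        · exact Or.inr h1
        · exact Or.inr (htrans _ _ _ h1 h2)
      antisymm := by
        rintro a b (rfl | h1) (h2 | h2)
        · rfl
        · rfl
        · exact h2.symm
        · exact (hirr _ (htrans _ _ _ h1 h2)).elim }
  obtain ⟨s, hs, hle⟩ := extend_partialOrder le
  let _ : LinearOrder B :=
    { le := s
      le_refl := hs.refl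
      le_trans := hs.trans
      le_antisymm := hs.antisymm
      le_total := hs.total
      toDecidableLE := Classical.decRel _ }
  have := Fintype.ofFinite B
  have hn' : Fintype.card B = n := by rw [← Nat.card_eq_fintype_card, hn]
  let e : Fin n ≃o B := monoEquivOfFin B hn'
  refine ⟨e.symm.toEquiv, fun b b' hb => ?_⟩
  have h1 : b ≤ b' := hle b b' (Or.inr hb)
  have h2 : b ≠ b' := by rintro rfl; exact hirr _ hb
  exact e.symm.strictMono (lt_of_le_of_ne h1 h2)

end LinearExtensions


/-! The `H_{ℓ,n}`-module attached to a finite poset of boxes with coordinates and contents. -/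

/-- A set of boxes with coordinates `β`, contents and a strict order, in which boxes of the same
coordinate and content are separated by two further boxes, covers are adjacent boxes, and boxes with the
same coordinate and with contents that differ by one are comparable. -/
structure BoxPoset (ℓ : ℕ) (B : Type) where
  /-- the coordinate `β(b)` -/
  coord : B → Fin ℓ
  /-- the content -/
  ct : B → ℂ
  /-- the order that standard tableaux respect -/
  lt : B → B → Prop
  trans : ∀ a b c, lt a b → lt b c → lt a c
  irrefl : ∀ a, ¬ lt a a
  separated : ∀ b b', coord b = coord b' → ct b = ct b' → b ≠ b' →
    (∃ c c', c ≠ c' ∧ lt b c ∧ lt c b' ∧ lt b c' ∧ lt c' b') ∨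
      ∃ c c', c ≠ c' ∧ lt b' c ∧ lt c b ∧ lt b' c' ∧ lt c' b
  cover : ∀ b b', lt b b' → (∀ c, lt b c → ¬ lt c b') → coord b = coord b' ∧ (ct b' - ct b) ^ 2 = 1
  comparable : ∀ b b', coord b = coord b' → (ct b' - ct b) ^ 2 = 1 → lt b b' ∨ lt b' b

namespace BoxPoset

variable {ℓ n : ℕ} {B : Type} (X : BoxPoset ℓ B)

/-- A filling is standard if it is a linear extension. -/
def IsStd (T : B ≃ Fin n) : Prop := ∀ b b', X.lt b b' → T b < T b'

/-- The standard tableaux. -/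
abbrev Tab (n : ℕ) : Type := {T : B ≃ Fin n // X.IsStd T}

/-- The filling `s_i T`. -/
def swapT {B : Type} {n : ℕ} (T : B ≃ Fin n) (i : ℕ) (hi : i + 1 < n) : B ≃ Fin n := T.trans (adjSwap i hi)

/-- The diagonal coefficient of the orthogonal form. -/
noncomputable def pco (x y : B) : ℂ := if X.coord x = X.coord y then 1 / (X.ct y - X.ct x) else 0

/-- The off-diagonal coefficient `√(1 - p²)` of the orthogonal form. -/
noncomputable def qco (x y : B) : ℂ := (1 - X.pco x y ^ 2) ^ ((2 : ℂ)⁻¹)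

theorem pco_symm (x y : B) : X.pco y x = - X.pco x y := by
  unfold pco
  by_cases h : X.coord x = X.coord y
  · rw [if_pos h, if_pos h.symm, ← neg_sub (X.ct x) (X.ct y), div_neg, neg_neg]
  · rw [if_neg h, if_neg (Ne.symm h), neg_zero]

theorem qco_symm (x y : B) : X.qco y x = X.qco x y := by
  rw [qco, qco, pco_symm, neg_sq]

theorem qco_sq (x y : B) : X.qco x y ^ 2 = 1 - X.pco x y ^ 2 := by
  have := Complex.cpow_nat_inv_pow (1 - X.pco x y ^ 2) (n := 2) two_ne_zero
  simpa only [qco, Nat.cast_ofNat] using this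

theorem pco_mul (a b c : B) (h1 : X.coord a = X.coord b → X.ct a ≠ X.ct b)
    (h2 : X.coord b = X.coord c → X.ct b ≠ X.ct c) (h3 : X.coord a = X.coord c → X.ct a ≠ X.ct c) :
    X.pco a b * X.pco b c = X.pco a c * (X.pco a b + X.pco b c) := by
  unfold pco
  by_cases hab : X.coord a = X.coord b
  · by_cases hbc : X.coord b = X.coord c
    · have hac := hab.trans hbc
      have e1 : X.ct b - X.ct a ≠ 0 := sub_ne_zero.2 (h1 hab).symm
      have e2 : X.ct c - X.ct b ≠ 0 := sub_ne_zero.2 (h2 hbc).symm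
      have e3 : X.ct c - X.ct a ≠ 0 := sub_ne_zero.2 (h3 hac).symm
      rw [if_pos hab, if_pos hbc, if_pos hac]
      field_simp
      ring
    · have hac : X.coord a ≠ X.coord c := fun h => hbc (hab.symm.trans h)
      simp [hbc, hac]
  · by_cases hbc : X.coord b = X.coord c
    · have hac : X.coord a ≠ X.coord c := fun h => hab (h.trans hbc.symm)
      simp [hab, hac]
    · simp [hab, hbc]

variable {X}

/-- In a standard tableau, boxes of the same coordinate whose entries differ by at most `2` have
different contents. -/
theorem ct_ne {T : B ≃ Fin n} (hT : X.IsStd T) {x y : B} (hxy : T x < T y) (h2 : (T y : ℕ) ≤ T x + 2)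
    (hc : X.coord x = X.coord y) : X.ct x ≠ X.ct y := by
  intro he
  have hne : x ≠ y := by rintro rfl; exact lt_irrefl _ hxy
  rcases X.separated x y hc he hne with ⟨c, c', hcc, h3, h4, h5, h6⟩ | ⟨c, c', hcc, h3, h4, h5, h6⟩
  · have a1 := hT _ _ h3
    have a2 := hT _ _ h4
    have a3 := hT _ _ h5
    have a4 := hT _ _ h6
    have a5 : T c ≠ T c' := T.injective.ne hcc
    rw [Fin.lt_def] at a1 a2 a3 a4
    rw [Ne, Fin.ext_iff] at a5
    omega
  · exact absurd ((hT _ _ h3).trans (hT _ _ h4)) (lt_asymm hxy)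

theorem boxAt_swapT_left (T : B ≃ Fin n) (i : ℕ) (hi : i + 1 < n) (hi' : i < n) :
    (swapT T i hi).symm ⟨i, hi'⟩ = T.symm ⟨i + 1, hi⟩ := by
  simp [swapT, adjSwap]

theorem boxAt_swapT_right (T : B ≃ Fin n) (i : ℕ) (hi : i + 1 < n) :
    (swapT T i hi).symm ⟨i + 1, hi⟩ = T.symm ⟨i, Nat.lt_of_succ_lt hi⟩ := by
  simp [swapT, adjSwap]

theorem boxAt_swapT_of_ne (T : B ≃ Fin n) (i : ℕ) (hi : i + 1 < n) (k : Fin n)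
    (h1 : (k : ℕ) ≠ i) (h2 : (k : ℕ) ≠ i + 1) : (swapT T i hi).symm k = T.symm k := by
  simp only [swapT, adjSwap, Equiv.symm_trans_apply, Equiv.symm_swap]
  rw [Equiv.swap_apply_of_ne_of_ne]
  · simpa [Fin.ext_iff] using h1
  · simpa [Fin.ext_iff] using h2

theorem swapT_swapT (T : B ≃ Fin n) (i : ℕ) (hi : i + 1 < n) : swapT (swapT T i hi) i hi = T := by
  ext b
  simp [swapT, adjSwap]

theorem swapT_val (T : B ≃ Fin n) (i : ℕ) (hi : i + 1 < n) (b : B) :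
    (swapT T i hi b : ℕ) = if (T b : ℕ) = i then i + 1 else if (T b : ℕ) = i + 1 then i else T b :=
  adjSwap_apply_val hi (T b)

theorem lt_of_not_isStd {T : B ≃ Fin n} {i : ℕ} {hi : i + 1 < n} (hT : ¬ X.IsStd T)
    (hs : X.IsStd (swapT T i hi)) :
    X.lt (T.symm ⟨i + 1, hi⟩) (T.symm ⟨i, Nat.lt_of_succ_lt hi⟩) := by
  unfold IsStd at hT
  push Not at hT
  obtain ⟨b, b', hb, hlt⟩ := hT
  have h1 := hs b b' hb
  have h2 : T b ≠ T b' := fun h => X.irrefl b (by rwa [← T.injective h] at hb)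
  rw [Fin.lt_def, swapT_val, swapT_val] at h1
  rw [Fin.le_def] at hlt
  rw [Ne, Fin.ext_iff] at h2
  have h3 : (T b : ℕ) = i + 1 ∧ (T b' : ℕ) = i := by split_ifs at h1 <;> omega
  have hb1 : b = T.symm ⟨i + 1, hi⟩ := by rw [Equiv.eq_symm_apply]; exact Fin.ext h3.1
  have hb2 : b' = T.symm ⟨i, Nat.lt_of_succ_lt hi⟩ := by rw [Equiv.eq_symm_apply]; exact Fin.ext h3.2
  rwa [← hb1, ← hb2]

theorem qco_eq_zero_of_pco_sq {x y : B} (h : X.pco x y ^ 2 = 1) : X.qco x y = 0 := by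
  rw [qco, h, sub_self, Complex.zero_cpow (by simp)]

/-- If exchanging `i` and `i + 1` turns a non-standard filling into a standard one, then the
off-diagonal coefficient vanishes. -/
theorem qco_eq_zero {T : B ≃ Fin n} {i : ℕ} {hi : i + 1 < n} (hT : ¬ X.IsStd T)
    (hs : X.IsStd (swapT T i hi)) :
    X.qco (T.symm ⟨i, Nat.lt_of_succ_lt hi⟩) (T.symm ⟨i + 1, hi⟩) = 0 := by
  have hlt := lt_of_not_isStd hT hs
  obtain ⟨h1, h2⟩ := X.cover _ _ hlt (by
    intro c hc1 hc2
    have e1 := hs _ _ hc1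
    have e2 := hs _ _ hc2
    rw [Fin.lt_def, swapT_val] at e1 e2
    rw [swapT_val] at e1 e2
    simp only [Equiv.apply_symm_apply] at e1 e2
    split_ifs at e1 e2 <;> omega)
  apply qco_eq_zero_of_pco_sq
  rw [pco, if_pos h1.symm, div_pow, one_pow, ← neg_sub, neg_sq, h2, div_one]

/-- If both `T` and `s_i T` are standard, then the off-diagonal coefficient does not vanish. -/
theorem qco_ne_zero {T : B ≃ Fin n} {i : ℕ} {hi : i + 1 < n} (hT : X.IsStd T)
    (hs : X.IsStd (swapT T i hi)) :
    X.qco (T.symm ⟨i, Nat.lt_of_succ_lt hi⟩) (T.symm ⟨i + 1, hi⟩) ≠ 0 := by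
  intro h0
  have hq := X.qco_sq (T.symm ⟨i, Nat.lt_of_succ_lt hi⟩) (T.symm ⟨i + 1, hi⟩)
  rw [h0, pco] at hq
  by_cases hc : X.coord (T.symm ⟨i, Nat.lt_of_succ_lt hi⟩) = X.coord (T.symm ⟨i + 1, hi⟩)
  · rw [if_pos hc, div_pow, one_pow] at hq
    have h1 : (X.ct (T.symm ⟨i + 1, hi⟩) - X.ct (T.symm ⟨i, Nat.lt_of_succ_lt hi⟩)) ^ 2 = 1 := by
      have h2 : 1 / (X.ct (T.symm ⟨i + 1, hi⟩) - X.ct (T.symm ⟨i, Nat.lt_of_succ_lt hi⟩)) ^ 2 = 1 := by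
        linear_combination hq
      rw [← one_div_one_div ((X.ct (T.symm ⟨i + 1, hi⟩) -
        X.ct (T.symm ⟨i, Nat.lt_of_succ_lt hi⟩)) ^ 2), h2, div_one]
    rcases X.comparable _ _ hc h1 with h | h
    · have := hs _ _ h
      rw [Fin.lt_def, swapT_val, swapT_val] at this
      simp at this
    · have := hT _ _ h
      rw [Fin.lt_def] at this
      simp at this
  · rw [if_neg hc] at hq
    norm_num at hq

/-- A standard tableau is determined by the coordinates and contents of the boxes of its entries. -/
theorem tab_ext {T S : B ≃ Fin n} (hT : X.IsStd T) (hS : X.IsStd S)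
    (hc : ∀ i, X.coord (T.symm i) = X.coord (S.symm i)) (hct : ∀ i, X.ct (T.symm i) = X.ct (S.symm i)) :
    T = S := by
  have key : ∀ k : ℕ, ∀ hk : k < n, T.symm ⟨k, hk⟩ = S.symm ⟨k, hk⟩ := by
    intro k
    induction k using Nat.strong_induction_on with
    | _ k ih =>
      intro hk
      have aux : ∀ {T S : B ≃ Fin n}, X.IsStd S → (∀ m, m < k → ∀ hm : m < n,
          T.symm ⟨m, hm⟩ = S.symm ⟨m, hm⟩) → ¬ X.lt (T.symm ⟨k, hk⟩) (S.symm ⟨k, hk⟩) := by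
        intro T S hS ih hlt
        have h1 := hS _ _ hlt
        rw [Equiv.apply_symm_apply, Fin.lt_def] at h1
        have h2 := ih (S (T.symm ⟨k, hk⟩)) h1 (Fin.is_lt _)
        simp only [Fin.eta, Equiv.symm_apply_apply] at h2
        rw [T.symm.injective.eq_iff] at h2
        rw [h2] at h1
        exact lt_irrefl _ h1
      by_contra hne
      rcases X.separated _ _ (hc ⟨k, hk⟩) (hct ⟨k, hk⟩) hne with ⟨c, -, -, h1, h2, -⟩ | ⟨c, -, -, h1, h2, -⟩
      · exact aux hS ih (X.trans _ _ _ h1 h2)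
      · exact aux hT (fun m hm hm' => (ih m hm hm').symm) (X.trans _ _ _ h1 h2)
  apply Equiv.symm_bijective.injective
  ext k : 1
  exact key k k.2

variable (X)

/-- The space with basis the standard tableaux. -/
abbrev W (n : ℕ) : Type := X.Tab n →₀ ℂ

variable {X}

open Classical in
/-- The basis vector `v_T` if `T` is standard, and `0` otherwise. -/
noncomputable def vec (X : BoxPoset ℓ B) (T : B ≃ Fin n) : X.W n :=
  if h : X.IsStd T then Finsupp.single ⟨T, h⟩ 1 else 0

instance tab_finite : Finite (X.Tab n) := by
  by_cases h : Nonempty (X.Tab n)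
  · obtain ⟨T⟩ := h
    have : Finite B := Finite.of_equiv _ T.1.symm
    infer_instance
  · rw [not_nonempty_iff] at h
    infer_instance

theorem vec_of (T : X.Tab n) : X.vec T.1 = Finsupp.single T 1 := dif_pos T.2

theorem vec_of_not {T : B ≃ Fin n} (h : ¬ X.IsStd T) : X.vec T = 0 := dif_neg h

theorem ext_vec {N : Type*} [AddCommMonoid N] [Module ℂ N] {f g : X.W n →ₗ[ℂ] N}
    (h : ∀ T : B ≃ Fin n, X.IsStd T → f (X.vec T) = g (X.vec T)) : f = g := by
  apply Finsupp.lhom_ext'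
  intro T
  apply LinearMap.ext_ring
  simpa [vec_of] using h T.1 T.2

/-- An operator that is diagonal in the basis `v_T`. -/
noncomputable def diagOp (X : BoxPoset ℓ B) (n : ℕ) (c : (B ≃ Fin n) → ℂ) : Module.End ℂ (X.W n) :=
  Finsupp.linearCombination ℂ fun T : X.Tab n => c T.1 • X.vec T.1

theorem diagOp_vec (c : (B ≃ Fin n) → ℂ) (T : B ≃ Fin n) : X.diagOp n c (X.vec T) = c T • X.vec T := by
  by_cases hT : X.IsStd T
  · rw [vec_of ⟨T, hT⟩, diagOp, Finsupp.linearCombination_single, one_smul, vec_of ⟨T, hT⟩]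
  · simp [vec_of_not hT]

/-- The action of `s_i`. -/
noncomputable def sOp (X : BoxPoset ℓ B) {n : ℕ} (i : ℕ) (hi : i + 1 < n) : Module.End ℂ (X.W n) :=
  Finsupp.linearCombination ℂ fun T : X.Tab n =>
    X.pco (T.1.symm ⟨i, Nat.lt_of_succ_lt hi⟩) (T.1.symm ⟨i + 1, hi⟩) • X.vec T.1 +
    X.qco (T.1.symm ⟨i, Nat.lt_of_succ_lt hi⟩) (T.1.symm ⟨i + 1, hi⟩) • X.vec (swapT T.1 i hi)

theorem sOp_vec (T : B ≃ Fin n) (i : ℕ) (hi : i + 1 < n) :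
    X.sOp i hi (X.vec T) =
      X.pco (T.symm ⟨i, Nat.lt_of_succ_lt hi⟩) (T.symm ⟨i + 1, hi⟩) • X.vec T +
      X.qco (T.symm ⟨i, Nat.lt_of_succ_lt hi⟩) (T.symm ⟨i + 1, hi⟩) • X.vec (swapT T i hi) := by
  by_cases hT : X.IsStd T
  · rw [vec_of ⟨T, hT⟩, sOp, Finsupp.linearCombination_single, one_smul, vec_of ⟨T, hT⟩]
  · by_cases hs : X.IsStd (swapT T i hi)
    · rw [vec_of_not hT, qco_eq_zero hT hs]; simp
    · rw [vec_of_not hT, vec_of_not hs]; simp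

theorem sOp_sq (i : ℕ) (hi : i + 1 < n) : X.sOp i hi * X.sOp i hi = 1 := by
  apply ext_vec
  intro T _
  rw [Module.End.mul_apply, sOp_vec, map_add, map_smul, map_smul, sOp_vec, sOp_vec,
    boxAt_swapT_left, boxAt_swapT_right, swapT_swapT,
    pco_symm X (T.symm ⟨i, Nat.lt_of_succ_lt hi⟩) (T.symm ⟨i + 1, hi⟩),
    qco_symm X (T.symm ⟨i, Nat.lt_of_succ_lt hi⟩) (T.symm ⟨i + 1, hi⟩), Module.End.one_apply]
  have h := X.qco_sq (T.symm ⟨i, Nat.lt_of_succ_lt hi⟩) (T.symm ⟨i + 1, hi⟩)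
  linear_combination (norm := module) h • X.vec T

theorem sOp_comm (i j : ℕ) (hij : i + 1 < j) (hi : i + 1 < n) (hj : j + 1 < n) :
    X.sOp i hi * X.sOp j hj = X.sOp j hj * X.sOp i hi := by
  apply ext_vec
  intro T _
  have hsw : swapT (swapT T j hj) i hi = swapT (swapT T i hi) j hj := by
    have := (braidRel_adjSwap' n).comm i j hij hj
    rw [adjSwap'_eq hi, adjSwap'_eq hj] at this
    apply Equiv.ext
    intro b
    exact congrArg (fun σ : Equiv.Perm (Fin n) => σ (T b)) this
  have hne : ∀ {a b : ℕ} {ha : a + 1 < n} {hb : b < n}, b ≠ a → b ≠ a + 1 →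
      (swapT T a ha).symm ⟨b, hb⟩ = T.symm ⟨b, hb⟩ := fun h1 h2 => boxAt_swapT_of_ne T _ _ _ h1 h2
  rw [Module.End.mul_apply, Module.End.mul_apply, sOp_vec, sOp_vec T i, map_add, map_smul, map_smul,
    map_add, map_smul, map_smul, sOp_vec, sOp_vec, sOp_vec, sOp_vec,
    hne (by omega) (by omega), hne (by omega) (by omega), hne (by omega) (by omega),
    hne (by omega) (by omega), hsw]
  module

theorem sOp_braid (i : ℕ) (hi : i + 1 < n) (hi' : i + 1 + 1 < n) :
    X.sOp i hi * X.sOp (i + 1) hi' * X.sOp i hi = X.sOp (i + 1) hi' * X.sOp i hi * X.sOp (i + 1) hi' := by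
  apply ext_vec
  intro T hT
  set a := T.symm ⟨i, Nat.lt_of_succ_lt hi⟩ with ha
  set b := T.symm ⟨i + 1, hi⟩ with hb
  set c := T.symm ⟨i + 1 + 1, hi'⟩ with hc
  have hTa : (T a : ℕ) = i := by simp [ha]
  have hTb : (T b : ℕ) = i + 1 := by simp [hb]
  have hTc : (T c : ℕ) = i + 1 + 1 := by simp [hc]
  have hpp : X.pco a b * X.pco b c = X.pco a c * (X.pco a b + X.pco b c) :=
    X.pco_mul a b c
      (ct_ne hT (by rw [Fin.lt_def]; omega) (by omega))
      (ct_ne hT (by rw [Fin.lt_def]; omega) (by omega))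
      (ct_ne hT (by rw [Fin.lt_def]; omega) (by omega))
  have hsw : swapT (swapT (swapT T i hi) (i + 1) hi') i hi =
      swapT (swapT (swapT T (i + 1) hi') i hi) (i + 1) hi' := by
    have := (braidRel_adjSwap' n).braid i hi'
    rw [adjSwap'_eq hi, adjSwap'_eq hi'] at this
    apply Equiv.ext
    intro x
    exact congrArg (fun σ : Equiv.Perm (Fin n) => σ (T x)) this
  have e1 := sOp_vec (X := X) T i hi
  have e2 := sOp_vec (X := X) T (i + 1) hi'
  have e3 := sOp_vec (X := X) (swapT T i hi) i hi
  have e4 := sOp_vec (X := X) (swapT T i hi) (i + 1) hi'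
  have e5 := sOp_vec (X := X) (swapT T (i + 1) hi') i hi
  have e6 := sOp_vec (X := X) (swapT T (i + 1) hi') (i + 1) hi'
  have e7 := sOp_vec (X := X) (swapT (swapT T i hi) (i + 1) hi') i hi
  have e8 := sOp_vec (X := X) (swapT (swapT T (i + 1) hi') i hi) (i + 1) hi'
  have n1 : ∀ (S : B ≃ Fin n), (swapT S i hi).symm ⟨i + 1 + 1, hi'⟩ = S.symm ⟨i + 1 + 1, hi'⟩ :=
    fun S => boxAt_swapT_of_ne S i hi _ (by simp only; omega) (by simp)
  have n2 : ∀ (S : B ≃ Fin n), (swapT S (i + 1) hi').symm ⟨i, Nat.lt_of_succ_lt hi⟩ =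
      S.symm ⟨i, Nat.lt_of_succ_lt hi⟩ :=
    fun S => boxAt_swapT_of_ne S (i + 1) hi' _ (by simp) (by simp only; omega)
  have n3 : ∀ (S : B ≃ Fin n), (swapT S (i + 1) hi').symm ⟨i + 1, hi⟩ =
      S.symm ⟨i + 1 + 1, hi'⟩ := fun S => boxAt_swapT_left S (i + 1) hi' hi
  simp only [n1, n2, n3, boxAt_swapT_left, boxAt_swapT_right, swapT_swapT, hsw, ← ha, ← hb, ← hc]
    at e1 e2 e3 e4 e5 e6 e7 e8
  simp only [Module.End.mul_apply, map_add, map_smul, e1, e2, e3, e4, e5, e6, e7, e8]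
  simp only [pco_symm X a b, pco_symm X b c, qco_symm X a b, qco_symm X b c]
  have q1 := X.qco_sq a b
  have q2 := X.qco_sq b c
  generalize X.pco a b = x at *
  generalize X.pco b c = y at *
  generalize X.pco a c = z at *
  generalize X.qco a b = u at *
  generalize X.qco b c = v at *
  linear_combination (norm := module) (q1 * z - q2 * z + hpp * (x - y)) • X.vec T +
    (u * hpp) • X.vec (swapT T i hi) - (v * hpp) • X.vec (swapT T (i + 1) hi')

/-- The character by which a diagonal matrix acts on `v_T`. -/
noncomputable def diagChar (X : BoxPoset ℓ B) (a : Fin n → rootsOfUnity ℓ ℂ) (T : B ≃ Fin n) : ℂ :=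
  ∏ i, (((a i : ℂˣ) : ℂ)) ^ (X.coord (T.symm i) : ℕ)

theorem diagChar_one (T : B ≃ Fin n) : X.diagChar 1 T = 1 := by simp [diagChar]

theorem diagChar_mul (a b : Fin n → rootsOfUnity ℓ ℂ) (T : B ≃ Fin n) :
    X.diagChar (a * b) T = X.diagChar a T * X.diagChar b T := by
  simp [diagChar, mul_pow, Finset.prod_mul_distrib]

theorem diagChar_mulSingle (i : Fin n) (ε : rootsOfUnity ℓ ℂ) (T : B ≃ Fin n) :
    X.diagChar (Pi.mulSingle i ε) T = ((ε : ℂˣ) : ℂ) ^ (X.coord (T.symm i) : ℕ) := by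
  rw [diagChar, Finset.prod_eq_single i]
  · simp
  · intro j _ hj
    simp [Pi.mulSingle_eq_of_ne hj]
  · simp

theorem diagChar_arrow (T : B ≃ Fin n) (σ : Equiv.Perm (Fin n)) (a : Fin n → rootsOfUnity ℓ ℂ) :
    X.diagChar ((mulAutArrow σ : MulAut (Fin n → rootsOfUnity ℓ ℂ)) a) (T.trans σ) = X.diagChar a T := by
  unfold diagChar
  refine (Fintype.prod_equiv σ _ _ fun i => ?_).symm
  rw [arrow_apply, Equiv.symm_apply_apply]
  simp

theorem sOp_diagOp (i : ℕ) (hi : i + 1 < n) (a : Fin n → rootsOfUnity ℓ ℂ) :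
    X.sOp i hi * X.diagOp n (X.diagChar a) =
      X.diagOp n (X.diagChar ((mulAutArrow (adjSwap i hi) : MulAut (Fin n → rootsOfUnity ℓ ℂ)) a)) *
        X.sOp i hi := by
  apply ext_vec
  intro T _
  rw [Module.End.mul_apply, Module.End.mul_apply, diagOp_vec, map_smul, sOp_vec, map_add, map_smul,
    map_smul, diagOp_vec, diagOp_vec, swapT, diagChar_arrow]
  by_cases hj : X.coord (T.symm ⟨i, Nat.lt_of_succ_lt hi⟩) = X.coord (T.symm ⟨i + 1, hi⟩)
  · have : X.diagChar ((mulAutArrow (adjSwap i hi) : MulAut (Fin n → rootsOfUnity ℓ ℂ)) a) T =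
        X.diagChar a T := by
      rw [← diagChar_arrow T (adjSwap i hi) a]
      unfold diagChar
      refine Finset.prod_congr rfl fun k _ => ?_
      congr 2
      have h1 : (T.trans (adjSwap i hi)).symm k = T.symm (adjSwap i hi k) := by simp [adjSwap]
      rw [h1, adjSwap, Equiv.swap_apply_def]
      split_ifs with h2 h3
      · rw [h2]; exact hj
      · rw [h3]; exact hj.symm
      · rfl
    rw [this]
    module
  · rw [pco, if_neg hj]
    simp only [zero_smul, zero_add]
    module

/-- `sOp` as a family of invertible operators. -/
noncomputable def sUnit (X : BoxPoset ℓ B) (n i : ℕ) : (Module.End ℂ (X.W n))ˣ :=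
  if hi : i + 1 < n then ⟨X.sOp i hi, X.sOp i hi, sOp_sq i hi, sOp_sq i hi⟩ else 1

theorem sUnit_val (i : ℕ) (hi : i + 1 < n) :
    ((X.sUnit n i : (Module.End ℂ (X.W n))ˣ) : Module.End ℂ (X.W n)) = X.sOp i hi := by
  rw [sUnit, dif_pos hi]

theorem sUnit_rel : BraidRel n (X.sUnit n) where
  sq i hi := Units.ext (by
    rw [Units.val_mul, sUnit_val i hi, sOp_sq, Units.val_one])
  comm i j hij hj := Units.ext (by
    rw [Units.val_mul, Units.val_mul, sUnit_val i (by omega), sUnit_val j hj]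
    exact sOp_comm i j hij _ _)
  braid i hi := Units.ext (by
    rw [Units.val_mul, Units.val_mul, Units.val_mul, Units.val_mul, sUnit_val i (by omega),
      sUnit_val (i + 1) hi]
    exact sOp_braid i _ _)

/-- The action of `S_n`. -/
noncomputable def permHom (X : BoxPoset ℓ B) (n : ℕ) :
    Equiv.Perm (Fin n) →* (Module.End ℂ (X.W n))ˣ :=
  (exists_permLift (sUnit_rel (X := X) (n := n))).choose

theorem permHom_adjSwap (i : ℕ) (hi : i + 1 < n) :
    ((X.permHom n (adjSwap i hi) : (Module.End ℂ (X.W n))ˣ) : Module.End ℂ (X.W n)) = X.sOp i hi := by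
  rw [permHom, (exists_permLift (sUnit_rel (X := X) (n := n))).choose_spec i hi, sUnit_val]

/-- The action of the group of diagonal matrices. -/
noncomputable def diagHom (X : BoxPoset ℓ B) (n : ℕ) :
    (Fin n → rootsOfUnity ℓ ℂ) →* (Module.End ℂ (X.W n))ˣ :=
  MonoidHom.toHomUnits ⟨⟨fun a => X.diagOp n (X.diagChar a), ext_vec fun T _ => by
      rw [diagOp_vec, diagChar_one, one_smul, Module.End.one_apply]⟩,
    fun a b => ext_vec fun T _ => by
      simp only [Module.End.mul_apply, diagOp_vec, diagChar_mul, map_smul, smul_smul, mul_comm]⟩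

theorem diagHom_val (a : Fin n → rootsOfUnity ℓ ℂ) :
    ((X.diagHom n a : (Module.End ℂ (X.W n))ˣ) : Module.End ℂ (X.W n)) = X.diagOp n (X.diagChar a) := rfl

theorem permHom_diagHom (σ : Equiv.Perm (Fin n)) : ∀ a : Fin n → rootsOfUnity ℓ ℂ,
    X.permHom n σ * X.diagHom n a = X.diagHom n (mulAutArrow σ a) * X.permHom n σ := by
  have hσ : σ ∈ Submonoid.closure
      {x : Equiv.Perm (Fin n) | ∃ i, 0 ≤ i ∧ i + 1 < n ∧ x = adjSwap' n i} := by
    rw [closure_adjSwap]; trivial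
  induction hσ using Submonoid.closure_induction with
  | mem x hx =>
    obtain ⟨i, -, hi, rfl⟩ := hx
    intro a
    rw [adjSwap'_eq hi]
    apply Units.ext
    rw [Units.val_mul, Units.val_mul, permHom_adjSwap, diagHom_val, diagHom_val, sOp_diagOp]
  | one => intro a; simp
  | mul x y _ _ hx hy =>
    intro a
    rw [map_mul, map_mul, mul_assoc, hy, ← mul_assoc, hx, mul_assoc, MulAut.mul_apply]

/-- The action of `G(ℓ,1,n)`. -/
noncomputable def groupRep (X : BoxPoset ℓ B) (n : ℕ) : GGroup ℓ n →* Module.End ℂ (X.W n) :=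
  (Units.coeHom (Module.End ℂ (X.W n))).comp
    (SemidirectProduct.lift (X.diagHom n) (X.permHom n) (by
      intro σ
      refine MonoidHom.ext fun a => ?_
      have := permHom_diagHom (X := X) σ a
      rw [MonoidHom.comp_apply, MonoidHom.comp_apply]
      simp [this]))

theorem groupRep_simpleRefl (i : ℕ) (hi : i + 1 < n) :
    X.groupRep n (simpleRefl i hi) = X.sOp i hi := by
  rw [← permHom_adjSwap]
  simp [groupRep, simpleRefl, permMat]

theorem groupRep_inl (a : Fin n → rootsOfUnity ℓ ℂ) :
    X.groupRep n (SemidirectProduct.inl a) = X.diagOp n (X.diagChar a) := by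
  rw [← diagHom_val]
  simp [groupRep]

theorem groupRep_diagAt_vec (i : Fin n) (ε : rootsOfUnity ℓ ℂ) (T : B ≃ Fin n) :
    X.groupRep n (diagAt i ε) (X.vec T) = ((ε : ℂˣ) : ℂ) ^ (X.coord (T.symm i) : ℕ) • X.vec T := by
  rw [diagAt, groupRep_inl, diagOp_vec, diagChar_mulSingle]

end BoxPoset

/-- Orthogonality of the characters of `μ_ℓ`. -/
theorem sum_rootsOfUnity_pow {ℓ : ℕ} [NeZero ℓ] (a b : Fin ℓ) :
    ∑ ε : rootsOfUnity ℓ ℂ, ((ε : ℂˣ) : ℂ) ^ (a : ℕ) * (((ε⁻¹ : rootsOfUnity ℓ ℂ) : ℂˣ) : ℂ) ^ (b : ℕ) =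
      if a = b then (ℓ : ℂ) else 0 := by
  split_ifs with hab
  · subst hab
    have : ∀ ε : rootsOfUnity ℓ ℂ,
        ((ε : ℂˣ) : ℂ) ^ (a : ℕ) * (((ε⁻¹ : rootsOfUnity ℓ ℂ) : ℂˣ) : ℂ) ^ (a : ℕ) = 1 := by
      intro ε
      rw [← mul_pow]
      simp
    have hc : Fintype.card (rootsOfUnity ℓ ℂ) = ℓ := by
      rw [← Nat.card_eq_fintype_card]
      exact (Complex.card_rootsOfUnity ℓ)
    rw [Finset.sum_congr rfl fun ε _ => this ε]
    simp [hc]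
  · have hprim := Complex.isPrimitiveRoot_exp ℓ (NeZero.ne ℓ)
    set z := hprim.toRootsOfUnity with hz
    have hzv : ((z : ℂˣ) : ℂ) = Complex.exp (2 * Real.pi * Complex.I / ℓ) := by
      simp [hz]
    set S := ∑ ε : rootsOfUnity ℓ ℂ,
      ((ε : ℂˣ) : ℂ) ^ (a : ℕ) * (((ε⁻¹ : rootsOfUnity ℓ ℂ) : ℂˣ) : ℂ) ^ (b : ℕ) with hS
    have h1 : ((z : ℂˣ) : ℂ) ^ (a : ℕ) * (((z⁻¹ : rootsOfUnity ℓ ℂ) : ℂˣ) : ℂ) ^ (b : ℕ) * S = S := by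
      rw [hS, Finset.mul_sum]
      refine Fintype.sum_equiv (Equiv.mulLeft z) _ _ fun ε => ?_
      simp only [Equiv.coe_mulLeft, mul_inv_rev, Subgroup.coe_mul, Units.val_mul]
      ring
    by_contra hne
    have h2 : ((z : ℂˣ) : ℂ) ^ (a : ℕ) * (((z⁻¹ : rootsOfUnity ℓ ℂ) : ℂˣ) : ℂ) ^ (b : ℕ) = 1 :=
      mul_right_cancel₀ hne (by rw [h1, one_mul])
    have h3 : ((z : ℂˣ) : ℂ) ^ (a : ℕ) = ((z : ℂˣ) : ℂ) ^ (b : ℕ) := by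
      have h4 : (((z⁻¹ : rootsOfUnity ℓ ℂ) : ℂˣ) : ℂ) = (((z : ℂˣ) : ℂ))⁻¹ := by simp
      rw [h4, inv_pow] at h2
      exact (mul_inv_eq_one₀ (by simp)).1 h2
    rw [hzv] at h3
    exact hab (Fin.ext (hprim.pow_inj a.2 b.2 h3))

namespace BoxPoset

variable {ℓ n : ℕ} {B : Type} {X : BoxPoset ℓ B}

theorem diagAt_inv {ℓ n : ℕ} (i : Fin n) (ε : rootsOfUnity ℓ ℂ) :
    (diagAt i ε : GGroup ℓ n)⁻¹ = diagAt i ε⁻¹ := by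
  simp [diagAt, ← map_inv, Pi.mulSingle_inv]

variable [NeZero ℓ]

theorem groupRep_pi_vec (i j : Fin n) (T : B ≃ Fin n) :
    (∑ ε : rootsOfUnity ℓ ℂ, X.groupRep n (diagAt i ε * (diagAt j ε)⁻¹)) (X.vec T) =
      (if X.coord (T.symm i) = X.coord (T.symm j) then (ℓ : ℂ) else 0) • X.vec T := by
  rw [← sum_rootsOfUnity_pow, LinearMap.sum_apply, Finset.sum_smul]
  refine Finset.sum_congr rfl fun ε _ => ?_
  rw [map_mul, Module.End.mul_apply, diagAt_inv, groupRep_diagAt_vec, map_smul, groupRep_diagAt_vec,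
    smul_smul, mul_comm]

/-- The representation of `H_{ℓ,n}` on the space with basis the standard tableaux. -/
noncomputable def heckeRep (X : BoxPoset ℓ B) (n : ℕ) : Hecke ℓ n →ₐ[ℂ] Module.End ℂ (X.W n) :=
  heckeLift (fun i => X.diagOp n fun T => (ℓ : ℂ) * X.ct (T.symm i)) (X.groupRep n)
    (fun i j => ext_vec fun T _ => by
      simp only [Module.End.mul_apply, diagOp_vec, map_smul, smul_smul, mul_comm])
    (fun i j ε => ext_vec fun T _ => by
      simp only [Module.End.mul_apply, diagOp_vec, groupRep_diagAt_vec, map_smul, smul_smul, mul_comm])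
    (fun i hi j h1 h2 => ext_vec fun T _ => by
      rw [groupRep_simpleRefl, Module.End.mul_apply, Module.End.mul_apply, diagOp_vec, map_smul, sOp_vec,
        map_add, map_smul, map_smul, diagOp_vec, diagOp_vec, boxAt_swapT_of_ne T i hi j h1 h2]
      module)
    (fun i hi => ext_vec fun T hT => by
      rw [groupRep_simpleRefl, LinearMap.sub_apply, groupRep_pi_vec, Module.End.mul_apply,
        Module.End.mul_apply, diagOp_vec, map_smul, sOp_vec, map_add, map_smul, map_smul, diagOp_vec,
        diagOp_vec, boxAt_swapT_right]
      by_cases hc : X.coord (T.symm ⟨i, Nat.lt_of_succ_lt hi⟩) = X.coord (T.symm ⟨i + 1, hi⟩)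
      · have h1 : X.ct (T.symm ⟨i, Nat.lt_of_succ_lt hi⟩) ≠ X.ct (T.symm ⟨i + 1, hi⟩) :=
          ct_ne hT (by simp [Fin.lt_def]) (by simp) hc
        have h2 : X.pco (T.symm ⟨i, Nat.lt_of_succ_lt hi⟩) (T.symm ⟨i + 1, hi⟩) *
            (X.ct (T.symm ⟨i + 1, hi⟩) - X.ct (T.symm ⟨i, Nat.lt_of_succ_lt hi⟩)) = 1 := by
          rw [pco, if_pos hc, one_div, inv_mul_cancel₀ (sub_ne_zero.2 h1.symm)]
        rw [if_pos hc]
        linear_combination (norm := module) ((-ℓ : ℂ) * h2) • X.vec T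
      · rw [if_neg hc, pco, if_neg hc]
        module)

theorem heckeRep_uH (i : Fin n) (T : B ≃ Fin n) :
    X.heckeRep n (uH i) (X.vec T) = ((ℓ : ℂ) * X.ct (T.symm i)) • X.vec T := by
  rw [heckeRep, heckeLift_uH, diagOp_vec]

theorem heckeRep_diagAt (i : Fin n) (ε : rootsOfUnity ℓ ℂ) (T : B ≃ Fin n) :
    X.heckeRep n (gH ℓ n (diagAt i ε)) (X.vec T) =
      ((ε : ℂˣ) : ℂ) ^ (X.coord (T.symm i) : ℕ) • X.vec T := by
  rw [heckeRep, heckeLift_gH, groupRep_diagAt_vec]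

theorem heckeRep_simpleRefl (i : ℕ) (hi : i + 1 < n) (T : B ≃ Fin n) :
    X.heckeRep n (gH ℓ n (simpleRefl i hi)) (X.vec T) =
      X.pco (T.symm ⟨i, Nat.lt_of_succ_lt hi⟩) (T.symm ⟨i + 1, hi⟩) • X.vec T +
      X.qco (T.symm ⟨i, Nat.lt_of_succ_lt hi⟩) (T.symm ⟨i + 1, hi⟩) • X.vec (swapT T i hi) := by
  rw [heckeRep, heckeLift_gH, groupRep_simpleRefl, sOp_vec]

end BoxPoset

theorem apply_of_diagonal {ι : Type*} {op : Module.End ℂ (ι →₀ ℂ)} {c : ι → ℂ}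
    (hop : ∀ x, op (Finsupp.single x 1) = c x • Finsupp.single x 1) (f : ι →₀ ℂ) (x : ι) :
    op f x = c x * f x := by
  classical
  induction f using Finsupp.induction_linear with
  | zero => simp
  | add f g hf hg => rw [map_add, Finsupp.add_apply, hf, hg, Finsupp.add_apply, mul_add]
  | single y r =>
    have : (Finsupp.single y r : ι →₀ ℂ) = r • Finsupp.single y 1 := by simp
    rw [this, map_smul, hop]
    by_cases hxy : y = x
    · subst hxy; simp [mul_comm]
    · simp [hxy]

/-- A nonzero subspace that is stable under a family of diagonal operators with distinct joint
eigenvalues contains a basis vector. -/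
theorem exists_single_mem {ι K : Type*} (N : Submodule ℂ (ι →₀ ℂ)) (hN : N ≠ ⊥)
    (op : K → Module.End ℂ (ι →₀ ℂ)) (c : K → ι → ℂ) (hop : ∀ k x, op k (Finsupp.single x 1) =
      c k x • Finsupp.single x 1) (hstab : ∀ k, ∀ f ∈ N, op k f ∈ N)
    (hsep : ∀ x y, (∀ k, c k x = c k y) → x = y) : ∃ x, Finsupp.single x 1 ∈ N := by
  classical
  have hval : ∀ k f x, (op k f) x = c k x * f x :=
    fun k f x => apply_of_diagonal (hop k) f x
  obtain ⟨f, hf, hf0⟩ := Submodule.exists_mem_ne_zero_of_ne_bot hN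
  have key : ∀ m : ℕ, ∀ f ∈ N, f ≠ 0 → f.support.card ≤ m → ∃ x, Finsupp.single x 1 ∈ N := by
    intro m
    induction m with
    | zero =>
      intro f _ hf0 hm
      exact absurd (Finsupp.support_eq_empty.1 (Finset.card_eq_zero.1 (Nat.le_zero.1 hm))) hf0
    | succ m ih =>
      intro f hf hf0 hm
      obtain ⟨x, hx⟩ := Finsupp.support_nonempty_iff.2 hf0
      by_cases hy : ∃ y ∈ f.support, y ≠ x
      · obtain ⟨y, hy, hyx⟩ := hy
        obtain ⟨k, hk⟩ : ∃ k, c k y ≠ c k x := by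
          by_contra hcon
          push Not at hcon
          exact hyx (hsep _ _ hcon)
        have hgval : ∀ z, (op k f - c k x • f) z = (c k z - c k x) * f z := by
          intro z
          rw [Finsupp.sub_apply, hval, Finsupp.smul_apply, smul_eq_mul, sub_mul]
        refine ih (op k f - c k x • f) (N.sub_mem (hstab k f hf) (N.smul_mem _ hf)) ?_ ?_
        · intro h0
          have := hgval y
          rw [h0, Finsupp.zero_apply] at this
          exact (mul_ne_zero (sub_ne_zero.2 hk) (Finsupp.mem_support_iff.1 hy)) this.symm
        · have hsub : (op k f - c k x • f).support ⊆ f.support.erase x := by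
            intro z hz
            rw [Finsupp.mem_support_iff, hgval] at hz
            rw [Finset.mem_erase, Finsupp.mem_support_iff]
            refine ⟨?_, right_ne_zero_of_mul hz⟩
            rintro rfl
            simp at hz
          have := Finset.card_le_card hsub
          rw [Finset.card_erase_of_mem hx] at this
          omega
      · push Not at hy
        refine ⟨x, ?_⟩
        have hfx : f = f x • Finsupp.single x 1 := by
          ext z
          by_cases hz : z = x
          · subst hz; simp
          · have : f z = 0 := by
              by_contra h
              exact hz (hy z (Finsupp.mem_support_iff.2 h))
            simp [this, Ne.symm hz]
        rw [hfx] at hf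
        have := N.smul_mem (f x)⁻¹ hf
        rwa [smul_smul, inv_mul_cancel₀ (Finsupp.mem_support_iff.1 hx), one_smul] at this
  exact key _ f hf hf0 le_rfl

namespace BoxPoset

variable {ℓ n : ℕ} {B : Type} {X : BoxPoset ℓ B} [NeZero ℓ]

/-- The representation on the space with basis the standard tableaux is irreducible. -/
theorem heckeRep_irreducible {ζ : rootsOfUnity ℓ ℂ} (hζ : IsPrimitiveRoot ζ ℓ)
    (N : Submodule ℂ (X.W n)) (hN : N ≠ ⊥) (hstab : ∀ h, ∀ f ∈ N, X.heckeRep n h f ∈ N) : N = ⊤ := by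
  have hζ' : IsPrimitiveRoot ((ζ : ℂˣ) : ℂ) ℓ := by
    rw [IsPrimitiveRoot.coe_units_iff, IsPrimitiveRoot.coe_submonoidClass_iff]
    exact hζ
  obtain ⟨S, hS⟩ := exists_single_mem N hN
    (Sum.elim (fun i : Fin n => X.heckeRep n (uH i)) fun i : Fin n => X.heckeRep n (gH ℓ n (diagAt i ζ)))
    (Sum.elim (fun i T => (ℓ : ℂ) * X.ct (T.1.symm i))
      fun i T => ((ζ : ℂˣ) : ℂ) ^ (X.coord (T.1.symm i) : ℕ))
    (by
      rintro (i | i) T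
      · rw [← vec_of]; exact heckeRep_uH i T.1
      · rw [← vec_of]; exact heckeRep_diagAt i ζ T.1)
    (by
      rintro (i | i) f hf
      · exact hstab _ f hf
      · exact hstab _ f hf)
    (by
      intro T S h
      refine Subtype.ext (tab_ext T.2 S.2 (fun i => ?_) (fun i => ?_))
      · exact Fin.ext (hζ'.pow_inj (Fin.is_lt _) (Fin.is_lt _) (h (Sum.inr i)))
      · exact mul_left_cancel₀ (Nat.cast_ne_zero.2 (NeZero.ne ℓ)) (h (Sum.inl i)))
  have hall : ∀ T : B ≃ Fin n, X.IsStd T → X.vec T ∈ N := by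
    refine linExt_connected (P := fun T => X.vec T ∈ N) S.2 (by rwa [vec_of]) ?_
    intro T i hi hT hT' hmem
    have h1 := hstab (gH ℓ n (simpleRefl i hi)) _ hmem
    rw [show T.trans (adjSwap i hi) = swapT T i hi from rfl] at h1 hmem hT'
    rw [heckeRep_simpleRefl, swapT_swapT] at h1
    have h2 := (N.add_mem_iff_right (N.smul_mem _ hmem)).1 h1
    have hq := qco_ne_zero (T := swapT T i hi) (i := i) (hi := hi) hT' (by rwa [swapT_swapT])
    exact (N.smul_mem_iff hq).1 h2
  rw [eq_top_iff]
  intro f _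
  induction f using Finsupp.induction_linear with
  | zero => exact N.zero_mem
  | add f g hf hg => exact N.add_mem (hf trivial) (hg trivial)
  | single T r =>
    have : (Finsupp.single T r : X.W n) = r • X.vec T.1 := by rw [vec_of]; simp
    rw [this]
    exact N.smul_mem _ (hall T.1 T.2)

end BoxPoset


/-! Young's orthogonal form: the Jucys–Murphy elements act by the contents. -/

section Specht

variable {ℓ n : ℕ} {lam : LPartition ℓ}

namespace Young

theorem vec_of_not {T : Filling lam n} (h : ¬ T.IsStandard) : vec T = 0 := dif_neg h

theorem swapF_val (T : Filling lam n) (i : ℕ) (hi : i + 1 < n) (b : PBox lam) :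
    (swapF T i hi b : ℕ) = if (T b : ℕ) = i then i + 1 else if (T b : ℕ) = i + 1 then i else T b :=
  adjSwap_apply_val hi (T b)

theorem qco_ne_zero {T : Filling lam n} {i : ℕ} {hi : i + 1 < n} (hT : T.IsStandard)
    (hs : (swapF T i hi).IsStandard) :
    qco (boxAt T i (Nat.lt_of_succ_lt hi)) (boxAt T (i + 1) hi) ≠ 0 := by
  intro h0
  have hq := qco_sq (boxAt T i (Nat.lt_of_succ_lt hi)) (boxAt T (i + 1) hi)
  have hTa : (T (boxAt T i (Nat.lt_of_succ_lt hi)) : ℕ) = i := by simp [boxAt]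
  have hTb : (T (boxAt T (i + 1) hi) : ℕ) = i + 1 := by simp [boxAt]
  generalize boxAt T i (Nat.lt_of_succ_lt hi) = a at *
  generalize boxAt T (i + 1) hi = b at *
  have hne : a ≠ b := by rintro rfl; omega
  rw [h0, pco] at hq
  by_cases hc : a.1.1 = b.1.1
  · rw [if_pos hc, div_pow, one_pow] at hq
    have h2 : 1 / (((b.ct - a.ct : ℤ) : ℝ) ^ 2) = 1 := by linear_combination hq
    have h1 : ((b.ct - a.ct : ℤ) : ℝ) ^ 2 = 1 := by
      rw [← one_div_one_div (((b.ct - a.ct : ℤ) : ℝ) ^ 2), h2, div_one]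
    have h3 : (b.ct - a.ct) ^ 2 = 1 := by exact_mod_cast h1
    have h4 : a.1.2 ≤ b.1.2 ∨ b.1.2 ≤ a.1.2 := by
      rcases sq_eq_one_iff.1 h3 with h3 | h3
      all_goals
        simp only [PBox.ct] at h3
        simp only [Prod.le_def]
        omega
    rcases h4 with h | h
    · have := hs _ _ hc h hne
      rw [Fin.lt_def, swapF_val, swapF_val] at this
      split_ifs at this <;> omega
    · have := hT _ _ hc.symm h hne.symm
      rw [Fin.lt_def] at this
      omega
  · rw [if_neg hc] at hq
    norm_num at hq

end Young

theorem spechtRep_diagAt_vec (i : Fin n) (ε : rootsOfUnity ℓ ℂ) (T : Filling lam n) :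
    spechtRep lam n (diagAt i ε) (Young.vec T) =
      ((ε : ℂˣ) : ℂ) ^ ((T.symm i).1.1 : ℕ) • Young.vec T := by
  by_cases hT : T.IsStandard
  · rw [Young.vec_of ⟨T, hT⟩, spechtRep_diagAt]
  · rw [Young.vec_of_not hT, map_zero, smul_zero]

variable [NeZero ℓ]

theorem spechtRep_pi_vec (i j : Fin n) (T : Filling lam n) :
    (spechtRep lam n).asAlgebraHom (∑ ε : rootsOfUnity ℓ ℂ,
        MonoidAlgebra.of ℂ (GGroup ℓ n) (diagAt i ε * (diagAt j ε)⁻¹)) (Young.vec T) =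
      (if (T.symm i).1.1 = (T.symm j).1.1 then (ℓ : ℂ) else 0) • Young.vec T := by
  rw [← sum_rootsOfUnity_pow, map_sum, LinearMap.sum_apply, Finset.sum_smul]
  refine Finset.sum_congr rfl fun ε _ => ?_
  rw [Representation.asAlgebraHom_of, map_mul, Module.End.mul_apply, BoxPoset.diagAt_inv,
    spechtRep_diagAt_vec, map_smul, spechtRep_diagAt_vec, smul_smul, mul_comm]

theorem jmElt_succ_eq (i : ℕ) (hi : i + 1 < n) :
    (jmElt ⟨i + 1, hi⟩ : MonoidAlgebra ℂ (GGroup ℓ n)) =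
      MonoidAlgebra.of ℂ (GGroup ℓ n) (simpleRefl i hi) * jmElt ⟨i, Nat.lt_of_succ_lt hi⟩ *
          MonoidAlgebra.of ℂ (GGroup ℓ n) (simpleRefl i hi) +
        (∑ ε : rootsOfUnity ℓ ℂ, MonoidAlgebra.of ℂ (GGroup ℓ n)
          (diagAt ⟨i, Nat.lt_of_succ_lt hi⟩ ε * (diagAt ⟨i + 1, hi⟩ ε)⁻¹)) *
          MonoidAlgebra.of ℂ (GGroup ℓ n) (simpleRefl i hi) := by
  have h1 : (simpleRefl i hi * simpleRefl i hi : GGroup ℓ n) = 1 := by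
    rw [simpleRefl, permMat, ← map_mul, adjSwap_mul_self, map_one]
  rw [jmElt_succ, sub_mul, mul_assoc (jmElt _), ← map_mul, h1, map_one, mul_one, sub_add_cancel]

/-- The Jucys–Murphy element `φ_i` acts on `v_T` by `ℓ` times the content of `T⁻¹(i)`. -/
theorem spechtRep_jmElt (i : Fin n) (T : Filling lam n) :
    (spechtRep lam n).asAlgebraHom (jmElt i) (Young.vec T) =
      ((ℓ : ℂ) * ((T.symm i).ct : ℤ)) • Young.vec T := by
  obtain ⟨i, hi⟩ := i
  induction i generalizing T with
  | zero =>
    have h0 : (jmElt ⟨0, hi⟩ : MonoidAlgebra ℂ (GGroup ℓ n)) = 0 := by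
      rw [jmElt, Finset.filter_eq_empty_iff.2, Finset.sum_empty]
      intro j _
      simp [Fin.lt_def]
    rw [h0, map_zero, LinearMap.zero_apply]
    by_cases hT : T.IsStandard
    · have hmin : ∀ b : PBox lam, ¬ T b < ⟨0, hi⟩ := fun b => by simp [Fin.lt_def]
      have hTb : T (T.symm ⟨0, hi⟩) = ⟨0, hi⟩ := by simp
      generalize T.symm ⟨0, hi⟩ = b at *
      obtain ⟨⟨j, r, c⟩, hb⟩ := b
      have hr : r = 0 := by
        by_contra hr
        have hb' : ((r - 1, c) : ℕ × ℕ) ∈ lam j := (lam j).up_left_mem (by omega) le_rfl hb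
        refine hmin ⟨(j, r - 1, c), hb'⟩ (hTb ▸ hT ⟨(j, r - 1, c), hb'⟩ _ rfl ⟨?_, ?_⟩ ?_)
        · simp
        · simp
        · simp; omega
      have hcc : c = 0 := by
        by_contra hr
        have hb' : ((r, c - 1) : ℕ × ℕ) ∈ lam j := (lam j).up_left_mem le_rfl (by omega) hb
        refine hmin ⟨(j, r, c - 1), hb'⟩ (hTb ▸ hT ⟨(j, r, c - 1), hb'⟩ _ rfl ⟨?_, ?_⟩ ?_)
        · simp
        · simp
        · simp; omega
      subst hr hcc
      simp [PBox.ct]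
    · rw [Young.vec_of_not hT, smul_zero]
  | succ i ih =>
    by_cases hT : T.IsStandard
    · have e1 := ih T (Nat.lt_of_succ_lt hi)
      have e2 := ih (Young.swapF T i hi) (Nat.lt_of_succ_lt hi)
      have e3 := spechtRep_pi_vec (n := n) ⟨i, Nat.lt_of_succ_lt hi⟩ ⟨i + 1, hi⟩ T
      have e4 := spechtRep_pi_vec (n := n) ⟨i, Nat.lt_of_succ_lt hi⟩ ⟨i + 1, hi⟩ (Young.swapF T i hi)
      have e5 := Young.sOp_vec T i hi
      have hss : Young.sOp lam i hi (Young.sOp lam i hi (Young.vec T)) = Young.vec T := by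
        rw [← Module.End.mul_apply, Young.sOp_sq, Module.End.one_apply]
      have f1 : (Young.swapF T i hi).symm ⟨i, Nat.lt_of_succ_lt hi⟩ = T.symm ⟨i + 1, hi⟩ :=
        Young.boxAt_swapF_left T i hi _
      have f2 : (Young.swapF T i hi).symm ⟨i + 1, hi⟩ = T.symm ⟨i, Nat.lt_of_succ_lt hi⟩ :=
        Young.boxAt_swapF_right T i hi
      have hct : (T.symm ⟨i, Nat.lt_of_succ_lt hi⟩).1.1 = (T.symm ⟨i + 1, hi⟩).1.1 →
          (T.symm ⟨i, Nat.lt_of_succ_lt hi⟩).ct ≠ (T.symm ⟨i + 1, hi⟩).ct :=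
        fun hc => Young.ct_ne T hT _ _ (by simp [Fin.lt_def]) (by simp) hc
      rw [f1] at e2
      rw [f1, f2] at e4
      simp only [Young.boxAt] at e5
      rw [jmElt_succ_eq, map_add, map_mul, map_mul, map_mul, Representation.asAlgebraHom_of,
        spechtRep_simpleRefl, LinearMap.add_apply, Module.End.mul_apply, Module.End.mul_apply,
        Module.End.mul_apply]
      rw [e5] at hss ⊢
      simp only [map_add, map_smul, e1, e2, e3, e4] at hss ⊢
      generalize T.symm ⟨i, Nat.lt_of_succ_lt hi⟩ = a at *
      generalize T.symm ⟨i + 1, hi⟩ = b at *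
      by_cases hc : a.1.1 = b.1.1
      · have h2 : ((Young.pco a b : ℝ) : ℂ) * ((b.ct : ℂ) - (a.ct : ℂ)) = 1 := by
          have h3 : (b.ct - a.ct : ℝ) ≠ 0 := sub_ne_zero.2 (by exact_mod_cast (hct hc).symm)
          have h4 : Young.pco a b * (b.ct - a.ct : ℝ) = 1 := by
            rw [Young.pco, if_pos hc]
            push_cast
            field_simp
          exact_mod_cast congrArg (fun t : ℝ => (t : ℂ)) h4
        rw [if_pos hc, if_pos hc.symm]
        linear_combination (norm := skip) ((ℓ : ℂ) * b.ct) • hss - ((ℓ : ℂ) * h2) • (Young.sOp lam i hi (Young.vec T))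
        rw [e5]
        module
      · rw [if_neg hc, if_neg (Ne.symm hc)]
        have hp : Young.pco a b = 0 := by rw [Young.pco, if_neg hc]
        rw [hp] at hss ⊢
        simp only [Complex.ofReal_zero, zero_smul, zero_add, smul_zero, add_zero] at hss ⊢
        linear_combination (norm := module) ((ℓ : ℂ) * b.ct) • hss
    · rw [Young.vec_of_not hT, map_zero, smul_zero]

end Specht


/-! A basis of `S^{λ∖μ}`. -/

section Skew

variable {ℓ m n : ℕ} {lam mu : LPartition ℓ}

/-- The boxes of `λ∖μ`. -/
abbrev SkewBox {ℓ : ℕ} (lam mu : LPartition ℓ) : Type :=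
  {b : Fin ℓ × ℕ × ℕ // b.2 ∈ lam b.1 ∧ b.2 ∉ mu b.1}

/-- A filling of `λ∖μ` is standard if its entries increase from left to right and from top to
bottom. -/
def IsSkewStd (U : SkewBox lam mu ≃ Fin n) : Prop :=
  ∀ b b' : SkewBox lam mu, b.1.1 = b'.1.1 → b.1.2 ≤ b'.1.2 → b ≠ b' → U b < U b'

/-- The standard tableaux of shape `λ∖μ`. -/
abbrev SkewTab (lam mu : LPartition ℓ) (n : ℕ) : Type := {U : SkewBox lam mu ≃ Fin n // IsSkewStd U}

/-- The boxes of `λ` are those of `μ` and those of `λ∖μ`. -/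
noncomputable def splitBox (h : mu ≤ lam) : PBox lam ≃ PBox mu ⊕ SkewBox lam mu := by
  classical exact
  { toFun := fun b => if hb : b.1.2 ∈ mu b.1.1 then Sum.inl ⟨b.1, hb⟩ else Sum.inr ⟨b.1, b.2, hb⟩
    invFun := Sum.elim (fun b => ⟨b.1, h b.1.1 b.2⟩) fun b => ⟨b.1, b.2.1⟩
    left_inv := by
      intro b
      by_cases hb : b.1.2 ∈ mu b.1.1
      · simp [hb]
      · simp [hb]
    right_inv := by
      rintro (b | b)
      · simp [b.2]
      · simp [b.2.2] }

theorem splitBox_symm_inl (h : mu ≤ lam) (b : PBox mu) :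
    (splitBox h).symm (Sum.inl b) = ⟨b.1, h b.1.1 b.2⟩ := rfl

theorem splitBox_symm_inr (h : mu ≤ lam) (b : SkewBox lam mu) :
    (splitBox h).symm (Sum.inr b) = ⟨b.1, b.2.1⟩ := rfl

theorem splitBox_cases (h : mu ≤ lam) (b : PBox lam) :
    (∃ b' : PBox mu, b = (splitBox h).symm (Sum.inl b')) ∨
      ∃ b' : SkewBox lam mu, b = (splitBox h).symm (Sum.inr b') := by
  rcases hb : splitBox h b with b' | b'
  · exact Or.inl ⟨b', by rw [← hb, Equiv.symm_apply_apply]⟩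
  · exact Or.inr ⟨b', by rw [← hb, Equiv.symm_apply_apply]⟩

/-- The filling of `λ` composed of fillings of `μ` and of `λ∖μ`. -/
noncomputable def glue (h : mu ≤ lam) (T : Filling mu m) (U : SkewBox lam mu ≃ Fin n) :
    Filling lam (m + n) :=
  ((splitBox h).trans (Equiv.sumCongr T U)).trans finSumFinEquiv

theorem glue_inl (h : mu ≤ lam) (T : Filling mu m) (U : SkewBox lam mu ≃ Fin n) (b : PBox mu) :
    glue h T U ((splitBox h).symm (Sum.inl b)) = Fin.castAdd n (T b) := by
  simp [glue]

theorem glue_inr (h : mu ≤ lam) (T : Filling mu m) (U : SkewBox lam mu ≃ Fin n) (b : SkewBox lam mu) :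
    glue h T U ((splitBox h).symm (Sum.inr b)) = Fin.natAdd m (U b) := by
  simp [glue]

theorem glue_symm_castAdd (h : mu ≤ lam) (T : Filling mu m) (U : SkewBox lam mu ≃ Fin n) (i : Fin m) :
    (glue h T U).symm (Fin.castAdd n i) = ⟨(T.symm i).1, h _ (T.symm i).2⟩ := by
  rw [Equiv.symm_apply_eq, ← splitBox_symm_inl h, glue_inl, Equiv.apply_symm_apply]

theorem glue_symm_natAdd (h : mu ≤ lam) (T : Filling mu m) (U : SkewBox lam mu ≃ Fin n) (i : Fin n) :
    (glue h T U).symm (Fin.natAdd m i) = ⟨(U.symm i).1, (U.symm i).2.1⟩ := by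
  rw [Equiv.symm_apply_eq, ← splitBox_symm_inr h, glue_inr, Equiv.apply_symm_apply]

theorem glue_isStandard (h : mu ≤ lam) (T : Filling mu m) (U : SkewBox lam mu ≃ Fin n) :
    (glue h T U).IsStandard ↔ T.IsStandard ∧ IsSkewStd U := by
  constructor
  · intro hs
    constructor
    · intro b b' h1 h2 h3
      have := hs ((splitBox h).symm (Sum.inl b)) ((splitBox h).symm (Sum.inl b')) h1 h2 (by simpa using h3)
      rw [glue_inl, glue_inl, Fin.lt_def] at this
      simpa using this
    · intro b b' h1 h2 h3
      have := hs ((splitBox h).symm (Sum.inr b)) ((splitBox h).symm (Sum.inr b')) h1 h2 (by simpa using h3)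
      rw [glue_inr, glue_inr, Fin.lt_def] at this
      simpa using this
  · rintro ⟨hT, hU⟩ b b' h1 h2 h3
    rcases splitBox_cases h b with ⟨c, rfl⟩ | ⟨c, rfl⟩ <;> rcases splitBox_cases h b' with ⟨c', rfl⟩ | ⟨c', rfl⟩
    · rw [glue_inl, glue_inl, Fin.lt_def]
      simpa using hT c c' h1 h2 (by rintro rfl; exact h3 rfl)
    · rw [glue_inl, glue_inr, Fin.lt_def]
      simp only [Fin.val_castAdd, Fin.val_natAdd]
      omega
    · exfalso
      have h1' : c.1.1 = c'.1.1 := h1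
      have h2' : c.1.2 ≤ c'.1.2 := h2
      have hc' := c'.2
      rw [← h1'] at hc'
      exact c.2.2 ((mu c.1.1).isLowerSet h2' hc')
    · rw [glue_inr, glue_inr, Fin.lt_def]
      simpa using hU c c' h1 h2 (by rintro rfl; exact h3 rfl)

theorem glue_swap_left (h : mu ≤ lam) (T : Filling mu m) (U : SkewBox lam mu ≃ Fin n) (i : ℕ)
    (hi : i + 1 < m) :
    Young.swapF (glue h T U) i (by omega) = glue h (Young.swapF T i hi) U := by
  ext b
  rw [Young.swapF_val]
  rcases splitBox_cases h b with ⟨c, rfl⟩ | ⟨c, rfl⟩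
  · rw [glue_inl, glue_inl, Fin.val_castAdd, Fin.val_castAdd, Young.swapF_val]
  · rw [glue_inr, glue_inr, Fin.val_natAdd]
    split_ifs <;> omega

theorem glue_swap_right (h : mu ≤ lam) (T : Filling mu m) (U : SkewBox lam mu ≃ Fin n) (i : ℕ)
    (hi : i + 1 < n) :
    Young.swapF (glue h T U) (m + i) (by omega) = glue h T (BoxPoset.swapT U i hi) := by
  ext b
  rw [Young.swapF_val]
  rcases splitBox_cases h b with ⟨c, rfl⟩ | ⟨c, rfl⟩
  · rw [glue_inl, glue_inl, Fin.val_castAdd]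
    have := (T c).2
    split_ifs <;> omega
  · rw [glue_inr, glue_inr, Fin.val_natAdd, Fin.val_natAdd, BoxPoset.swapT_val]
    split_ifs <;> omega

theorem shiftEmb_zero_eq (i : Fin m) (h : 0 + m ≤ m + n) : shiftEmb 0 m (m + n) h i = Fin.castAdd n i := by
  ext; simp [shiftEmb_val]

theorem shiftEmb_right_eq (i : Fin n) (h : m + n ≤ m + n) : shiftEmb m n (m + n) h i = Fin.natAdd m i := rfl

theorem embGroup_shift_zero_simpleRefl (i : ℕ) (hi : i + 1 < m) (h : 0 + m ≤ m + n) :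
    embGroup (shiftEmb 0 m (m + n) h) (simpleRefl i hi : GGroup ℓ m) = simpleRefl i (by omega) := by
  rw [embGroup_shift_simpleRefl]
  simp only [Nat.zero_add]

/-- The linear map `S^μ → S^λ` with `v_T ↦ v_{T ∪ U}`. -/
noncomputable def skewMap (h : mu ≤ lam) (m : ℕ) (U : SkewBox lam mu ≃ Fin n) :
    Young.Sp mu m →ₗ[ℂ] Young.Sp lam (m + n) :=
  Finsupp.linearCombination ℂ fun T : PSYT mu m => Young.vec (glue h T.1 U)

theorem skewMap_vec (h : mu ≤ lam) (U : SkewBox lam mu ≃ Fin n) (T : Filling mu m) :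
    skewMap h m U (Young.vec T) = Young.vec (glue h T U) := by
  by_cases hT : T.IsStandard
  · rw [Young.vec_of ⟨T, hT⟩, skewMap, Finsupp.linearCombination_single, one_smul]
  · have : ¬ (glue h T U).IsStandard := fun hs => hT ((glue_isStandard h T U).1 hs).1
    rw [Young.vec_of_not hT, Young.vec_of_not this, map_zero]

theorem skewMap_mem (h : mu ≤ lam) (U : SkewBox lam mu ≃ Fin n) :
    skewMap h m U ∈ SkewSpecht lam mu m n := by
  intro g
  let S : Submonoid (GGroup ℓ m) :=
    { carrier := {g | skewMap h m U ∘ₗ spechtRep mu m g =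
        spechtRep lam (m + n) (embGroup (shiftEmb 0 m (m + n) (by omega)) g) ∘ₗ skewMap h m U}
      one_mem' := by
        simp [Module.End.one_eq_id]
      mul_mem' := by
        intro a b ha hb
        change _ = _ at ha hb
        change _ = _
        rw [map_mul, map_mul, map_mul, Module.End.mul_eq_comp, Module.End.mul_eq_comp,
          ← LinearMap.comp_assoc, ha, LinearMap.comp_assoc, hb, LinearMap.comp_assoc] }
  refine gGroup_induction S (fun i ε => ?_) (fun i hi => ?_) g
  · refine Young.ext_vec fun T _ => ?_
    rw [LinearMap.comp_apply, LinearMap.comp_apply, spechtRep_diagAt_vec, map_smul, skewMap_vec,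
      embGroup_diagAt, shiftEmb_zero_eq, spechtRep_diagAt_vec, glue_symm_castAdd]
  · refine Young.ext_vec fun T _ => ?_
    rw [LinearMap.comp_apply, LinearMap.comp_apply, skewMap_vec, embGroup_shift_zero_simpleRefl,
      spechtRep_simpleRefl, spechtRep_simpleRefl, Young.sOp_vec, Young.sOp_vec, map_add, map_smul, map_smul,
      skewMap_vec, skewMap_vec, glue_swap_left h T U i hi]
    have e1 : Young.boxAt (glue h T U) i (by omega) = ⟨_, h _ (Young.boxAt T i (by omega)).2⟩ :=
      glue_symm_castAdd h T U ⟨i, by omega⟩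
    have e2 : Young.boxAt (glue h T U) (i + 1) (by omega) = ⟨_, h _ (Young.boxAt T (i + 1) hi).2⟩ :=
      glue_symm_castAdd h T U ⟨i + 1, by omega⟩
    rw [e1, e2]
    rfl

/-- The element of `S^{λ∖μ}` attached to a filling of `λ∖μ`. -/
noncomputable def skewVec (h : mu ≤ lam) (m : ℕ) (U : SkewBox lam mu ≃ Fin n) : SkewSpecht lam mu m n :=
  ⟨skewMap h m U, skewMap_mem h U⟩

theorem skewVec_of_not (h : mu ≤ lam) {U : SkewBox lam mu ≃ Fin n} (hU : ¬ IsSkewStd U) :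
    skewVec h m U = 0 := by
  apply Subtype.ext
  refine Young.ext_vec fun T _ => ?_
  have : ¬ (glue h T U).IsStandard := fun hs => hU ((glue_isStandard h T U).1 hs).2
  exact (skewMap_vec h U T).trans (Young.vec_of_not this)

/-- Two elements of `S^{λ∖μ}` that agree on one basis vector are equal. -/
theorem skewSpecht_ext {f g : SkewSpecht lam mu m n} (S : PSYT mu m)
    (hfg : f.1 (Young.vec S.1) = g.1 (Young.vec S.1)) : f = g := by
  apply Subtype.ext
  refine Young.ext_vec fun T hT => ?_
  have hstd : ∀ T : Filling mu m, T.IsStandard ↔ ∀ b b' : PBox mu,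
      (b.1.1 = b'.1.1 ∧ b.1.2 ≤ b'.1.2 ∧ b ≠ b') → T b < T b' :=
    fun T => ⟨fun h b b' hb => h b b' hb.1 hb.2.1 hb.2.2, fun h b b' h1 h2 h3 => h b b' ⟨h1, h2, h3⟩⟩
  refine linExt_connected (P := fun T : Filling mu m => f.1 (Young.vec T) = g.1 (Young.vec T))
    ((hstd _).1 S.2) hfg ?_ T ((hstd _).1 hT)
  intro T i hi h1 h2 h3
  have h1 := (hstd T).2 h1
  have h2 : (Young.swapF T i hi).IsStandard := (hstd _).2 h2
  change f.1 (Young.vec (Young.swapF T i hi)) = g.1 (Young.vec (Young.swapF T i hi)) at h3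
  have key : ∀ f : SkewSpecht lam mu m n, f.1 (Young.sOp mu i hi (Young.vec (Young.swapF T i hi))) =
      Young.sOp lam i (by omega) (f.1 (Young.vec (Young.swapF T i hi))) := by
    intro f
    have := congrArg (fun z => z (Young.vec (Young.swapF T i hi))) (f.2 (simpleRefl i hi))
    simpa only [LinearMap.comp_apply, embGroup_shift_zero_simpleRefl, spechtRep_simpleRefl] using this
  have h4 := key f
  rw [h3, ← key g, Young.sOp_vec, map_add, map_add, map_smul, map_smul, map_smul, map_smul, h3,
    Young.swapF_swapF] at h4
  have h5 := add_left_cancel h4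
  have hq := Young.qco_ne_zero (T := Young.swapF T i hi) (i := i) (hi := hi) h2
    (by rwa [Young.swapF_swapF])
  exact smul_right_injective _ (Complex.ofReal_ne_zero.2 hq) h5

end Skew

section SkewAction

variable {ℓ m n : ℕ} {lam mu : LPartition ℓ}

section Action

variable [NeZero ℓ]

theorem skewRep_apply (x : Hecke ℓ n) (f : SkewSpecht lam mu m n) :
    (skewRep lam mu m n x f).1 = (spechtRep lam (m + n)).asAlgebraHom (jmHom ℓ m n x) ∘ₗ f.1 := rfl

theorem skewRep_uH (h : mu ≤ lam) (U : SkewBox lam mu ≃ Fin n) (i : Fin n) :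
    skewRep lam mu m n (uH i) (skewVec h m U) =
      ((ℓ : ℂ) * (((U.symm i).1.2.2 : ℂ) - ((U.symm i).1.2.1 : ℂ))) • skewVec h m U := by
  apply Subtype.ext
  refine Young.ext_vec fun T _ => ?_
  rw [skewRep_apply, jmHom_uH, LinearMap.comp_apply, skewVec, skewMap_vec, shiftEmb_right_eq,
    spechtRep_jmElt, glue_symm_natAdd]
  simp only [PBox.ct, Int.cast_sub, Int.cast_natCast, SetLike.mk_smul_mk, LinearMap.smul_apply, skewMap_vec]

theorem skewRep_diagAt (h : mu ≤ lam) (U : SkewBox lam mu ≃ Fin n) (i : Fin n) (ε : rootsOfUnity ℓ ℂ) :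
    skewRep lam mu m n (gH ℓ n (diagAt i ε)) (skewVec h m U) =
      ((ε : ℂˣ) : ℂ) ^ ((U.symm i).1.1 : ℕ) • skewVec h m U := by
  apply Subtype.ext
  refine Young.ext_vec fun T _ => ?_
  rw [skewRep_apply, jmHom_gH, LinearMap.comp_apply, skewVec, skewMap_vec, embGroup_diagAt,
    shiftEmb_right_eq, Representation.asAlgebraHom_of, spechtRep_diagAt_vec, glue_symm_natAdd]
  simp only [SetLike.mk_smul_mk, LinearMap.smul_apply, skewMap_vec]

/-- The box of `λ` given by a box of `λ∖μ`. -/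
def SkewBox.toPBox (b : SkewBox lam mu) : PBox lam := ⟨b.1, b.2.1⟩

theorem skewRep_simpleRefl (h : mu ≤ lam) (U : SkewBox lam mu ≃ Fin n) (i : ℕ) (hi : i + 1 < n) :
    skewRep lam mu m n (gH ℓ n (simpleRefl i hi)) (skewVec h m U) =
      ((Young.pco (SkewBox.toPBox (U.symm ⟨i, Nat.lt_of_succ_lt hi⟩))
        (SkewBox.toPBox (U.symm ⟨i + 1, hi⟩)) : ℝ) : ℂ) • skewVec h m U +
      ((Young.qco (SkewBox.toPBox (U.symm ⟨i, Nat.lt_of_succ_lt hi⟩))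
        (SkewBox.toPBox (U.symm ⟨i + 1, hi⟩)) : ℝ) : ℂ) • skewVec h m (BoxPoset.swapT U i hi) := by
  apply Subtype.ext
  refine Young.ext_vec fun T _ => ?_
  have e1 : Young.boxAt (glue h T U) (m + i) (by omega) =
      SkewBox.toPBox (U.symm ⟨i, Nat.lt_of_succ_lt hi⟩) := glue_symm_natAdd h T U ⟨i, by omega⟩
  have e2 : Young.boxAt (glue h T U) (m + i + 1) (by omega) = SkewBox.toPBox (U.symm ⟨i + 1, hi⟩) :=
    glue_symm_natAdd h T U ⟨i + 1, by omega⟩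
  rw [skewRep_apply, jmHom_gH, LinearMap.comp_apply, embGroup_shift_simpleRefl,
    Representation.asAlgebraHom_of, spechtRep_simpleRefl]
  rw [Submodule.coe_add, Submodule.coe_smul, Submodule.coe_smul, LinearMap.add_apply, LinearMap.smul_apply,
    LinearMap.smul_apply, skewVec, skewVec, skewMap_vec, skewMap_vec, Young.sOp_vec, e1, e2, glue_swap_right]

/-- `S^μ → S^λ` intertwines the Jucys–Murphy elements. -/
theorem skewSpecht_jmElt (f : SkewSpecht lam mu m n) (i : Fin m) (x : Young.Sp mu m) :
    f.1 ((spechtRep mu m).asAlgebraHom (jmElt i) x) =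
      (spechtRep lam (m + n)).asAlgebraHom (jmElt (Fin.castAdd n i)) (f.1 x) := by
  have hset : Finset.univ.filter (· < Fin.castAdd n i) =
      (Finset.univ.filter (· < i)).map (Fin.castAddEmb n) := by
    ext k
    simp only [Finset.mem_filter, Finset.mem_univ, true_and, Finset.mem_map, Fin.lt_def, Fin.castAddEmb_apply,
      Fin.ext_iff, Fin.val_castAdd]
    constructor
    · intro hk
      exact ⟨⟨k, by omega⟩, hk, rfl⟩
    · rintro ⟨j, hj, hjk⟩
      omega
  rw [jmElt, jmElt, hset, Finset.sum_map]
  simp only [map_sum, LinearMap.sum_apply, Representation.asAlgebraHom_of]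
  refine Finset.sum_congr rfl fun j _ => Finset.sum_congr rfl fun ε _ => ?_
  have h1 := congrArg (fun z => z x) (f.2 (reflAt i j ε))
  have h2 : embGroup (shiftEmb 0 m (m + n) (by omega)) (reflAt i j ε : GGroup ℓ m) =
      reflAt (Fin.castAdd n i) (Fin.castAdd n j) ε := by
    rw [reflAt, map_mul, map_mul, map_inv, embGroup_diagAt, embGroup_swap, shiftEmb_zero_eq,
      shiftEmb_zero_eq]
    rfl
  rw [h2] at h1
  exact h1

end Action

theorem skewSpecht_diagAt (f : SkewSpecht lam mu m n) (i : Fin m) (ε : rootsOfUnity ℓ ℂ)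
    (x : Young.Sp mu m) :
    f.1 (spechtRep mu m (diagAt i ε) x) =
      spechtRep lam (m + n) (diagAt (Fin.castAdd n i) ε) (f.1 x) := by
  have h1 := congrArg (fun z => z x) (f.2 (diagAt i ε))
  rw [embGroup_diagAt, shiftEmb_zero_eq] at h1
  exact h1

/-- The first `m` boxes of a standard tableau are determined by their coordinates and contents. -/
theorem psyt_prefix (h : mu ≤ lam) {S : Filling mu m} (hS : S.IsStandard) {T : Filling lam (m + n)}
    (hT : T.IsStandard) (hc : ∀ i, (T.symm (Fin.castAdd n i)).1.1 = (S.symm i).1.1)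
    (hct : ∀ i, (T.symm (Fin.castAdd n i)).ct = (S.symm i).ct) (i : Fin m) :
    T.symm (Fin.castAdd n i) = ⟨(S.symm i).1, h _ (S.symm i).2⟩ := by
  obtain ⟨k, hk⟩ := i
  induction k using Nat.strong_induction_on with
  | _ k ih =>
    have hc' := hc ⟨k, hk⟩
    have hct' := hct ⟨k, hk⟩
    have hTb : T (T.symm (Fin.castAdd n ⟨k, hk⟩)) = Fin.castAdd n ⟨k, hk⟩ := by simp
    have hSb : S (S.symm ⟨k, hk⟩) = ⟨k, hk⟩ := by simp
    generalize T.symm (Fin.castAdd n ⟨k, hk⟩) = b at *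
    generalize S.symm ⟨k, hk⟩ = b' at *
    by_contra hne
    have hcomp : b.1.2 ≤ b'.1.2 ∨ b'.1.2 ≤ b.1.2 := by
      simp only [PBox.ct] at hct'
      simp only [Prod.le_def]
      omega
    rcases hcomp with hle | hle
    · have hbm : b.1.2 ∈ mu b.1.1 := by rw [hc']; exact (mu b'.1.1).isLowerSet hle b'.2
      have h1 := hS ⟨b.1, hbm⟩ b' hc' hle (by rintro rfl; exact hne rfl)
      rw [hSb, Fin.lt_def] at h1
      have h2 := ih (S ⟨b.1, hbm⟩) h1 (Fin.is_lt _)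
      rw [Fin.eta, Equiv.symm_apply_apply, Equiv.symm_apply_eq] at h2
      have h3 : (⟨b.1, h _ hbm⟩ : PBox lam) = b := rfl
      simp only at h2
      rw [h3, hTb] at h2
      have := congrArg Fin.val h2
      simp only [Fin.val_castAdd] at this
      simp only at h1
      omega
    · have h1 := hT ⟨b'.1, h _ b'.2⟩ b hc'.symm hle (fun e => hne e.symm)
      rw [hTb, Fin.lt_def] at h1
      simp only [Fin.val_castAdd] at h1
      have h2 := ih _ h1 (h1.trans hk)
      have h4 : Fin.castAdd n ⟨(T ⟨b'.1, h _ b'.2⟩ : ℕ), h1.trans hk⟩ = T ⟨b'.1, h _ b'.2⟩ := Fin.ext rfl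
      rw [h4, Equiv.symm_apply_apply, Subtype.mk.injEq] at h2
      have h5 : b' = S.symm ⟨(T ⟨b'.1, h _ b'.2⟩ : ℕ), h1.trans hk⟩ := Subtype.ext h2
      have h6 := congrArg Fin.val (S.symm.injective ((S.eq_symm_apply.2 hSb).symm.trans h5))
      simp only at h6
      omega

/-- A filling of `λ` whose first entries fill `μ` as `S` does is composed of `S` and a filling of
`λ∖μ`. -/
theorem exists_glue (h : mu ≤ lam) (S : Filling mu m) (T : Filling lam (m + n))
    (hT : ∀ i, T.symm (Fin.castAdd n i) = ⟨(S.symm i).1, h _ (S.symm i).2⟩) :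
    ∃ U : SkewBox lam mu ≃ Fin n, T = glue h S U := by
  have hmu : ∀ b : PBox mu, T ⟨b.1, h _ b.2⟩ = Fin.castAdd n (S b) := by
    intro b
    have := hT (S b)
    rw [Equiv.symm_apply_apply, Equiv.symm_apply_eq] at this
    exact this.symm
  have hge : ∀ b : SkewBox lam mu, m ≤ (T (SkewBox.toPBox b) : ℕ) := by
    intro b
    by_contra hlt
    push Not at hlt
    have h1 := hT ⟨_, hlt⟩
    rw [show Fin.castAdd n ⟨(T (SkewBox.toPBox b) : ℕ), hlt⟩ = T (SkewBox.toPBox b) from Fin.ext rfl,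
      Equiv.symm_apply_apply] at h1
    have h2 : b.1 = (S.symm ⟨_, hlt⟩).1 := congrArg Subtype.val h1
    exact b.2.2 (h2 ▸ (S.symm ⟨_, hlt⟩).2)
  have hnot : ∀ i : Fin n, (T.symm (Fin.natAdd m i)).1.2 ∉ mu (T.symm (Fin.natAdd m i)).1.1 := by
    intro i hmem
    have h1 := hmu ⟨_, hmem⟩
    simp only [Subtype.coe_eta, Equiv.apply_symm_apply] at h1
    have := congrArg Fin.val h1
    simp only [Fin.val_natAdd, Fin.val_castAdd] at this
    have := (S ⟨_, hmem⟩).2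
    omega
  let U : SkewBox lam mu ≃ Fin n :=
    { toFun := fun b => ⟨T (SkewBox.toPBox b) - m, by have := (T (SkewBox.toPBox b)).2; have := hge b; omega⟩
      invFun := fun i => ⟨(T.symm (Fin.natAdd m i)).1, (T.symm (Fin.natAdd m i)).2, hnot i⟩
      left_inv := by
        intro b
        apply Subtype.ext
        have : Fin.natAdd m (⟨T (SkewBox.toPBox b) - m, by
            have := (T (SkewBox.toPBox b)).2; have := hge b; omega⟩ : Fin n) = T (SkewBox.toPBox b) := by
          ext
          have := hge b
          simp only [Fin.val_natAdd]
          omega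
        simp only [this, Equiv.symm_apply_apply]
        rfl
      right_inv := by
        intro i
        ext
        simp [SkewBox.toPBox] }
  refine ⟨U, ?_⟩
  ext b
  rcases splitBox_cases h b with ⟨c, rfl⟩ | ⟨c, rfl⟩
  · rw [glue_inl, splitBox_symm_inl, hmu]
  · rw [glue_inr, splitBox_symm_inr, Fin.val_natAdd]
    have := hge c
    change (T (SkewBox.toPBox c) : ℕ) = m + (T (SkewBox.toPBox c) - m)
    omega

instance skewTab_finite : Finite (SkewTab lam mu n) := by
  by_cases h : Nonempty (SkewTab lam mu n)
  · obtain ⟨U⟩ := h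
    have : Finite (SkewBox lam mu) := Finite.of_equiv _ U.1.symm
    infer_instance
  · rw [not_nonempty_iff] at h
    infer_instance

theorem skewVec_linearIndependent (h : mu ≤ lam) (S : PSYT mu m) :
    LinearIndependent ℂ fun U : SkewTab lam mu n => skewVec h m U.1 := by
  let ev : SkewSpecht lam mu m n →ₗ[ℂ] Young.Sp lam (m + n) :=
    (LinearMap.applyₗ (Young.vec S.1)).comp (SkewSpecht lam mu m n).subtype
  have hev : ∀ U : SkewTab lam mu n, ev (skewVec h m U.1) =
      Finsupp.single ⟨glue h S.1 U.1, (glue_isStandard h _ _).2 ⟨S.2, U.2⟩⟩ 1 := by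
    intro U
    exact (skewMap_vec h U.1 S.1).trans (Young.vec_of ⟨_, (glue_isStandard h _ _).2 ⟨S.2, U.2⟩⟩)
  apply LinearIndependent.of_comp ev
  have hinj : Function.Injective fun U : SkewTab lam mu n =>
      (⟨glue h S.1 U.1, (glue_isStandard h _ _).2 ⟨S.2, U.2⟩⟩ : PSYT lam (m + n)) := by
    intro U U' hUU
    have h1 : glue h S.1 U.1 = glue h S.1 U'.1 := congrArg Subtype.val hUU
    apply Subtype.ext
    ext b
    have h2 := congrArg (fun T : Filling lam (m + n) => (T ((splitBox h).symm (Sum.inr b)) : ℕ)) h1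
    simpa only [glue_inr, Fin.val_natAdd, Nat.add_left_cancel_iff] using h2
  have := (Finsupp.basisSingleOne (R := ℂ) (ι := PSYT lam (m + n))).linearIndependent.comp _ hinj
  convert this using 1
  funext U
  simp [hev]

theorem skewVec_span [NeZero ℓ] (h : mu ≤ lam) (S : PSYT mu m) :
    ⊤ ≤ Submodule.span ℂ (Set.range fun U : SkewTab lam mu n => skewVec h m U.1) := by
  classical
  intro f _
  have := Fintype.ofFinite (SkewTab lam mu n)
  set y := f.1 (Young.vec S.1) with hy
  have hprim := Complex.isPrimitiveRoot_exp ℓ (NeZero.ne ℓ)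
  set z := hprim.toRootsOfUnity with hz
  have hzv : ((z : ℂˣ) : ℂ) = Complex.exp (2 * Real.pi * Complex.I / ℓ) := by simp [hz]
  have hjm : ∀ (i : Fin m) (T : PSYT lam (m + n)),
      ((ℓ : ℂ) * ((S.1.symm i).ct : ℤ)) * y T = ((ℓ : ℂ) * ((T.1.symm (Fin.castAdd n i)).ct : ℤ)) * y T := by
    intro i T
    have h1 := skewSpecht_jmElt f i (Young.vec S.1)
    rw [spechtRep_jmElt, map_smul, ← hy] at h1
    have h2 := congrArg (fun w => w T) h1
    simp only [Finsupp.smul_apply, smul_eq_mul] at h2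
    rw [h2]
    exact apply_of_diagonal (c := fun T : PSYT lam (m + n) =>
      ((ℓ : ℂ) * ((T.1.symm (Fin.castAdd n i)).ct : ℤ)))
      (fun T => by rw [← Young.vec_of, spechtRep_jmElt]) y T
  have hdg : ∀ (i : Fin m) (T : PSYT lam (m + n)),
      ((z : ℂˣ) : ℂ) ^ ((S.1.symm i).1.1 : ℕ) * y T =
        ((z : ℂˣ) : ℂ) ^ ((T.1.symm (Fin.castAdd n i)).1.1 : ℕ) * y T := by
    intro i T
    have h1 := skewSpecht_diagAt f i z (Young.vec S.1)
    rw [spechtRep_diagAt_vec, map_smul, ← hy] at h1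
    have h2 := congrArg (fun w => w T) h1
    simp only [Finsupp.smul_apply, smul_eq_mul] at h2
    rw [h2]
    exact apply_of_diagonal (c := fun T : PSYT lam (m + n) =>
      ((z : ℂˣ) : ℂ) ^ ((T.1.symm (Fin.castAdd n i)).1.1 : ℕ))
      (fun T => by rw [← Young.vec_of, spechtRep_diagAt_vec]) y T
  let g : SkewTab lam mu n → PSYT lam (m + n) := fun U =>
    ⟨glue h S.1 U.1, (glue_isStandard h _ _).2 ⟨S.2, U.2⟩⟩
  have hg : Function.Injective g := by
    intro U U' hUU
    exact (skewVec_linearIndependent (n := n) h S).injective (skewSpecht_ext S (by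
      have h1 : glue h S.1 U.1 = glue h S.1 U'.1 := congrArg Subtype.val hUU
      exact (skewMap_vec h U.1 S.1).trans (h1 ▸ (skewMap_vec h U'.1 S.1).symm)))
  have hsupp : ∀ T, y T ≠ 0 → ∃ U, g U = T := by
    intro T hT
    have h1 : ∀ i, T.1.symm (Fin.castAdd n i) = ⟨(S.1.symm i).1, h _ (S.1.symm i).2⟩ := by
      refine psyt_prefix h S.2 T.2 (fun i => ?_) (fun i => ?_)
      · have := mul_right_cancel₀ hT (hdg i T)
        rw [hzv] at this
        exact (Fin.ext (hprim.pow_inj (Fin.is_lt _) (Fin.is_lt _) this)).symm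
      · have := mul_left_cancel₀ (Nat.cast_ne_zero.2 (NeZero.ne ℓ)) (mul_right_cancel₀ hT (hjm i T))
        exact_mod_cast this.symm
    obtain ⟨U, hU⟩ := exists_glue h S.1 T.1 h1
    have hstd : IsSkewStd U := ((glue_isStandard h S.1 U).1 (hU ▸ T.2)).2
    exact ⟨⟨U, hstd⟩, Subtype.ext hU.symm⟩
  have hf : f = ∑ U : SkewTab lam mu n, y (g U) • skewVec h m U.1 := by
    refine skewSpecht_ext S ?_
    have hsum : (∑ U : SkewTab lam mu n, y (g U) • skewVec h m U.1 : SkewSpecht lam mu m n).1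
        (Young.vec S.1) = ∑ U : SkewTab lam mu n, y (g U) • Finsupp.single (g U) 1 := by
      rw [Submodule.coe_sum, LinearMap.sum_apply]
      refine Finset.sum_congr rfl fun U _ => ?_
      rw [Submodule.coe_smul, LinearMap.smul_apply, ← Young.vec_of]
      exact congrArg _ (skewMap_vec h U.1 S.1)
    rw [hsum, ← hy]
    ext T
    rw [Finsupp.finsetSum_apply]
    by_cases hT : ∃ U, g U = T
    · obtain ⟨U, rfl⟩ := hT
      rw [Finset.sum_eq_single U]
      · simp
      · intro U' _ hne
        simp [hg.ne hne]
      · simp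
    · have h0 : y T = 0 := by
        by_contra h0
        exact hT (hsupp T h0)
      rw [h0, Finset.sum_eq_zero]
      intro U _
      have : g U ≠ T := fun e => hT ⟨U, e⟩
      simp [this]
  rw [hf]
  exact Submodule.sum_mem _ fun U _ => Submodule.smul_mem _ _ (Submodule.subset_span ⟨U, rfl⟩)

instance pbox_finite (lam : LPartition ℓ) : Finite (PBox lam) :=
  Finite.of_injective (β := Σ j, {p : ℕ × ℕ // p ∈ (lam j).cells}) (fun b => ⟨b.1.1, b.1.2, b.2⟩) (by
    rintro ⟨⟨j, p⟩, hp⟩ ⟨⟨j', p'⟩, hp'⟩ h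
    obtain ⟨rfl, h⟩ := Sigma.mk.inj h
    obtain rfl := congrArg Subtype.val (eq_of_heq h)
    rfl)

theorem card_pbox (lam : LPartition ℓ) : Nat.card (PBox lam) = lam.size := by
  let e : PBox lam ≃ Σ j, {p : ℕ × ℕ // p ∈ (lam j).cells} :=
    { toFun := fun b => ⟨b.1.1, b.1.2, b.2⟩
      invFun := fun b => ⟨(b.1, b.2.1), b.2.2⟩
      left_inv := fun _ => rfl
      right_inv := fun _ => rfl }
  rw [Nat.card_congr e, Nat.card_sigma, LPartition.size]
  refine Finset.sum_congr rfl fun j _ => ?_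
  rw [YoungDiagram.card, Nat.card_eq_fintype_card, Fintype.card_coe]

theorem exists_psyt (mu : LPartition ℓ) : Nonempty (PSYT mu mu.size) := by
  obtain ⟨T, hT⟩ := exists_linExt (B := PBox mu)
    (lt := fun b b' => b.1.1 = b'.1.1 ∧ b.1.2 ≤ b'.1.2 ∧ b ≠ b')
    (by
      rintro a b c ⟨h1, h2, h3⟩ ⟨h4, h5, h6⟩
      refine ⟨h1.trans h4, h2.trans h5, ?_⟩
      rintro rfl
      exact h3 (Subtype.ext (Prod.ext h1 (le_antisymm h2 h5))))
    (fun a h => h.2.2 rfl) (card_pbox mu)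
  exact ⟨⟨T, fun b b' h1 h2 h3 => hT b b' ⟨h1, h2, h3⟩⟩⟩

/-- The basis of `S^{λ∖μ}` indexed by the standard tableaux of shape `λ∖μ`. -/
noncomputable def skewBasis [NeZero ℓ] (h : mu ≤ lam) (n : ℕ) :
    Module.Basis (SkewTab lam mu n) ℂ (SkewSpecht lam mu mu.size n) :=
  Module.Basis.mk (skewVec_linearIndependent h (exists_psyt mu).some)
    (skewVec_span h (exists_psyt mu).some)

theorem skewBasis_apply [NeZero ℓ] (h : mu ≤ lam) (U : SkewTab lam mu n) :
    skewBasis h n U = skewVec h mu.size U.1 := by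
  rw [skewBasis, Module.Basis.mk_apply]

instance skewBox_finite : Finite (SkewBox lam mu) :=
  Finite.of_injective SkewBox.toPBox fun b b' hb => by
    have hb' : b.toPBox.1 = b'.toPBox.1 := congrArg Subtype.val hb
    exact Subtype.ext hb'

theorem card_skewBox (h : mu ≤ lam) : Nat.card (SkewBox lam mu) = lam.size - mu.size := by
  have h1 := Nat.card_congr (splitBox h)
  rw [Nat.card_sum, card_pbox, card_pbox] at h1
  omega

theorem exists_skewTab (h : mu ≤ lam) : Nonempty (SkewTab lam mu (lam.size - mu.size)) := by
  obtain ⟨T, hT⟩ := exists_linExt (B := SkewBox lam mu)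
    (lt := fun b b' => b.1.1 = b'.1.1 ∧ b.1.2 ≤ b'.1.2 ∧ b ≠ b')
    (by
      rintro a b c ⟨h1, h2, h3⟩ ⟨h4, h5, h6⟩
      refine ⟨h1.trans h4, h2.trans h5, ?_⟩
      rintro rfl
      exact h3 (Subtype.ext (Prod.ext h1 (le_antisymm h2 h5))))
    (fun a h => h.2.2 rfl) (card_skewBox h)
  exact ⟨⟨T, fun b b' h1 h2 h3 => hT b b' ⟨h1, h2, h3⟩⟩⟩

end SkewAction


/-! Blocks of consecutive entries. -/

section Blocks

variable {k : ℕ} (size : Fin k → ℕ)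

/-- The entries of the `i`-th block. -/
abbrev blockEmb (i : Fin k) : Fin (size i) ↪ Fin (∑ j, size j) :=
  shiftEmb (blockStart size i) (size i) _ (blockStart_le size i)

theorem blockEmb_injective :
    Function.Injective fun p : Σ i, Fin (size i) => blockEmb size p.1 p.2 := by
  rintro ⟨i, a⟩ ⟨j, b⟩ h
  have hv : blockStart size i + a = blockStart size j + b := congrArg Fin.val h
  rcases lt_trichotomy i j with hij | rfl | hij
  · have := blockStart_lt size i j hij
    have := a.2
    omega
  · obtain rfl : a = b := Fin.ext (by omega)
    rfl
  · have := blockStart_lt size j i hij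
    have := b.2
    omega

/-- The disjoint union of the blocks is the set of all entries. -/
noncomputable def blockEquiv : (Σ i, Fin (size i)) ≃ Fin (∑ j, size j) :=
  Equiv.ofBijective _ ((Fintype.bijective_iff_injective_and_card _).2 ⟨blockEmb_injective size, by simp⟩)

theorem blockEquiv_apply (i : Fin k) (a : Fin (size i)) :
    blockEquiv size ⟨i, a⟩ = blockEmb size i a := rfl

end Blocks

namespace SkewShape

variable {ℓ : ℕ} {D D' : SkewShape ℓ}

/-- The order that standard Young tableaux respect. -/
def boxLt (b b' : D.Box) : Prop :=
  b.coord = b'.coord ∧ (∃ k l : ℕ, b'.x = b.x + k ∧ b'.y = b.y + l) ∧ b ≠ b'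

theorem Box.ext' {b b' : D.Box} (h1 : b.coord = b'.coord) (h2 : b.x = b'.x) (h3 : b.y = b'.y) : b = b' :=
  Subtype.ext (Prod.ext h1 (Prod.ext h2 h3))

theorem exists_box_between {b b' : D.Box} (h : b.coord = b'.coord) {k l : ℕ} (hx : b'.x = b.x + k)
    (hy : b'.y = b.y + l) {k' l' : ℕ} (hk : k' ≤ k) (hl : l' ≤ l) :
    ∃ c : D.Box, c.coord = b.coord ∧ c.x = b.x + k' ∧ c.y = b.y + l' := by
  have h1 : (b.x, b.y) ∈ D.part b.coord := b.2
  have h2 : (b.x + k, b.y + l) ∈ D.part b.coord := by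
    rw [← hx, ← hy, h]; exact b'.2
  exact ⟨⟨(b.coord, b.x + k', b.y + l'), D.isSkew _ _ _ _ _ h1 h2 k' l' hk hl⟩, rfl, rfl, rfl⟩

theorem comp_eq_of_diff {b b' : D.Box} (h : b.coord = b'.coord) {k l : ℕ} (hx : b'.x = b.x + k)
    (hy : b'.y = b.y + l) : b.comp = b'.comp := by
  induction k generalizing b' with
  | zero =>
    induction l generalizing b' with
    | zero =>
      rw [Box.ext' h (by simp [hx]) (by simp [hy])]
    | succ l ih =>
      obtain ⟨c, h1, h2, h3⟩ := exists_box_between h hx hy le_rfl (Nat.le_succ l)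
      rw [ih h1.symm h2 h3]
      refine SimpleGraph.ConnectedComponent.sound (SimpleGraph.Adj.reachable ?_)
      refine ⟨h1.trans h, Or.inl ⟨h2.trans hx.symm, Or.inr ?_⟩⟩
      rw [h3, hy]; push_cast; ring
  | succ k ih =>
    obtain ⟨c, h1, h2, h3⟩ := exists_box_between h hx hy (Nat.le_succ k) le_rfl
    rw [ih h1.symm h2 h3]
    refine SimpleGraph.ConnectedComponent.sound (SimpleGraph.Adj.reachable ?_)
    refine ⟨h1.trans h, Or.inr ⟨h3.trans hy.symm, Or.inr ?_⟩⟩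
    rw [h2, hx]; push_cast; ring

theorem boxLt.comp_eq {b b' : D.Box} (h : boxLt b b') : b.comp = b'.comp := by
  obtain ⟨h1, ⟨k, l, h2, h3⟩, -⟩ := h
  exact comp_eq_of_diff h1 h2 h3

theorem boxLt.trans {a b c : D.Box} (h : boxLt a b) (h' : boxLt b c) : boxLt a c := by
  obtain ⟨h1, ⟨k, l, h2, h3⟩, h4⟩ := h
  obtain ⟨h1', ⟨k', l', h2', h3'⟩, h4'⟩ := h'
  refine ⟨h1.trans h1', ⟨k + k', l + l', ?_, ?_⟩, ?_⟩
  · rw [h2', h2]; push_cast; ring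
  · rw [h3', h3]; push_cast; ring
  · rintro rfl
    rw [h2'] at h2
    rw [h3'] at h3
    have e1 : ((k' + k : ℕ) : ℂ) = 0 := by push_cast; linear_combination -h2
    have e2 : ((l' + l : ℕ) : ℂ) = 0 := by push_cast; linear_combination -h3
    rw [Nat.cast_eq_zero] at e1 e2
    obtain rfl : k' = 0 := by omega
    obtain rfl : l' = 0 := by omega
    exact h4' (Box.ext' h1' (by simp [h2']) (by simp [h3']))

namespace DiagonalSlide

variable (S : DiagonalSlide D D')

theorem ct_eq (b : D.Box) : (S.toIso b).ct = b.ct := by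
  rw [Box.ct, Box.ct, S.x_eq, S.y_eq]; ring

theorem comp_eq_iff (b b' : D.Box) : (S.toIso b).comp = (S.toIso b').comp ↔ b.comp = b'.comp := by
  unfold Box.comp
  rw [SimpleGraph.ConnectedComponent.eq, SimpleGraph.ConnectedComponent.eq, SimpleGraph.Iso.reachable_iff]

theorem boxLt_iff (b b' : D.Box) : boxLt (S.toIso b) (S.toIso b') ↔ boxLt b b' := by
  have hne : S.toIso b ≠ S.toIso b' ↔ b ≠ b' := S.toIso.injective.ne_iff
  constructor
  · intro h
    have hc := (S.comp_eq_iff b b').1 h.comp_eq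
    obtain ⟨h1, ⟨k, l, h2, h3⟩, h4⟩ := h
    refine ⟨by rwa [S.coord_eq, S.coord_eq] at h1, ⟨k, l, ?_, ?_⟩, hne.1 h4⟩
    · rw [S.x_eq, S.x_eq, hc] at h2; linear_combination h2
    · rw [S.y_eq, S.y_eq, hc] at h3; linear_combination h3
  · intro h
    have hc := h.comp_eq
    obtain ⟨h1, ⟨k, l, h2, h3⟩, h4⟩ := h
    refine ⟨by rwa [S.coord_eq, S.coord_eq], ⟨k, l, ?_, ?_⟩, hne.2 h4⟩
    · rw [S.x_eq, S.x_eq, hc]; linear_combination h2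
    · rw [S.y_eq, S.y_eq, hc]; linear_combination h3

end DiagonalSlide

namespace Presentation

variable (P : Presentation D)

/-- The boxes of the skew diagrams `λ_i∖μ_i`. -/
abbrev Cell : Type := Σ i, SkewBox (P.outer i) (P.inner i)

theorem cell_mem (p : P.Cell) : ∃ h : (((p.2.1.2.2 : ℂ) + 1 + P.α p.1, (p.2.1.2.1 : ℂ) + 1) : ℂ × ℂ) ∈
    D.part p.2.1.1, Box.comp (⟨(p.2.1.1, _), h⟩ : D.Box) = P.comp p.1 :=
  (P.comp_eq p.1 p.2.1.1 _).2 ⟨p.2.1.2.1, p.2.1.2.2, p.2.2.1, p.2.2.2, rfl⟩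

/-- The box of `D` given by a box of `λ_i∖μ_i`. -/
noncomputable def cellBox (p : P.Cell) : D.Box :=
  ⟨(p.2.1.1, (p.2.1.2.2 : ℂ) + 1 + P.α p.1, (p.2.1.2.1 : ℂ) + 1), (P.cell_mem p).1⟩

theorem cellBox_comp (p : P.Cell) : (P.cellBox p).comp = P.comp p.1 := (P.cell_mem p).2

theorem cellBox_x (p : P.Cell) : (P.cellBox p).x = (p.2.1.2.2 : ℂ) + 1 + P.α p.1 := rfl

theorem cellBox_y (p : P.Cell) : (P.cellBox p).y = (p.2.1.2.1 : ℂ) + 1 := rfl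

theorem cellBox_ct (p : P.Cell) :
    (P.cellBox p).ct = ((p.2.1.2.2 : ℂ) - (p.2.1.2.1 : ℂ)) + P.α p.1 := by
  rw [Box.ct, cellBox_x, cellBox_y]; ring

theorem cellBox_bijective : Function.Bijective P.cellBox := by
  constructor
  · rintro ⟨i, ⟨⟨j, r, c⟩, hs⟩⟩ ⟨i', ⟨⟨j', r', c'⟩, hs'⟩⟩ h
    have hi : P.comp i = P.comp i' := by
      rw [← P.cellBox_comp ⟨i, ⟨(j, r, c), hs⟩⟩, h, cellBox_comp]
    obtain rfl := P.comp.injective hi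
    obtain rfl : j = j' := congrArg Box.coord h
    have hx := congrArg Box.x h
    have hy := congrArg Box.y h
    simp only [cellBox_x, cellBox_y, add_left_inj, Nat.cast_inj] at hx hy
    subst hx hy
    rfl
  · intro b
    obtain ⟨i, hi⟩ := P.comp.surjective b.comp
    obtain ⟨r, c, h1, h2, h3⟩ := (P.comp_eq i b.coord b.1.2).1 ⟨b.2, hi.symm⟩
    refine ⟨⟨i, ⟨(b.coord, r, c), h1, h2⟩⟩, ?_⟩
    exact Subtype.ext (Prod.ext rfl h3.symm)

/-- The boxes of `D` are those of the skew diagrams `λ_i∖μ_i`. -/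
noncomputable def cellEquiv : P.Cell ≃ D.Box := Equiv.ofBijective P.cellBox P.cellBox_bijective

theorem cellEquiv_apply (p : P.Cell) : P.cellEquiv p = P.cellBox p := rfl

theorem boxLt_cellBox_fst {p p' : P.Cell} (h : boxLt (P.cellBox p) (P.cellBox p')) : p.1 = p'.1 := by
  have := h.comp_eq
  rw [cellBox_comp, cellBox_comp] at this
  exact P.comp.injective this

theorem boxLt_cellBox_iff (i : Fin P.k) (s s' : SkewBox (P.outer i) (P.inner i)) :
    boxLt (P.cellBox ⟨i, s⟩) (P.cellBox ⟨i, s'⟩) ↔ s.1.1 = s'.1.1 ∧ s.1.2 ≤ s'.1.2 ∧ s ≠ s' := by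
  have hne : P.cellBox ⟨i, s⟩ ≠ P.cellBox ⟨i, s'⟩ ↔ s ≠ s' := by
    rw [P.cellBox_bijective.injective.ne_iff]
    simp
  constructor
  · rintro ⟨h1, ⟨k, l, h2, h3⟩, h4⟩
    refine ⟨h1, ?_, hne.1 h4⟩
    rw [cellBox_x, cellBox_x] at h2
    rw [cellBox_y, cellBox_y] at h3
    have e2 : s'.1.2.2 = s.1.2.2 + k := by
      have : (s'.1.2.2 : ℂ) = ((s.1.2.2 + k : ℕ) : ℂ) := by push_cast; linear_combination h2
      exact_mod_cast this
    have e3 : s'.1.2.1 = s.1.2.1 + l := by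
      have : (s'.1.2.1 : ℂ) = ((s.1.2.1 + l : ℕ) : ℂ) := by push_cast; linear_combination h3
      exact_mod_cast this
    rw [Prod.le_def]
    omega
  · rintro ⟨h1, h2, h3⟩
    rw [Prod.le_def] at h2
    refine ⟨h1, ⟨s'.1.2.2 - s.1.2.2, s'.1.2.1 - s.1.2.1, ?_, ?_⟩, hne.2 h3⟩
    · rw [cellBox_x, cellBox_x, Nat.cast_sub h2.2]; simp only; ring
    · rw [cellBox_y, cellBox_y, Nat.cast_sub h2.1]; ring

theorem exists_y_eq (P : Presentation D) (b : D.Box) : ∃ r : ℕ, b.y = r := by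
  obtain ⟨p, rfl⟩ := P.cellBox_bijective.surjective b
  exact ⟨p.2.1.2.1 + 1, by rw [cellBox_y]; push_cast; ring⟩

/-- The boxes of a shape with integral rows as a poset of boxes. -/
noncomputable def boxPoset (P : Presentation D) : BoxPoset ℓ D.Box where
  coord := Box.coord
  ct := Box.ct
  lt := boxLt
  trans _ _ _ := boxLt.trans
  irrefl _ h := h.2.2 rfl
  separated := by
    have key : ∀ b b' : D.Box, b.coord = b'.coord → b.ct = b'.ct → ∀ r r' : ℕ, b.y = r → b'.y = r' →
        r < r' → ∃ c c', c ≠ c' ∧ boxLt b c ∧ boxLt c b' ∧ boxLt b c' ∧ boxLt c' b' := by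
      intro b b' hc hct r r' hr hr' hlt
      obtain ⟨k, rfl⟩ : ∃ k, r' = r + (k + 1) := ⟨r' - r - 1, by omega⟩
      have hy : b'.y = b.y + (k + 1 : ℕ) := by rw [hr, hr']; push_cast; ring
      have hx : b'.x = b.x + (k + 1 : ℕ) := by
        rw [Box.ct, Box.ct] at hct
        linear_combination hy - hct
      obtain ⟨c, c1, c2, c3⟩ := exists_box_between hc hx hy (show 1 ≤ k + 1 by omega) (Nat.zero_le _)
      obtain ⟨d, d1, d2, d3⟩ := exists_box_between hc hx hy (Nat.zero_le _) (show 1 ≤ k + 1 by omega)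
      have hk : (k : ℂ) + 1 ≠ 0 := by exact_mod_cast Nat.succ_ne_zero k
      refine ⟨c, d, ?_, ⟨c1.symm, ⟨1, 0, c2, c3⟩, ?_⟩, ⟨c1.trans hc, ⟨k, k + 1, ?_, ?_⟩, ?_⟩,
        ⟨d1.symm, ⟨0, 1, d2, d3⟩, ?_⟩, ⟨d1.trans hc, ⟨k + 1, k, ?_, ?_⟩, ?_⟩⟩
      · rintro rfl
        rw [c2] at d2
        simp at d2
      · rintro rfl
        simp at c2
      · rw [hx, c2]; push_cast; ring
      · rw [hy, c3]; push_cast; ring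
      · rintro rfl
        rw [hy] at c3
        push_cast at c3
        exact hk (by linear_combination c3)
      · rintro rfl
        simp at d3
      · rw [hx, d2]; push_cast; ring
      · rw [hy, d3]; push_cast; ring
      · rintro rfl
        rw [hx] at d2
        push_cast at d2
        exact hk (by linear_combination d2)
    intro b b' hc hct hne
    obtain ⟨r, hr⟩ := P.exists_y_eq b
    obtain ⟨r', hr'⟩ := P.exists_y_eq b'
    rcases lt_trichotomy r r' with h | rfl | h
    · exact Or.inl (key b b' hc hct r r' hr hr' h)
    · refine absurd (Box.ext' hc ?_ (hr.trans hr'.symm)) hne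
      rw [Box.ct, Box.ct, hr, hr'] at hct
      exact sub_left_injective hct
    · exact Or.inr (key b' b hc.symm hct.symm r' r hr' hr h)
  cover := by
    rintro b b' ⟨hc, ⟨k, l, hx, hy⟩, hne⟩ hmin
    refine ⟨hc, ?_⟩
    have hmid : ∀ k' l' : ℕ, k' ≤ k → l' ≤ l → 0 < k' + l' → k' = k ∧ l' = l := by
      intro k' l' hk hl hpos
      obtain ⟨c, c1, c2, c3⟩ := exists_box_between hc hx hy hk hl
      by_contra hcon
      refine hmin c ⟨c1.symm, ⟨k', l', c2, c3⟩, ?_⟩ ⟨c1.trans hc, ⟨k - k', l - l', ?_, ?_⟩, ?_⟩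
      · rintro rfl
        have e1 : (k' : ℂ) = 0 := by linear_combination -c2
        have e2 : (l' : ℂ) = 0 := by linear_combination -c3
        rw [Nat.cast_eq_zero] at e1 e2
        omega
      · rw [hx, c2, Nat.cast_sub hk]; ring
      · rw [hy, c3, Nat.cast_sub hl]; ring
      · rintro rfl
        rw [hx] at c2
        rw [hy] at c3
        have e1 : (k : ℂ) = k' := by linear_combination c2
        have e2 : (l : ℂ) = l' := by linear_combination c3
        rw [Nat.cast_inj] at e1 e2
        omega
    have hkl : 0 < k + l := by
      by_contra h0
      obtain rfl : k = 0 := by omega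
      obtain rfl : l = 0 := by omega
      exact hne (Box.ext' hc (by simp [hx]) (by simp [hy]))
    rw [Box.ct, Box.ct, hx, hy]
    rcases Nat.eq_zero_or_pos k with rfl | hk
    · obtain rfl : 1 = l := (hmid 0 1 le_rfl (by omega) (by omega)).2
      push_cast; ring
    · obtain ⟨rfl, rfl⟩ := hmid 1 0 hk (Nat.zero_le _) (by omega)
      push_cast; ring
  comparable := by
    have key : ∀ b b' : D.Box, b.coord = b'.coord → (b'.ct - b.ct) ^ 2 = 1 → ∀ r r' : ℕ, b.y = r →
        b'.y = r' → r < r' → boxLt b b' := by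
      intro b b' hc hct r r' hr hr' hlt
      obtain ⟨k, rfl⟩ : ∃ k, r' = r + (k + 1) := ⟨r' - r - 1, by omega⟩
      have hne : b ≠ b' := by
        rintro rfl
        rw [hr, Nat.cast_inj] at hr'
        omega
      have hy : b'.y = b.y + (k + 1 : ℕ) := by rw [hr, hr']; push_cast; ring
      rcases sq_eq_one_iff.1 hct with h | h
      · refine ⟨hc, ⟨k + 2, k + 1, ?_, hy⟩, hne⟩
        rw [Box.ct, Box.ct] at h
        push_cast at hy ⊢
        linear_combination h + hy
      · refine ⟨hc, ⟨k, k + 1, ?_, hy⟩, hne⟩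
        rw [Box.ct, Box.ct] at h
        push_cast at hy ⊢
        linear_combination h + hy
    intro b b' hc hct
    obtain ⟨r, hr⟩ := P.exists_y_eq b
    obtain ⟨r', hr'⟩ := P.exists_y_eq b'
    rcases lt_trichotomy r r' with h | rfl | h
    · exact Or.inl (key b b' hc hct r r' hr hr' h)
    · have hy : b'.y = b.y := hr'.trans hr.symm
      have hne : b ≠ b' := by
        rintro rfl
        simp at hct
      rcases sq_eq_one_iff.1 hct with h | h
      · refine Or.inl ⟨hc, ⟨1, 0, ?_, by simp [hy]⟩, hne⟩
        rw [Box.ct, Box.ct] at h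
        push_cast
        linear_combination h + hy
      · refine Or.inr ⟨hc.symm, ⟨1, 0, ?_, by simp [hy]⟩, hne.symm⟩
        rw [Box.ct, Box.ct] at h
        push_cast
        linear_combination -h - hy
    · exact Or.inr (key b' b hc.symm (by rw [← hct]; ring) r' r hr' hr h)

theorem card_box [NeZero ℓ] : Nat.card D.Box = P.n := by
  rw [← Nat.card_congr P.cellEquiv]
  rw [Nat.card_sigma]
  exact Finset.sum_congr rfl fun i _ => card_skewBox (P.inner_le_outer i)

theorem pco_cellBox (i : Fin P.k) (s s' : SkewBox (P.outer i) (P.inner i)) :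
    P.boxPoset.pco (P.cellBox ⟨i, s⟩) (P.cellBox ⟨i, s'⟩) =
      ((Young.pco s.toPBox s'.toPBox : ℝ) : ℂ) := by
  have hc : P.boxPoset.coord (P.cellBox ⟨i, s⟩) = P.boxPoset.coord (P.cellBox ⟨i, s'⟩) ↔
    s.toPBox.1.1 = s'.toPBox.1.1 := Iff.rfl
  have hct : ∀ s, P.boxPoset.ct (P.cellBox ⟨i, s⟩) = ((s.1.2.2 : ℂ) - (s.1.2.1 : ℂ)) + P.α i :=
    fun s => P.cellBox_ct ⟨i, s⟩
  simp only [BoxPoset.pco, Young.pco, hc, hct]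
  split_ifs
  · simp only [PBox.ct, SkewBox.toPBox]
    push_cast
    ring
  · simp

theorem qco_cellBox (i : Fin P.k) (s s' : SkewBox (P.outer i) (P.inner i)) :
    P.boxPoset.qco (P.cellBox ⟨i, s⟩) (P.cellBox ⟨i, s'⟩) =
      ((Young.qco s.toPBox s'.toPBox : ℝ) : ℂ) := by
  have h := Young.pco_sq_le s.toPBox s'.toPBox
  rw [BoxPoset.qco, pco_cellBox, Young.qco, Real.sqrt_eq_rpow, Complex.ofReal_cpow (by linarith)]
  norm_num

/-- The filling of `D` composed of fillings of the components. -/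
noncomputable def joinTab (U : ∀ i, SkewBox (P.outer i) (P.inner i) ≃ Fin (P.size i)) : D.Box ≃ Fin P.n :=
  (P.cellEquiv.symm.trans (Equiv.sigmaCongrRight U)).trans (blockEquiv P.size)

variable (U : ∀ i, SkewBox (P.outer i) (P.inner i) ≃ Fin (P.size i))

theorem joinTab_cellBox (i : Fin P.k) (s : SkewBox (P.outer i) (P.inner i)) :
    P.joinTab U (P.cellBox ⟨i, s⟩) = blockEmb P.size i (U i s) := by
  rw [joinTab, ← cellEquiv_apply]
  simp [blockEquiv_apply]

theorem joinTab_symm_blockEmb (i : Fin P.k) (a : Fin (P.size i)) :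
    (P.joinTab U).symm (blockEmb P.size i a) = P.cellBox ⟨i, (U i).symm a⟩ := by
  rw [Equiv.symm_apply_eq, joinTab_cellBox, Equiv.apply_symm_apply]

theorem joinTab_trans_isStd (hU : ∀ i, IsSkewStd (U i)) (w : Equiv.Perm (Fin P.n))
    (hw : ∀ i, StrictMono fun a => w (blockEmb P.size i a)) :
    P.boxPoset.IsStd ((P.joinTab U).trans w) := by
  intro b b' hb
  obtain ⟨⟨i, s⟩, rfl⟩ := P.cellBox_bijective.surjective b
  obtain ⟨⟨i', s'⟩, rfl⟩ := P.cellBox_bijective.surjective b'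
  obtain rfl : i = i' := P.boxLt_cellBox_fst hb
  obtain ⟨h1, h2, h3⟩ := (P.boxLt_cellBox_iff i s s').1 hb
  rw [Equiv.trans_apply, Equiv.trans_apply, joinTab_cellBox, joinTab_cellBox]
  exact hw i (hU i s s' h1 h2 h3)

theorem joinTab_isStd (hU : ∀ i, IsSkewStd (U i)) : P.boxPoset.IsStd (P.joinTab U) := by
  refine P.joinTab_trans_isStd U hU 1 fun i a b hab => ?_
  simp only [Equiv.Perm.one_apply, Fin.lt_def, shiftEmb_val] at hab ⊢
  omega

theorem isSkewStd_of_joinTab (h : P.boxPoset.IsStd (P.joinTab U)) (i : Fin P.k) : IsSkewStd (U i) := by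
  intro s s' h1 h2 h3
  have := h _ _ ((P.boxLt_cellBox_iff i s s').2 ⟨h1, h2, h3⟩)
  rw [joinTab_cellBox, joinTab_cellBox, Fin.lt_def, shiftEmb_val, shiftEmb_val] at this
  rw [Fin.lt_def]
  omega

theorem blockEmb_lt (i : Fin P.k) {j : ℕ} (hj : j < P.size i) : blockStart P.size i + j < P.n := by
  have := blockStart_le P.size i
  unfold n
  omega

theorem joinTab_swap (i : Fin P.k) (j : ℕ) (hj : j + 1 < P.size i) :
    P.joinTab (Function.update U i (BoxPoset.swapT (U i) j hj)) =
      BoxPoset.swapT (P.joinTab U) (blockStart P.size i + j) (P.blockEmb_lt i hj) := by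
  ext b
  obtain ⟨⟨i', s⟩, rfl⟩ := P.cellBox_bijective.surjective b
  rw [BoxPoset.swapT_val, joinTab_cellBox, joinTab_cellBox, shiftEmb_val, shiftEmb_val]
  by_cases h : i' = i
  · subst h
    rw [Function.update_self, BoxPoset.swapT_val]
    split_ifs <;> omega
  · rw [Function.update_of_ne h]
    have h2 := (U i' s).2
    rcases lt_or_gt_of_ne h with h1 | h1
    · have := blockStart_lt P.size _ _ h1
      split_ifs <;> omega
    · have := blockStart_lt P.size _ _ h1
      split_ifs <;> omega

theorem joinTab_trans_injective {U U' : ∀ i, SkewBox (P.outer i) (P.inner i) ≃ Fin (P.size i)}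
    {w w' : Equiv.Perm (Fin P.n)} (hw : ∀ i, StrictMono fun a => w (blockEmb P.size i a))
    (hw' : ∀ i, StrictMono fun a => w' (blockEmb P.size i a))
    (h : (P.joinTab U).trans w = (P.joinTab U').trans w') : w = w' ∧ U = U' := by
  have hval : ∀ i s, w (blockEmb P.size i (U i s)) = w' (blockEmb P.size i (U' i s)) := by
    intro i s
    have := congrArg (fun T : D.Box ≃ Fin P.n => T (P.cellBox ⟨i, s⟩)) h
    simpa only [Equiv.trans_apply, joinTab_cellBox] using this
  have hblock : ∀ i, (fun a => w (blockEmb P.size i a)) = fun a => w' (blockEmb P.size i a) := by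
    intro i
    refine (StrictMono.range_inj (hw i) (hw' i)).1 ?_
    have h1 : Set.range (fun a => w (blockEmb P.size i a)) =
        Set.range fun s => w (blockEmb P.size i (U i s)) :=
      ((U i).surjective.range_comp fun a => w (blockEmb P.size i a)).symm
    have h2 : Set.range (fun a => w' (blockEmb P.size i a)) =
        Set.range fun s => w' (blockEmb P.size i (U' i s)) :=
      ((U' i).surjective.range_comp fun a => w' (blockEmb P.size i a)).symm
    rw [h1, h2]
    congr 1
    exact funext fun s => hval i s
  have hww : w = w' := by
    ext x
    obtain ⟨⟨i, a⟩, rfl⟩ := (blockEquiv P.size).surjective x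
    exact congrArg Fin.val (congrFun (hblock i) a)
  refine ⟨hww, ?_⟩
  subst hww
  funext i
  ext s
  have := (blockEmb P.size i).injective (w.injective (hval i s))
  exact congrArg Fin.val this

end Presentation

/-- Sliding components does not change the standard Young tableaux. -/
noncomputable def DiagonalSlide.tabEquiv (S : DiagonalSlide D D') (P : Presentation D') (n : ℕ) :
    P.boxPoset.Tab n ≃ D.SYT n where
  toFun T := ⟨S.toIso.toEquiv.trans T.1, fun b b' h1 h2 h3 => T.2 _ _ ((S.boxLt_iff b b').2 ⟨h1, h2, h3⟩)⟩
  invFun T := ⟨S.toIso.toEquiv.symm.trans T.1, fun b b' hb => by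
    obtain ⟨c, rfl⟩ := S.toIso.surjective b
    obtain ⟨c', rfl⟩ := S.toIso.surjective b'
    obtain ⟨h1, h2, h3⟩ := (S.boxLt_iff c c').1 hb
    have hs : ∀ c, S.toIso.toEquiv.symm (S.toIso c) = c := S.toIso.toEquiv.symm_apply_apply
    rw [Equiv.trans_apply, Equiv.trans_apply, hs, hs]
    exact T.2 c c' h1 h2 h3⟩
  left_inv T := by
    apply Subtype.ext
    ext b
    simp
  right_inv T := by
    apply Subtype.ext
    ext b
    exact congrArg (fun c => (T.1 c : ℕ)) (S.toIso.toEquiv.symm_apply_apply b)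

theorem DiagonalSlide.tabEquiv_symm_apply (S : DiagonalSlide D D') (P : Presentation D') {n : ℕ}
    (T : D.SYT n) (i : Fin n) : ((S.tabEquiv P n).symm T).1.symm i = S.toIso (T.boxOf i) := rfl

end SkewShape


open scoped TensorProduct

/-! Induced modules. -/

section Induction

variable {A B N W : Type} [Semiring A] [Algebra ℂ A] [Ring B] [Algebra ℂ B] [AddCommMonoid N] [Module ℂ N]
  [AddCommGroup W] [Module ℂ W] (f : A →ₐ[ℂ] B) (ρ : A →ₐ[ℂ] Module.End ℂ N)

/-- The map `x ↦ 1 ⊗ x`. -/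
noncomputable def indOne : N →ₗ[ℂ] Ind f ρ :=
  ((indRel f ρ).mkQ.restrictScalars ℂ).comp (TensorProduct.mk ℂ B N 1)

theorem indOne_apply (x : N) : indOne f ρ x = Submodule.Quotient.mk ((1 : B) ⊗ₜ[ℂ] x) := rfl

theorem smul_indOne_eq (b : B) (x : N) :
    b • indOne f ρ x = Submodule.Quotient.mk (b ⊗ₜ[ℂ] x) := by
  rw [indOne_apply, ← Submodule.Quotient.mk_smul, TensorProduct.smul_tmul', smul_eq_mul, mul_one]

theorem map_smul_indOne (a : A) (x : N) : f a • indOne f ρ x = indOne f ρ (ρ a x) := by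
  rw [smul_indOne_eq, indOne_apply, Submodule.Quotient.eq]
  exact Submodule.subset_span ⟨1, a, x, by rw [one_mul]⟩

/-- A subspace of the induced module that contains all `b ⊗ x` is everything. -/
theorem ind_eq_top (K : Submodule ℂ (Ind f ρ)) (hK : ∀ (b : B) x, b • indOne f ρ x ∈ K) : K = ⊤ := by
  rw [eq_top_iff]
  rintro m -
  obtain ⟨z, rfl⟩ := Submodule.Quotient.mk_surjective _ m
  induction z using TensorProduct.induction_on with
  | zero => exact K.zero_mem
  | tmul b x => rw [← smul_indOne_eq]; exact hK b x
  | add y z hy hz => exact K.add_mem hy hz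

variable {f ρ}

/-- The universal property of the induced module. -/
theorem exists_indLift (σ : B →ₐ[ℂ] Module.End ℂ W) (Θ : N →ₗ[ℂ] W)
    (h : ∀ a, Θ ∘ₗ ρ a = σ (f a) ∘ₗ Θ) :
    ∃ Φ : Ind f ρ →ₗ[ℂ] W, (∀ x, Φ (indOne f ρ x) = Θ x) ∧ ∀ b m, Φ (b • m) = σ b (Φ m) := by
  let φ : B ⊗[ℂ] N →ₗ[ℂ] W := TensorProduct.lift ((LinearMap.lcomp ℂ W Θ).comp σ.toLinearMap)
  have hφ : ∀ b x, φ (b ⊗ₜ[ℂ] x) = σ b (Θ x) := fun b x => by simp [φ]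
  have hsm : ∀ (b : B) z, φ (b • z) = σ b (φ z) := by
    intro b z
    induction z using TensorProduct.induction_on with
    | zero => simp
    | tmul c x => rw [TensorProduct.smul_tmul', hφ, hφ, smul_eq_mul, map_mul, Module.End.mul_apply]
    | add y z hy hz => rw [smul_add, map_add, map_add, map_add, hy, hz]
  have hker : (indRel f ρ).restrictScalars ℂ ≤ LinearMap.ker φ := by
    intro z hz
    rw [Submodule.restrictScalars_mem] at hz
    rw [LinearMap.mem_ker]
    induction hz using Submodule.span_induction with
    | mem z hz =>
      obtain ⟨b, a, x, rfl⟩ := hz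
      rw [map_sub, hφ, hφ, map_mul, Module.End.mul_apply, sub_eq_zero]
      exact congrArg _ (congrArg (fun t => t x) (h a)).symm
    | zero => exact map_zero _
    | add y z _ _ hy hz => rw [map_add, hy, hz, add_zero]
    | smul b z _ hz => rw [hsm, hz, map_zero]
  let Φ : Ind f ρ →ₗ[ℂ] W := (Submodule.liftQ _ φ hker).comp
    (Submodule.Quotient.restrictScalarsEquiv ℂ (indRel f ρ)).symm.toLinearMap
  have hΦ : ∀ z, Φ (Submodule.Quotient.mk z) = φ z := fun z => rfl
  refine ⟨Φ, fun x => ?_, fun b m => ?_⟩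
  · rw [indOne_apply, hΦ, hφ, map_one, Module.End.one_apply]
  · obtain ⟨z, rfl⟩ := Submodule.Quotient.mk_surjective _ m
    rw [← Submodule.Quotient.mk_smul, hΦ, hΦ, hsm]

end Induction

/-! The Young subalgebra. -/

section YoungSubalgebra

variable {ℓ : ℕ} [NeZero ℓ] {k : ℕ} {size : Fin k → ℕ}

theorem prod_ofFn_mulSingle {M : Type*} [Monoid M] {k : ℕ} (i : Fin k) (a : M) (f : Fin k → M)
    (hi : f i = a) (hne : ∀ j, j ≠ i → f j = 1) : (List.ofFn f).prod = a := by
  induction k with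
  | zero => exact i.elim0
  | succ k ih =>
    rw [List.ofFn_succ, List.prod_cons]
    refine Fin.cases (fun hi hne => ?_) (fun i hi hne => ?_) i hi hne
    · have : (fun j : Fin k => f j.succ) = fun _ => 1 := funext fun j => hne _ (Fin.succ_ne_zero j)
      rw [this, hi]
      simp
    · rw [hne 0 (Fin.succ_ne_zero i).symm, one_mul]
      exact ih i _ hi fun j hj => hne _ fun e => hj (Fin.succ_injective _ e)

theorem youngHom_single (i : Fin k) (x : Hecke ℓ (size i)) :
    youngHom ℓ size (PiTensorProduct.singleAlgHom i x) =
      heckeShift ℓ (blockStart size i) (size i) _ (blockStart_le size i) x := by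
  rw [PiTensorProduct.singleAlgHom_apply, youngHom, PiTensorProduct.liftAlgHom_apply,
    PiTensorProduct.lift.tprod, MultilinearMap.compLinearMap_apply, MultilinearMap.mkPiAlgebraFin_apply]
  refine prod_ofFn_mulSingle i _ _ ?_ ?_
  · simp
  · intro j hj
    simp [Pi.mulSingle_eq_of_ne hj]

variable {N : Fin k → Type} [∀ i, AddCommMonoid (N i)] [∀ i, Module ℂ (N i)]
  (ρ : ∀ i, Hecke ℓ (size i) →ₐ[ℂ] Module.End ℂ (N i))

theorem tensorRep_single (i : Fin k) (x : Hecke ℓ (size i)) (v : ∀ i, N i) :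
    tensorRep ρ (PiTensorProduct.singleAlgHom i x) (PiTensorProduct.tprod ℂ v) =
      PiTensorProduct.tprod ℂ (Function.update v i (ρ i x (v i))) := by
  rw [PiTensorProduct.singleAlgHom_apply, tensorRep, PiTensorProduct.liftAlgHom_apply,
    PiTensorProduct.lift.tprod, MultilinearMap.compLinearMap_apply,
    PiTensorProduct.mapMultilinear_apply, PiTensorProduct.map_tprod]
  congr 1
  funext j
  by_cases hj : j = i
  · subst hj
    simp
  · simp [Pi.mulSingle_eq_of_ne hj, Function.update_of_ne hj]

/-- A subalgebra of `H_{ℓ,n_1} ⊗ ⋯ ⊗ H_{ℓ,n_k}` that contains all generators is everything. -/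
theorem youngAlg_induction (S : Subalgebra ℂ (YoungAlg ℓ size))
    (hu : ∀ i j, PiTensorProduct.singleAlgHom i (uH j) ∈ S)
    (hd : ∀ i j ε, PiTensorProduct.singleAlgHom i (gH ℓ (size i) (diagAt j ε)) ∈ S)
    (hs : ∀ i j hj, PiTensorProduct.singleAlgHom i (gH ℓ (size i) (simpleRefl j hj)) ∈ S)
    (a : YoungAlg ℓ size) : a ∈ S := by
  have h1 : ∀ i x, PiTensorProduct.singleAlgHom i x ∈ S := by
    intro i x
    let ι : Hecke ℓ (size i) →ₐ[ℂ] YoungAlg ℓ size :=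
      PiTensorProduct.singleAlgHom (R := ℂ) (A := fun i => Hecke ℓ (size i)) i
    exact hecke_induction (S.comap ι) (hu i) (fun g =>
      gGroup_induction ((S.comap ι).toSubmonoid.comap (gH ℓ (size i))) (hd i) (hs i) g) x
  induction a using PiTensorProduct.induction_on with
  | smul_tprod r x =>
    refine S.smul_mem ?_ r
    exact Submonoid.pi_mem_of_mulSingle_mem
      (H := S.toSubmonoid.comap (PiTensorProduct.tprodMonoidHom ℂ)) x fun i => h1 i (x i)
  | add a b ha hb => exact S.add_mem ha hb

/-- The elements of an algebra whose action a linear map intertwines. -/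
def equivariantSubalgebra {A N W : Type} [Semiring A] [Algebra ℂ A] [AddCommMonoid N] [Module ℂ N]
    [AddCommMonoid W] [Module ℂ W] (ρ : A →ₐ[ℂ] Module.End ℂ N) (σ : A →ₐ[ℂ] Module.End ℂ W)
    (Θ : N →ₗ[ℂ] W) : Subalgebra ℂ A where
  carrier := {a | Θ ∘ₗ ρ a = σ a ∘ₗ Θ}
  mul_mem' := by
    intro a b ha hb
    change _ = _ at ha hb
    change _ = _
    rw [map_mul, map_mul, Module.End.mul_eq_comp, Module.End.mul_eq_comp, ← LinearMap.comp_assoc, ha,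
      LinearMap.comp_assoc, hb, LinearMap.comp_assoc]
  add_mem' := by
    intro a b ha hb
    change _ = _ at ha hb
    change _ = _
    rw [map_add, map_add, LinearMap.comp_add, LinearMap.add_comp, ha, hb]
  algebraMap_mem' := by
    intro r
    change _ = _
    ext x
    simp [Algebra.algebraMap_eq_smul_one]

theorem mem_equivariantSubalgebra {A N W : Type} [Semiring A] [Algebra ℂ A] [AddCommMonoid N] [Module ℂ N]
    [AddCommMonoid W] [Module ℂ W] {ρ : A →ₐ[ℂ] Module.End ℂ N} {σ : A →ₐ[ℂ] Module.End ℂ W}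
    {Θ : N →ₗ[ℂ] W} {a : A} : a ∈ equivariantSubalgebra ρ σ Θ ↔ Θ ∘ₗ ρ a = σ a ∘ₗ Θ := Iff.rfl

end YoungSubalgebra

namespace SkewShape.Presentation

variable {ℓ : ℕ} {D : SkewShape ℓ} (P : Presentation D)

/-- The vector of a factor attached to a filling. -/
noncomputable abbrev fvec (i : Fin P.k) (U : SkewBox (P.outer i) (P.inner i) ≃ Fin (P.size i)) :
    P.Factor i := skewVec (P.inner_le_outer i) _ U

theorem update_fvec (U : ∀ i, SkewBox (P.outer i) (P.inner i) ≃ Fin (P.size i)) (i : Fin P.k)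
    (V : SkewBox (P.outer i) (P.inner i) ≃ Fin (P.size i)) :
    Function.update (fun i => P.fvec i (U i)) i (P.fvec i V) =
      fun j => P.fvec j (Function.update U i V j) := by
  funext j
  by_cases hj : j = i
  · subst hj; simp
  · simp [Function.update_of_ne hj]

variable [NeZero ℓ]

theorem shiftAut_uH {n : ℕ} (κ : ℂ) (i : Fin n) :
    shiftAut ℓ n κ (uH i) = uH i + algebraMap ℂ _ κ := heckeLift_uH _ _ _ _ i

theorem shiftAut_gH {n : ℕ} (κ : ℂ) (g : GGroup ℓ n) : shiftAut ℓ n κ (gH ℓ n g) = gH ℓ n g :=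
  heckeLift_gH _ _ _ _ g

theorem factor_uH (i : Fin P.k) (U : SkewBox (P.outer i) (P.inner i) ≃ Fin (P.size i))
    (j : Fin (P.size i)) :
    P.factor i (uH j) (P.fvec i U) =
      ((ℓ : ℂ) * P.boxPoset.ct (P.cellBox ⟨i, U.symm j⟩)) • P.fvec i U := by
  have hct : P.boxPoset.ct (P.cellBox ⟨i, U.symm j⟩) =
      (((U.symm j).1.2.2 : ℂ) - ((U.symm j).1.2.1 : ℂ)) + P.α i := P.cellBox_ct _
  rw [factor, AlgHom.comp_apply, shiftAut_uH, map_add, AlgHom.commutes, LinearMap.add_apply, skewRep_uH,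
    Module.algebraMap_end_apply, ← add_smul, hct]
  congr 1
  ring

theorem factor_diagAt (i : Fin P.k) (U : SkewBox (P.outer i) (P.inner i) ≃ Fin (P.size i))
    (j : Fin (P.size i)) (ε : rootsOfUnity ℓ ℂ) :
    P.factor i (gH ℓ _ (diagAt j ε)) (P.fvec i U) =
      (((ε : ℂˣ) : ℂ) ^ (P.boxPoset.coord (P.cellBox ⟨i, U.symm j⟩) : ℕ)) • P.fvec i U := by
  rw [factor, AlgHom.comp_apply, shiftAut_gH, skewRep_diagAt]
  rfl

theorem factor_simpleRefl (i : Fin P.k) (U : SkewBox (P.outer i) (P.inner i) ≃ Fin (P.size i))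
    (j : ℕ) (hj : j + 1 < P.size i) :
    P.factor i (gH ℓ _ (simpleRefl j hj)) (P.fvec i U) =
      P.boxPoset.pco (P.cellBox ⟨i, U.symm ⟨j, Nat.lt_of_succ_lt hj⟩⟩)
        (P.cellBox ⟨i, U.symm ⟨j + 1, hj⟩⟩) • P.fvec i U +
      P.boxPoset.qco (P.cellBox ⟨i, U.symm ⟨j, Nat.lt_of_succ_lt hj⟩⟩)
        (P.cellBox ⟨i, U.symm ⟨j + 1, hj⟩⟩) • P.fvec i (BoxPoset.swapT U j hj) := by
  rw [factor, AlgHom.comp_apply, shiftAut_gH, skewRep_simpleRefl, pco_cellBox, qco_cellBox]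

/-- The basis of the tensor product of the factors. -/
noncomputable def tensorBasis :
    Module.Basis (∀ i, SkewTab (P.outer i) (P.inner i) (P.size i)) ℂ (⨂[ℂ] i, P.Factor i) :=
  Basis.piTensorProduct fun i => skewBasis (P.inner_le_outer i) (P.size i)

theorem tensorBasis_apply (U : ∀ i, SkewTab (P.outer i) (P.inner i) (P.size i)) :
    P.tensorBasis U = PiTensorProduct.tprod ℂ fun i => P.fvec i (U i).1 := by
  rw [tensorBasis, Basis.piTensorProduct_apply]
  simp only [skewBasis_apply]

/-- The map from the tensor product of the factors to the module with basis the standard tableaux. -/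
noncomputable def joinMap : (⨂[ℂ] i, P.Factor i) →ₗ[ℂ] P.boxPoset.W P.n :=
  P.tensorBasis.constr ℂ fun U => P.boxPoset.vec (P.joinTab fun i => (U i).1)

theorem joinMap_tprod (U : ∀ i, SkewBox (P.outer i) (P.inner i) ≃ Fin (P.size i)) :
    P.joinMap (PiTensorProduct.tprod ℂ fun i => P.fvec i (U i)) = P.boxPoset.vec (P.joinTab U) := by
  by_cases h : ∀ i, IsSkewStd (U i)
  · have := P.tensorBasis_apply fun i => ⟨U i, h i⟩
    rw [← this, joinMap, Module.Basis.constr_basis]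
  · push Not at h
    obtain ⟨i, hi⟩ := h
    rw [MultilinearMap.map_coord_zero _ i (skewVec_of_not _ hi), map_zero,
      BoxPoset.vec_of_not fun hs => hi (P.isSkewStd_of_joinTab U hs i)]

theorem joinMap_equivariant (a : YoungAlg ℓ P.size) :
    P.joinMap ∘ₗ tensorRep (N := P.Factor) P.factor a =
      P.boxPoset.heckeRep P.n (youngHom ℓ P.size a) ∘ₗ P.joinMap := by
  refine (mem_equivariantSubalgebra (ρ := tensorRep (N := P.Factor) P.factor)
    (σ := (P.boxPoset.heckeRep P.n).comp (youngHom ℓ P.size)) (Θ := P.joinMap)).1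
    (youngAlg_induction _ (fun i j => ?_) (fun i j ε => ?_) (fun i j hj => ?_) a)
  all_goals
    rw [mem_equivariantSubalgebra]
    refine P.tensorBasis.ext fun U => ?_
    rw [LinearMap.comp_apply, LinearMap.comp_apply, AlgHom.comp_apply, youngHom_single, tensorBasis_apply,
      tensorRep_single, joinMap_tprod]
  · rw [heckeShift_uH, BoxPoset.heckeRep_uH, joinTab_symm_blockEmb, factor_uH, MultilinearMap.map_update_smul,
      Function.update_eq_self, map_smul, joinMap_tprod]
  · rw [heckeShift_gH, embGroup_diagAt, BoxPoset.heckeRep_diagAt, joinTab_symm_blockEmb, factor_diagAt,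
      MultilinearMap.map_update_smul, Function.update_eq_self, map_smul, joinMap_tprod]
  · have e1 := P.joinTab_symm_blockEmb (fun i => (U i).1) i ⟨j, Nat.lt_of_succ_lt hj⟩
    have e2 := P.joinTab_symm_blockEmb (fun i => (U i).1) i ⟨j + 1, hj⟩
    rw [heckeShift_gH, embGroup_shift_simpleRefl, BoxPoset.heckeRep_simpleRefl, factor_simpleRefl,
      MultilinearMap.map_update_add, MultilinearMap.map_update_smul, MultilinearMap.map_update_smul,
      Function.update_eq_self, map_add, map_smul, map_smul, joinMap_tprod, update_fvec, joinMap_tprod]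
    rw [P.joinTab_swap (fun i => (U i).1) i j hj, ← e1, ← e2]
    rfl

end SkewShape.Presentation

namespace SkewShape.Presentation

variable {ℓ : ℕ} {D : SkewShape ℓ} (P : Presentation D)

/-- The permutations that are increasing on every block. -/
abbrev BlockMono : Type :=
  {w : Equiv.Perm (Fin P.n) // ∀ i, StrictMono fun a => w (blockEmb P.size i a)}

theorem card_le : Nat.card (P.BlockMono × ∀ i, SkewTab (P.outer i) (P.inner i) (P.size i)) ≤
    Nat.card (P.boxPoset.Tab P.n) := by
  refine Nat.card_le_card_of_injective
    (fun p => ⟨(P.joinTab fun i => (p.2 i).1).trans p.1.1,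
      P.joinTab_trans_isStd _ (fun i => (p.2 i).2) _ p.1.2⟩) ?_
  rintro ⟨⟨w, hw⟩, U⟩ ⟨⟨w', hw'⟩, U'⟩ h
  obtain ⟨h1, h2⟩ := P.joinTab_trans_injective hw hw' (congrArg Subtype.val h)
  refine Prod.ext (Subtype.ext h1) (funext fun i => Subtype.ext ?_)
  exact congrFun h2 i

variable [NeZero ℓ]

/-- The map from the tensor product of the factors to the induced module. -/
noncomputable abbrev sdOne : (⨂[ℂ] i, P.Factor i) →ₗ[ℂ] P.SD :=
  indOne (youngHom ℓ P.size) (tensorRep (N := P.Factor) P.factor)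

theorem heckeShift_smul_sdOne (i : Fin P.k) (h : Hecke ℓ (P.size i)) (x : ⨂[ℂ] i, P.Factor i) :
    heckeShift ℓ (blockStart P.size i) (P.size i) P.n (blockStart_le P.size i) h • P.sdOne x =
      P.sdOne (tensorRep (N := P.Factor) P.factor (PiTensorProduct.singleAlgHom i h) x) := by
  rw [← map_smul_indOne, youngHom_single]

theorem exists_uH_smul_sdOne (m : Fin P.n) (x : ⨂[ℂ] i, P.Factor i) :
    ∃ y, (uH m : Hecke ℓ P.n) • P.sdOne x = P.sdOne y := by
  obtain ⟨⟨i, a⟩, rfl⟩ := (blockEquiv P.size).surjective m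
  rw [blockEquiv_apply, ← heckeShift_uH, heckeShift_smul_sdOne]
  exact ⟨_, rfl⟩

theorem exists_diagAt_smul_sdOne (m : Fin P.n) (ε : rootsOfUnity ℓ ℂ) (x : ⨂[ℂ] i, P.Factor i) :
    ∃ y, gH ℓ P.n (diagAt m ε) • P.sdOne x = P.sdOne y := by
  obtain ⟨⟨i, a⟩, rfl⟩ := (blockEquiv P.size).surjective m
  rw [blockEquiv_apply, ← embGroup_diagAt, ← heckeShift_gH, heckeShift_smul_sdOne]
  exact ⟨_, rfl⟩

theorem exists_simpleRefl_smul_sdOne (i : Fin P.k) (j : ℕ) (hj : j + 1 < P.size i)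
    (x : ⨂[ℂ] i, P.Factor i) :
    ∃ y, gH ℓ P.n (simpleRefl (blockStart P.size i + j) (P.blockEmb_lt (j := j + 1) i hj)) • P.sdOne x =
      P.sdOne y := by
  have := P.heckeShift_smul_sdOne i (gH ℓ _ (simpleRefl j hj)) x
  rw [heckeShift_gH, embGroup_shift_simpleRefl] at this
  exact ⟨_, this⟩

/-- The vectors `w ⊗ v_U`, for `w` increasing on every block, in the induced module. -/
noncomputable def spanVec (p : P.BlockMono × ∀ i, SkewTab (P.outer i) (P.inner i) (P.size i)) : P.SD :=
  gH ℓ P.n (permMat p.1.1) • P.sdOne (P.tensorBasis p.2)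

/-- The span of the vectors `w ⊗ v_U`. -/
noncomputable abbrev spanSub : Submodule ℂ P.SD := Submodule.span ℂ (Set.range P.spanVec)

theorem permMat_smul_mem (w : Equiv.Perm (Fin P.n)) : ∀ x : ⨂[ℂ] i, P.Factor i,
    gH ℓ P.n (permMat w) • P.sdOne x ∈ P.spanSub := by
  induction w using perm_descent_induction with
  | h w ih =>
    intro x
    by_cases hw : ∀ i, StrictMono fun a => w (blockEmb P.size i a)
    · have hx : x ∈ Submodule.span ℂ (Set.range P.tensorBasis) := P.tensorBasis.mem_span x
      induction hx using Submodule.span_induction with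
      | mem x hx =>
        obtain ⟨U, rfl⟩ := hx
        exact Submodule.subset_span ⟨(⟨w, hw⟩, U), rfl⟩
      | zero => rw [map_zero, smul_zero]; exact Submodule.zero_mem _
      | add x y _ _ hx hy => rw [map_add, smul_add]; exact Submodule.add_mem _ hx hy
      | smul r x _ hx => rw [map_smul, smul_comm]; exact Submodule.smul_mem _ r hx
    · push Not at hw
      obtain ⟨i, hi⟩ := hw
      have hdesc : ∃ (j : ℕ) (hj : j + 1 < P.size i),
          w ⟨blockStart P.size i + j + 1, P.blockEmb_lt (j := j + 1) i hj⟩ <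
            w ⟨blockStart P.size i + j, P.blockEmb_lt i (Nat.lt_of_succ_lt hj)⟩ := by
        by_contra hcon
        push Not at hcon
        refine hi (Monotone.strictMono_of_injective ?_ (w.injective.comp (blockEmb P.size i).injective))
        have key : ∀ m (a : ℕ) (ha : a + m < P.size i),
            w (blockEmb P.size i ⟨a, by omega⟩) ≤ w (blockEmb P.size i ⟨a + m, ha⟩) := by
          intro m
          induction m with
          | zero => intro a ha; exact le_rfl
          | succ m ihm => intro a ha; exact (ihm a (by omega)).trans (hcon (a + m) ha)
        intro a b hab
        obtain ⟨m, hm⟩ := Nat.exists_eq_add_of_le (Fin.le_def.1 hab)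
        have := key m a (by rw [← hm]; exact b.2)
        rwa [show (⟨a + m, by rw [← hm]; exact b.2⟩ : Fin (P.size i)) = b from Fin.ext hm.symm] at this
      obtain ⟨j, hj, hlt⟩ := hdesc
      obtain ⟨y, hy⟩ := P.exists_simpleRefl_smul_sdOne i j hj x
      have hw' : (permMat w : GGroup ℓ P.n) =
          permMat (w * adjSwap (blockStart P.size i + j) (P.blockEmb_lt (j := j + 1) i hj)) *
            simpleRefl (blockStart P.size i + j) (P.blockEmb_lt (j := j + 1) i hj) := by
        rw [simpleRefl, permMat, permMat, permMat, ← map_mul, mul_assoc, adjSwap_mul_self, mul_one]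
      rw [hw', map_mul, mul_smul, hy]
      exact ih _ (P.blockEmb_lt (j := j + 1) i hj) hlt y

/-- An operator that maps all `w ⊗ x` to the span of the `w ⊗ x` stabilizes this span. -/
theorem smul_mem_spanSub {h : Hecke ℓ P.n}
    (hh : ∀ w x, h • gH ℓ P.n (permMat w) • P.sdOne x ∈ P.spanSub) {m : P.SD} (hm : m ∈ P.spanSub) :
    h • m ∈ P.spanSub := by
  induction hm using Submodule.span_induction with
  | mem x hx =>
    obtain ⟨p, rfl⟩ := hx
    exact hh _ _
  | zero => rw [smul_zero]; exact Submodule.zero_mem _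
  | add x y _ _ hx hy => rw [smul_add]; exact Submodule.add_mem _ hx hy
  | smul r x _ hx => rw [smul_comm]; exact Submodule.smul_mem _ r hx

theorem gH_smul_mem (g : GGroup ℓ P.n) : ∀ m ∈ P.spanSub, gH ℓ P.n g • m ∈ P.spanSub := by
  let S : Submonoid (GGroup ℓ P.n) :=
    { carrier := {g | ∀ m ∈ P.spanSub, gH ℓ P.n g • m ∈ P.spanSub}
      one_mem' := fun m hm => by rwa [map_one, one_smul]
      mul_mem' := fun {a b} ha hb m hm => by rw [map_mul, mul_smul]; exact ha _ (hb _ hm) }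
  refine gGroup_induction S (fun i ε m hm => ?_) (fun i hi m hm => ?_) g
  · refine P.smul_mem_spanSub (fun w x => ?_) hm
    obtain ⟨y, hy⟩ := P.exists_diagAt_smul_sdOne (w.symm i) ε x
    have : diagAt i ε * permMat w = (permMat w * diagAt (w.symm i) ε : GGroup ℓ P.n) := by
      rw [permMat_diagAt, Equiv.apply_symm_apply]
    rw [← mul_smul, ← map_mul, this, map_mul, mul_smul, hy]
    exact P.permMat_smul_mem w y
  · refine P.smul_mem_spanSub (fun w x => ?_) hm
    have : simpleRefl i hi * permMat w = (permMat (adjSwap i hi * w) : GGroup ℓ P.n) := by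
      rw [simpleRefl, permMat, permMat, permMat, ← map_mul]
    rw [← mul_smul, ← map_mul, this]
    exact P.permMat_smul_mem _ x

theorem uH_smul_mem (g : GGroup ℓ P.n) : ∀ m ∈ P.spanSub, (∀ i, (uH i : Hecke ℓ P.n) • m ∈ P.spanSub) →
    ∀ i, (uH i : Hecke ℓ P.n) • gH ℓ P.n g • m ∈ P.spanSub := by
  let S : Submonoid (GGroup ℓ P.n) :=
    { carrier := {g | ∀ m ∈ P.spanSub, (∀ i, (uH i : Hecke ℓ P.n) • m ∈ P.spanSub) →
        ∀ i, (uH i : Hecke ℓ P.n) • gH ℓ P.n g • m ∈ P.spanSub}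
      one_mem' := fun m hm hu i => by rw [map_one, one_smul]; exact hu i
      mul_mem' := fun {a b} ha hb m hm hu i => by
        rw [map_mul, mul_smul]
        exact ha _ (P.gH_smul_mem _ _ hm) (hb m hm hu) i }
  refine gGroup_induction S (fun j ε m hm hu i => ?_) (fun j hj m hm hu i => ?_) g
  · rw [← mul_smul, ← diag_uH, mul_smul]
    exact P.gH_smul_mem _ _ (hu i)
  · set s := gH ℓ P.n (simpleRefl j hj) with hs
    set π : Hecke ℓ P.n := ∑ ε : rootsOfUnity ℓ ℂ,
      gH ℓ P.n (diagAt ⟨j, Nat.lt_of_succ_lt hj⟩ ε * (diagAt ⟨j + 1, hj⟩ ε)⁻¹) with hπ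
    have hsm : ∀ m ∈ P.spanSub, s • m ∈ P.spanSub := P.gH_smul_mem _
    have hπm : ∀ m ∈ P.spanSub, π • m ∈ P.spanSub := by
      intro m hm
      rw [hπ, Finset.sum_smul]
      exact Submodule.sum_mem _ fun ε _ => P.gH_smul_mem _ _ hm
    have hss : s * s = 1 := by
      rw [hs, ← map_mul, simpleRefl, permMat, ← map_mul, adjSwap_mul_self, map_one, map_one]
    have hrel : s * uH ⟨j, Nat.lt_of_succ_lt hj⟩ = uH ⟨j + 1, hj⟩ * s - π := s_uH j hj
    by_cases h2 : (i : ℕ) = j + 1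
    · obtain rfl : i = ⟨j + 1, hj⟩ := Fin.ext h2
      have : uH ⟨j + 1, hj⟩ * s = s * uH ⟨j, Nat.lt_of_succ_lt hj⟩ + π := by
        rw [hrel, sub_add_cancel]
      rw [← mul_smul, this, add_smul, mul_smul]
      exact Submodule.add_mem _ (hsm _ (hu _)) (hπm _ hm)
    · by_cases h1 : (i : ℕ) = j
      · obtain rfl : i = ⟨j, Nat.lt_of_succ_lt hj⟩ := Fin.ext h1
        have : uH ⟨j, Nat.lt_of_succ_lt hj⟩ * s = s * (uH ⟨j + 1, hj⟩ - π * s) := by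
          have h3 : uH ⟨j + 1, hj⟩ - π * s = s * uH ⟨j, Nat.lt_of_succ_lt hj⟩ * s := by
            rw [hrel, sub_mul, mul_assoc _ s s, hss, mul_one]
          rw [h3, mul_assoc s, ← mul_assoc s s, hss, one_mul]
        rw [← mul_smul, this, mul_smul, sub_smul, mul_smul]
        exact hsm _ (Submodule.sub_mem _ (hu _) (hπm _ (hsm _ hm)))
      · rw [← mul_smul, hs, ← s_uH_of_ne j hj i h1 h2, mul_smul]
        exact hsm _ (hu i)

theorem spanSub_eq_top : P.spanSub = ⊤ := by
  have hone : ∀ x, P.sdOne x ∈ P.spanSub := by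
    intro x
    have := P.permMat_smul_mem 1 x
    rwa [permMat, map_one, map_one, one_smul] at this
  let S : Subalgebra ℂ (Hecke ℓ P.n) :=
    { carrier := {h | ∀ m ∈ P.spanSub, h • m ∈ P.spanSub}
      mul_mem' := fun {a b} ha hb m hm => by rw [mul_smul]; exact ha _ (hb _ hm)
      add_mem' := fun {a b} ha hb m hm => by rw [add_smul]; exact Submodule.add_mem _ (ha _ hm) (hb _ hm)
      algebraMap_mem' := fun r m hm => by
        rw [algebraMap_smul]
        exact Submodule.smul_mem _ r hm }
  refine ind_eq_top _ _ _ fun b x => ?_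
  refine hecke_induction S (fun i m hm => ?_) (fun g m hm => P.gH_smul_mem g m hm) b _ (hone x)
  refine P.smul_mem_spanSub (fun w x => P.uH_smul_mem _ _ (hone x) (fun i => ?_) i) hm
  obtain ⟨y, hy⟩ := P.exists_uH_smul_sdOne i x
  rw [hy]
  exact hone y

/-- The induced module is the module with basis the standard tableaux. -/
theorem exists_sdEquiv {ζ : rootsOfUnity ℓ ℂ} (hζ : IsPrimitiveRoot ζ ℓ) :
    ∃ Φ : P.SD ≃ₗ[ℂ] P.boxPoset.W P.n,
      ∀ (h : Hecke ℓ P.n) (m : P.SD), Φ (h • m) = P.boxPoset.heckeRep P.n h (Φ m) := by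
  obtain ⟨Φ, hΦ1, hΦ2⟩ := exists_indLift (P.boxPoset.heckeRep P.n) P.joinMap P.joinMap_equivariant
  have hrange : LinearMap.range Φ = ⊤ := by
    refine BoxPoset.heckeRep_irreducible hζ _ ?_ ?_
    · intro h0
      let U : ∀ i, SkewTab (P.outer i) (P.inner i) (P.size i) :=
        fun i => (exists_skewTab (P.inner_le_outer i)).some
      have h1 : P.boxPoset.vec (P.joinTab fun i => (U i).1) ∈ LinearMap.range Φ :=
        ⟨P.sdOne (P.tensorBasis U), by rw [hΦ1, tensorBasis_apply, joinMap_tprod]⟩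
      rw [h0, Submodule.mem_bot, BoxPoset.vec_of ⟨_, P.joinTab_isStd _ fun i => (U i).2⟩,
        Finsupp.single_eq_zero] at h1
      exact one_ne_zero h1
    · rintro h _ ⟨m, rfl⟩
      exact ⟨h • m, hΦ2 h m⟩
  have hsurj : Function.Surjective Φ := LinearMap.range_eq_top.1 hrange
  have : Fintype (P.BlockMono × ∀ i, SkewTab (P.outer i) (P.inner i) (P.size i)) := Fintype.ofFinite _
  have : Fintype (P.boxPoset.Tab P.n) := Fintype.ofFinite _
  have hfin : Module.Finite ℂ P.SD :=
    ⟨by rw [← P.spanSub_eq_top]; exact Submodule.fg_span (Set.finite_range _)⟩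
  have hle : Module.finrank ℂ P.SD ≤ Module.finrank ℂ (P.boxPoset.W P.n) := by
    have h1 := finrank_range_le_card (R := ℂ) P.spanVec
    have h2 := P.card_le
    rw [Nat.card_eq_fintype_card, Nat.card_eq_fintype_card] at h2
    rw [Set.finrank, show Submodule.span ℂ (Set.range P.spanVec) = ⊤ from P.spanSub_eq_top,
      finrank_top] at h1
    rw [Module.finrank_finsupp_self]
    exact h1.trans h2
  have heq : Module.finrank ℂ P.SD = Module.finrank ℂ (P.boxPoset.W P.n) :=
    le_antisymm hle (LinearMap.finrank_le_finrank_of_surjective hsurj)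
  have hinj : Function.Injective Φ := (LinearMap.injective_iff_surjective_of_finrank_eq_finrank heq).2 hsurj
  exact ⟨LinearEquiv.ofBijective Φ ⟨hinj, hsurj⟩, hΦ2⟩

theorem isSimpleModule_sd {ζ : rootsOfUnity ℓ ℂ} (hζ : IsPrimitiveRoot ζ ℓ) :
    IsSimpleModule (Hecke ℓ P.n) P.SD := by
  obtain ⟨Φ, hΦ⟩ := P.exists_sdEquiv hζ
  have hnt : Nontrivial P.SD := by
    let U : ∀ i, SkewTab (P.outer i) (P.inner i) (P.size i) :=
      fun i => (exists_skewTab (P.inner_le_outer i)).some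
    have : Nonempty (P.boxPoset.Tab P.n) := ⟨⟨_, P.joinTab_isStd _ fun i => (U i).2⟩⟩
    exact Φ.symm.injective.nontrivial
  rw [isSimpleModule_iff]
  refine { eq_bot_or_eq_top := fun N => ?_ }
  by_cases hN : N = ⊥
  · exact Or.inl hN
  · right
    have htop : (N.restrictScalars ℂ).map Φ.toLinearMap = ⊤ := by
      refine BoxPoset.heckeRep_irreducible hζ _ ?_ ?_
      · intro h0
        obtain ⟨m, hm, hm0⟩ := Submodule.exists_mem_ne_zero_of_ne_bot hN
        have : Φ m ∈ (N.restrictScalars ℂ).map Φ.toLinearMap := ⟨m, hm, rfl⟩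
        rw [h0, Submodule.mem_bot, LinearEquiv.map_eq_zero_iff] at this
        exact hm0 this
      · rintro h _ ⟨m, hm, rfl⟩
        exact ⟨h • m, N.smul_mem h hm, hΦ h m⟩
    rw [eq_top_iff]
    intro m _
    obtain ⟨m', hm', he⟩ : Φ m ∈ (N.restrictScalars ℂ).map Φ.toLinearMap := by rw [htop]; trivial
    rwa [← Φ.injective he]

end SkewShape.Presentation

end GHecke

theorem mainTheorem2 {ℓ : ℕ} [NeZero ℓ] (ζ : rootsOfUnity ℓ ℂ) (hζ : IsPrimitiveRoot ζ ℓ)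
    (D D' : GHecke.SkewShape ℓ) (slide : GHecke.SkewShape.DiagonalSlide D D')
    (P : GHecke.SkewShape.Presentation D') :
    Nat.card D.Box = P.n ∧
    IsSimpleModule (GHecke.Hecke ℓ P.n) P.SD ∧
    GHecke.IsUDiagonalizable P.n ζ P.SD ∧
    ∃ v : Module.Basis (D.SYT P.n) ℂ P.SD, ∀ (T : D.SYT P.n) (i : Fin P.n),
      (GHecke.uH i : GHecke.Hecke ℓ P.n) • v T = ((ℓ : ℂ) * (T.boxOf i).ct) • v T ∧
      GHecke.gH ℓ P.n (GHecke.diagAt i ζ) • v T =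
        (((ζ : ℂˣ) : ℂ) ^ ((T.boxOf i).coord : ℕ)) • v T := by
  have hcard : Nat.card D.Box = P.n := by
    rw [Nat.card_congr slide.toIso.toEquiv, P.card_box]
  obtain ⟨Φ, hΦ⟩ := P.exists_sdEquiv hζ
  let v : Module.Basis (D.SYT P.n) ℂ P.SD :=
    (Finsupp.basisSingleOne.map Φ.symm).reindex (slide.tabEquiv P P.n)
  have hv : ∀ T, Φ (v T) = P.boxPoset.vec ((slide.tabEquiv P P.n).symm T).1 := by
    intro T
    rw [GHecke.BoxPoset.vec_of]
    simp [v]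
  have hact : ∀ (T : D.SYT P.n) (i : Fin P.n),
      (GHecke.uH i : GHecke.Hecke ℓ P.n) • v T = ((ℓ : ℂ) * (T.boxOf i).ct) • v T ∧
      GHecke.gH ℓ P.n (GHecke.diagAt i ζ) • v T =
        (((ζ : ℂˣ) : ℂ) ^ ((T.boxOf i).coord : ℕ)) • v T := by
    intro T i
    constructor
    · apply Φ.injective
      rw [hΦ, hv, map_smul, hv, GHecke.BoxPoset.heckeRep_uH, slide.tabEquiv_symm_apply,
        ← slide.ct_eq]
      rfl
    · apply Φ.injective
      rw [hΦ, hv, map_smul, hv, GHecke.BoxPoset.heckeRep_diagAt, slide.tabEquiv_symm_apply,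
        ← slide.coord_eq]
      rfl
  refine ⟨hcard, P.isSimpleModule_sd hζ, ⟨_, v, fun T a ha => ?_⟩, v, hact⟩
  induction ha using Algebra.adjoin_induction with
  | mem a ha =>
    rcases ha with ⟨i, rfl⟩ | ⟨i, rfl⟩
    · exact ⟨_, (hact T i).1⟩
    · exact ⟨_, (hact T i).2⟩
  | algebraMap r => exact ⟨r, algebraMap_smul _ _ _⟩
  | add a b _ _ ha hb =>
    obtain ⟨c, hc⟩ := ha
    obtain ⟨d, hd⟩ := hb
    exact ⟨c + d, by rw [add_smul, add_smul, hc, hd]⟩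
  | mul a b _ _ ha hb =>
    obtain ⟨c, hc⟩ := ha
    obtain ⟨d, hd⟩ := hb
    exact ⟨d * c, by rw [mul_smul, hd, smul_comm, hc, smul_smul]⟩
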